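/- Let $d\ge 1$, $\upsilon>0$, $\eta>0$. For a lattice spacing $\Delta x>0$ put $\Delta t=\eta\Delta x^2$ (diffusive scaling), $c=\Delta x/\Delta t$, $\varepsilon=\upsilon\Delta t/\Delta x^2=\upsilon\eta$. The D$d$Q$(1+2d^2)$ lattice has the velocities $\bm c_k\in\{0,\ \pm c\,e_i,\ \pm c\,e_i\pm c\,e_j\ (i<j)\}$ with weights $w_k=w_0,\,w_1,\,w_{1+2d}$ respectively, $w_0=1-2dw_1-2d(d-1)w_{1+2d}$; $\bm M$ is the matrix of the natural moments $1$; $c_i$; $c_i^2$; $c_ic_j$; $c_ic_j^2$, $c_i^2c_j$, $c_i^2c_j^2$ ($i<j$), and $\bm S$ is diagonal with entries $s_0;\ s_1;\ s_{21};\ s_{22};\ 1$ on these groups, $s_0,s_1,s_{21},s_{22}\in(0,2)$ (for $d=1$, $s_{21}$ is called $s_2$, and $s_{22},w_{1+2d}$ do not occur). The MRT-LB model is $$f_k(\bm x+\bm c_k\Delta t,t+\Delta t)=f_k(\bm x,t)-\sum_l(\bm M^{-1}\bm S\bm M)_{kl}f^{ne}_l(\bm x,t),\qquad f^{ne}_k=f_k-w_k\theta,\quad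 \theta=\sum_kf_k,$$ together with the formulas $$u_i=(2-s_1)\frac{\sum_kc_{ki}f^{ne}_k}{\sum_kf_k},\qquad \partial_i\theta\approx-\frac{s_1}{\Delta t\,c_s^2}\sum_kc_{ki}f_k^{ne},\qquad c_s^2=[2w_1+4(d-1)w_{1+2d}]c^2.$$ Let $W=w_1+2(d-1)w_{1+2d}$ and $$\begin{aligned} R_{d1}&=6[s_{21}(s_1-1)+s_1^2+s_{21}-2s_1]-s_{21}s_1^2+6W[2s_1(2-s_1)+s_{21}(4+s_1^2-6s_1)],\\ R_{d2}&=s_1^2w_{1+2d}[2(s_1-2)(2s_{21}+s_{22})+s_{21}s_{22}(8-3s_1)]-8s_1s_{21}s_{22}W^2\\ &\quad+s_{22}W^2\big(8[s_1+s_{21}-s_1^2+(s_1-1)s_1s_{21}]+(2-s_{21})s_1^3\big),\\ \mathrm{Con}_{d1}&=3s_1[s_{21}+s_1-2]-s_1^2s_{21}+6W(2-s_1)[s_1+s_{21}(1-s_1)],\\ \mathrm{Con}_{d2}&=-s_{22}W^2(s_1-2)(s_1+s_{21}-s_1s_{21})-s_1^2w_{1+2d}(2s_{21}+s_{22}-2s_{21}s_{22}),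 \end{aligned}$$ and for $d=1$ let $R_1,\mathrm{Con}_1$ be $R_{d1},\mathrm{Con}_{d1}$ with $s_{21}=s_2$, $W=w_1$. Theorem 2. (a) Suppose that $\varepsilon=[2w_1+4(d-1)w_{1+2d}](1/s_1-1/2)$ and $R_{d1}=R_{d2}=\mathrm{Con}_{d1}=\mathrm{Con}_{d2}=0$ if $d>1$, respectively $\varepsilon=2w_1(1/s_1-1/2)$ and $R_1=\mathrm{Con}_1=0$ if $d=1$. Then the model is fourth-order accurate in space for the coupled Burgers' equations $\partial_t\bm u+\bm u\cdot\nabla\bm u=\upsilon\nabla^2\bm u$, $\nabla\bm u=(\nabla\bm u)^T$, in the following sense, where $U$ is any open set of space-time and all $O(\cdot)$ are for $\Delta x\to0$, uniform on compact subsets of $U$. (i) (Modified equations.) For each family of solutions $f$ of the scheme that are smooth on $U$ with derivatives bounded on compact sets independently of $\Delta x$, one has $\partial_t\theta=\upsilon\nabla^2\theta+O(\Delta x^4)$ and $-\frac{s_1}{\Delta t c_s^2}\sum_kc_{ki}f_k^{ne}=\partial_i\theta+O(\Delta x^4)$; if moreover $|\theta|$ is bounded away from $0$ on compact sets as $\Delta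 x\to 0$, the computed velocity satisfies $u_i=-2\upsilon\,\partial_i\theta/\theta+O(\Delta x^4)$, $\partial_tu_i+\bm u\cdot\nabla u_i=\upsilon\nabla^2u_i+O(\Delta x^4)$ and $\partial_ju_i=\partial_iu_j+O(\Delta x^4)$. (ii) (Truncation error.) If $\theta$ is smooth and nonvanishing on $U$ with $\partial_t\theta=\upsilon\nabla^2\theta$, then $\bm u=-2\upsilon\nabla\theta/\theta$ solves the coupled Burgers' equations with $\nabla\bm u=(\nabla\bm u)^T$ on $U$, and there is a family $f$, smooth on $U$ with derivatives bounded on compact sets independently of $\Delta x$, with $\sum_kf_k=\theta$, which satisfies the evolution equation up to $O(\Delta x^6)=\Delta t\,O(\Delta x^4)$ and for which the velocity and gradient formulas give $u_i+O(\Delta x^4)$ and $\partial_i\theta+O(\Delta x^4)$. (b) For every $s_0\in(0,2)$, the choice $s_1=\frac{2}{6\varepsilon+1}$, $s_{21}=\frac{24\varepsilon}{(6\varepsilon+1)^2}$, $s_{22}=\frac{4}{6\varepsilon+3}$, $w_1=\frac16-\frac{(d-1)\varepsilon}{3}$, $w_{1+2d}=\frac{\varepsilon}{6}$ (for $d=1$: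 $s_1=\frac{2}{6\varepsilon+1}$, $s_2=\frac{24\varepsilon}{(6\varepsilon+1)^2}$, $w_1=\frac16$) has all relaxation parameters in $(0,2)$ and satisfies all the conditions of (a), so the model is then fourth-order accurate. -/

import Mathlib

open scoped ContDiff

noncomputable section

namespace MRTLB

/-! ### Space-time, partial derivatives, Burgers' equations -/

/-- Points `(x, t)` of `d`-dimensional space and time. -/
abbrev SpaceTime (d : ℕ) : Type := (Fin d → ℝ) × ℝ

/-- The partial derivative with respect to `t`. -/
def dt {d : ℕ} (g : SpaceTime d → ℝ) (p : SpaceTime d) : ℝ :=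
  fderiv ℝ g p (0, 1)

/-- The partial derivative with respect to the `i`-th space coordinate. -/
def dx {d : ℕ} (i : Fin d) (g : SpaceTime d → ℝ) (p : SpaceTime d) : ℝ :=
  fderiv ℝ g p (Pi.single i 1, 0)

/-- The Laplacian in the space variables. -/
def lap {d : ℕ} (g : SpaceTime d → ℝ) (p : SpaceTime d) : ℝ :=
  ∑ i, dx i (dx i g) p

/-- `∂ₜ θ - υ ∇² θ`. -/
def diffusionDefect {d : ℕ} (υ : ℝ) (θ : SpaceTime d → ℝ) (p : SpaceTime d) : ℝ :=
  dt θ p - υ * lap θ p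

/-- The `i`-th component of `∂ₜ u + u ⬝ ∇ u - υ ∇² u`. -/
def burgersDefect {d : ℕ} (υ : ℝ) (u : Fin d → SpaceTime d → ℝ) (i : Fin d)
    (p : SpaceTime d) : ℝ :=
  dt (u i) p + ∑ j, u j p * dx j (u i) p - υ * lap (u i) p

/-- The entry `(i, j)` of `∇ u - (∇ u)ᵀ`, up to sign. -/
def symmetryDefect {d : ℕ} (u : Fin d → SpaceTime d → ℝ) (i j : Fin d) (p : SpaceTime d) : ℝ :=
  dx j (u i) p - dx i (u j) p

/-- The Cole-Hopf transformation `u = - 2 υ ∇ θ / θ`. -/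
def coleHopf {d : ℕ} (υ : ℝ) (θ : SpaceTime d → ℝ) (i : Fin d) (p : SpaceTime d) : ℝ :=
  -2 * υ * (dx i θ p / θ p)

/-! ### The DdQ(1+2d²) lattice -/

/-- Pairs `i < j` of coordinates. -/
abbrev Pair (d : ℕ) : Type := {q : Fin d × Fin d // q.1 < q.2}

/-- A set with `1 + 2 d + 4 (d (d - 1) / 2) = 1 + 2 d²` elements. It indexes the discrete velocities
(the rest velocity, `± eᵢ`, and `± eᵢ ± eⱼ` for `i < j`), and also the natural moments
(`1`; `cᵢ`, `cᵢ²`; and `cᵢ cⱼ`, `cᵢ cⱼ²`, `cᵢ² cⱼ`, `cᵢ² cⱼ²` for `i < j`), so that the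
transformation matrix is square. -/
abbrev Slot (d : ℕ) : Type := Unit ⊕ (Fin d × Bool) ⊕ (Pair d × Bool × Bool)

/-- The sign encoded by a Boolean. -/
def sgn (b : Bool) : ℝ := if b then -1 else 1

/-- The discrete velocities for unit lattice speed. -/
def dir {d : ℕ} : Slot d → Fin d → ℝ
  | .inl _ => 0
  | .inr (.inl (i, b)) => Pi.single i (sgn b)
  | .inr (.inr (q, b, b')) => Pi.single q.1.1 (sgn b) + Pi.single q.1.2 (sgn b')

/-- The monomials of the natural moments. -/
def monomial {d : ℕ} : Slot d → (Fin d → ℝ) → ℝ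
  | .inl _, _ => 1
  | .inr (.inl (i, false)), v => v i
  | .inr (.inl (i, true)), v => v i ^ 2
  | .inr (.inr (q, false, false)), v => v q.1.1 * v q.1.2
  | .inr (.inr (q, false, true)), v => v q.1.1 * v q.1.2 ^ 2
  | .inr (.inr (q, true, false)), v => v q.1.1 ^ 2 * v q.1.2
  | .inr (.inr (q, true, true)), v => v q.1.1 ^ 2 * v q.1.2 ^ 2

/-- The discrete velocities `c_k` for lattice speed `c`. -/
def vel {d : ℕ} (c : ℝ) (k : Slot d) : Fin d → ℝ := c • dir k

/-- The transformation matrix `M` of the natural moments. -/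
def momentMatrix (d : ℕ) (c : ℝ) : Matrix (Slot d) (Slot d) ℝ :=
  Matrix.of fun r k => monomial r (vel c k)

/-! ### The MRT-LB model -/

/-- The free parameters: the relaxation parameters `s₀`, `s₁`, `s₂₁`, `s₂₂`, the weight `w1` of the
velocities `± eᵢ` and the weight `w2` (that is, `w_{1+2d}`) of the velocities `± eᵢ ± eⱼ`.
For `d = 1` the parameter `s21` is the one called `s₂`, and `s22`, `w2` do not enter the model. -/
structure Params where
  s0 : ℝ
  s1 : ℝ
  s21 : ℝ
  s22 : ℝ
  w1 : ℝ
  w2 : ℝ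

/-- The relaxation parameters are located in `(0, 2)`. -/
def Params.Admissible (P : Params) : Prop :=
  P.s0 ∈ Set.Ioo (0 : ℝ) 2 ∧ P.s1 ∈ Set.Ioo (0 : ℝ) 2 ∧
    P.s21 ∈ Set.Ioo (0 : ℝ) 2 ∧ P.s22 ∈ Set.Ioo (0 : ℝ) 2

/-- The diagonal of the relaxation matrix `S`. -/
def relax {d : ℕ} (P : Params) : Slot d → ℝ
  | .inl _ => P.s0
  | .inr (.inl (_, false)) => P.s1
  | .inr (.inl (_, true)) => P.s21
  | .inr (.inr (_, false, false)) => P.s22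
  | .inr (.inr (_, false, true)) => 1
  | .inr (.inr (_, true, _)) => 1

/-- The weight coefficients. -/
def weight {d : ℕ} (P : Params) : Slot d → ℝ
  | .inl _ => 1 - 2 * (d : ℝ) * P.w1 - 2 * (d : ℝ) * ((d : ℝ) - 1) * P.w2
  | .inr (.inl _) => P.w1
  | .inr (.inr _) => P.w2

/-- The collision matrix `M⁻¹ S M`. -/
def collision (d : ℕ) (P : Params) (c : ℝ) : Matrix (Slot d) (Slot d) ℝ :=
  (momentMatrix d c)⁻¹ * Matrix.diagonal (relax P) * momentMatrix d c

/-- The time step `Δt = η Δx²` of the diffusive scaling. -/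
def timeStep (η h : ℝ) : ℝ := η * h ^ 2

/-- The lattice speed `c = Δx / Δt`. -/
def latticeSpeed (η h : ℝ) : ℝ := h / timeStep η h

/-- `c_s² = [2 w₁ + 4 (d - 1) w_{1+2d}] c²`. -/
def soundSq (d : ℕ) (P : Params) (η h : ℝ) : ℝ :=
  (2 * P.w1 + 4 * ((d : ℝ) - 1) * P.w2) * latticeSpeed η h ^ 2

/-- The point `(x + c_k Δt, t + Δt)`. -/
def stream {d : ℕ} (η h : ℝ) (k : Slot d) (p : SpaceTime d) : SpaceTime d :=
  (p.1 + timeStep η h • vel (latticeSpeed η h) k, p.2 + timeStep η h)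

/-- The conserved moment `θ = ∑ₖ f_k`. -/
def density {d : ℕ} (f : Slot d → SpaceTime d → ℝ) (p : SpaceTime d) : ℝ :=
  ∑ k, f k p

/-- The non-equilibrium part `f_k - f_k^{eq}`, with `f_k^{eq} = w_k θ`. -/
def nonEq {d : ℕ} (P : Params) (f : Slot d → SpaceTime d → ℝ) (k : Slot d) (p : SpaceTime d) : ℝ :=
  f k p - weight P k * density f p

/-- Left minus right hand side of the evolution equation
`f_k(x + c_k Δt, t + Δt) = f_k(x, t) - ∑ₗ (M⁻¹ S M)_{kl} (f_l - f_l^{eq})(x, t)`. -/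
def lbDefect {d : ℕ} (P : Params) (η h : ℝ) (f : Slot d → SpaceTime d → ℝ) (k : Slot d)
    (p : SpaceTime d) : ℝ :=
  f k (stream η h k p) -
    (f k p - ∑ l, collision d P (latticeSpeed η h) k l * nonEq P f l p)

/-- The first moment `∑ₖ c_{ki} f_k^{ne}`. -/
def flux {d : ℕ} (P : Params) (η h : ℝ) (f : Slot d → SpaceTime d → ℝ) (i : Fin d)
    (p : SpaceTime d) : ℝ :=
  ∑ k, vel (latticeSpeed η h) k i * nonEq P f k p

/-- The local formula of the model for the velocity,
`u_i = (2 - s₁) ∑ₖ c_{ki} f_k^{ne} / ∑ₖ f_k`. -/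
def lbVelocity {d : ℕ} (P : Params) (η h : ℝ) (f : Slot d → SpaceTime d → ℝ) (i : Fin d)
    (p : SpaceTime d) : ℝ :=
  (2 - P.s1) * (flux P η h f i p / density f p)

/-- The local formula of the model for the gradient,
`∂ᵢ θ = - s₁ / (Δt c_s²) ∑ₖ c_{ki} f_k^{ne}`. -/
def lbGradient {d : ℕ} (P : Params) (η h : ℝ) (f : Slot d → SpaceTime d → ℝ) (i : Fin d)
    (p : SpaceTime d) : ℝ :=
  -(P.s1 / (timeStep η h * soundSq d P η h)) * flux P η h f i p

/-! ### Fourth-order accuracy at the diffusive scaling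

All families are indexed by the lattice spacing `h = Δx > 0`. -/

/-- `g = O(Δx^r)` as `Δx → 0`, uniformly on compact subsets of `U`. -/
def LocBigO {d : ℕ} (U : Set (SpaceTime d)) (r : ℕ) (g : ℝ → SpaceTime d → ℝ) : Prop :=
  ∀ K : Set (SpaceTime d), K ⊆ U → IsCompact K →
    ∃ C h₀ : ℝ, 0 < h₀ ∧ ∀ h, 0 < h → h < h₀ → ∀ p ∈ K, |g h p| ≤ C * h ^ r

/-- A family of distribution functions that are smooth on `U` for all small `Δx`, with all
derivatives bounded independently of `Δx` on compact subsets of `U`. -/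
def RegularFamily {d : ℕ} (U : Set (SpaceTime d)) (f : ℝ → Slot d → SpaceTime d → ℝ) : Prop :=
  ∃ h₀ : ℝ, 0 < h₀ ∧
    (∀ h, 0 < h → h < h₀ → ∀ k, ContDiffOn ℝ ∞ (f h k) U) ∧
    ∀ (k : Slot d) (n : ℕ) (K : Set (SpaceTime d)), K ⊆ U → IsCompact K →
      ∃ C : ℝ, ∀ h, 0 < h → h < h₀ → ∀ p ∈ K, ‖iteratedFDeriv ℝ n (f h k) p‖ ≤ C

/-- For all small `Δx` the evolution equation of the model holds at each point of `U` for which all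
the points it involves lie in `U`. -/
def SolvesScheme {d : ℕ} (U : Set (SpaceTime d)) (P : Params) (η : ℝ)
    (f : ℝ → Slot d → SpaceTime d → ℝ) : Prop :=
  ∃ h₀ : ℝ, 0 < h₀ ∧ ∀ h, 0 < h → h < h₀ → ∀ p ∈ U, (∀ k, stream η h k p ∈ U) →
    ∀ k, lbDefect P η h (f h) k p = 0

/-- On compact subsets of `U` the conserved moment stays away from zero as `Δx → 0`. -/
def DensityAwayFromZero {d : ℕ} (U : Set (SpaceTime d)) (f : ℝ → Slot d → SpaceTime d → ℝ) :
    Prop :=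
  ∀ K : Set (SpaceTime d), K ⊆ U → IsCompact K →
    ∃ δ h₀ : ℝ, 0 < δ ∧ 0 < h₀ ∧ ∀ h, 0 < h → h < h₀ → ∀ p ∈ K, δ ≤ |density (f h) p|

/-- The modified equations of the model are consistent with the differential equations up to
`O(Δx⁴)`: for every regular family of solutions of the scheme, the conserved moment satisfies the
diffusion equation, the gradient and velocity formulas give the gradient and the Cole-Hopf velocity
of the conserved moment, and the computed velocity satisfies the coupled Burgers' equations and the
potential symmetry condition, each up to `O(Δx⁴)`. -/
def FourthOrderModifiedEquation (d : ℕ) (υ η : ℝ) (P : Params) : Prop :=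
  ∀ (U : Set (SpaceTime d)) (f : ℝ → Slot d → SpaceTime d → ℝ), IsOpen U →
    RegularFamily U f → SolvesScheme U P η f →
      LocBigO U 4 (fun h => diffusionDefect υ (density (f h))) ∧
      (∀ i, LocBigO U 4 (fun h p => lbGradient P η h (f h) i p - dx i (density (f h)) p)) ∧
      (DensityAwayFromZero U f →
        (∀ i, LocBigO U 4
          (fun h p => lbVelocity P η h (f h) i p - coleHopf υ (density (f h)) i p)) ∧
        (∀ i, LocBigO U 4 (fun h => burgersDefect υ (lbVelocity P η h (f h)) i)) ∧
        (∀ i j, LocBigO U 4 (fun h => symmetryDefect (lbVelocity P η h (f h)) i j)))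

/-- Truncation error of the model at an exact solution: each nonvanishing smooth solution `θ` of
the diffusion equation, whose Cole-Hopf velocity `u` solves the coupled Burgers' equations, is the
conserved moment of a regular family of distribution functions that satisfies the evolution
equation up to `Δt · O(Δx⁴) = O(Δx⁶)`, and at which the gradient and velocity formulas give
`∇ θ` and `u` up to `O(Δx⁴)`. -/
def FourthOrderTruncation (d : ℕ) (υ η : ℝ) (P : Params) : Prop :=
  ∀ (U : Set (SpaceTime d)) (θ : SpaceTime d → ℝ), IsOpen U → ContDiffOn ℝ ∞ θ U →
    (∀ p ∈ U, θ p ≠ 0) → (∀ p ∈ U, diffusionDefect υ θ p = 0) →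
      (∀ i, ∀ p ∈ U, burgersDefect υ (coleHopf υ θ) i p = 0) ∧
      (∀ i j, ∀ p ∈ U, symmetryDefect (coleHopf υ θ) i j p = 0) ∧
      ∃ f : ℝ → Slot d → SpaceTime d → ℝ,
        RegularFamily U f ∧
        (∀ h, 0 < h → ∀ p ∈ U, density (f h) p = θ p) ∧
        (∀ k, LocBigO U 6 (fun h => lbDefect P η h (f h) k)) ∧
        (∀ i, LocBigO U 4 (fun h p => lbGradient P η h (f h) i p - dx i θ p)) ∧
        (∀ i, LocBigO U 4 (fun h p => lbVelocity P η h (f h) i p - coleHopf υ θ i p))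

/-- The Cole-Hopf based MRT-LB model with viscosity `υ`, `Δt = η Δx²` and parameters `P` is
fourth-order accurate in space at the diffusive scaling. -/
def FourthOrderAccurate (d : ℕ) (υ η : ℝ) (P : Params) : Prop :=
  FourthOrderModifiedEquation d υ η P ∧ FourthOrderTruncation d υ η P

/-! ### The conditions on the parameters -/

/-- The quantity `R₁` for `d = 1`. -/
def R1 (P : Params) : ℝ :=
  6 * (P.s21 * (P.s1 - 1) + P.s1 ^ 2 + P.s21 - 2 * P.s1) - P.s21 * P.s1 ^ 2
    + 6 * P.w1 * (2 * P.s1 * (2 - P.s1) + P.s21 * (4 + P.s1 ^ 2 - 6 * P.s1))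

/-- The quantity `Con₁` for `d = 1`. -/
def Con1 (P : Params) : ℝ :=
  3 * P.s1 * (P.s21 + P.s1 - 2) - P.s1 ^ 2 * P.s21
    + 6 * P.w1 * (2 - P.s1) * (P.s1 + P.s21 * (1 - P.s1))

/-- The quantity `R_{d1}` for `d > 1`. -/
def Rd1 (d : ℕ) (P : Params) : ℝ :=
  6 * (P.s21 * (P.s1 - 1) + P.s1 ^ 2 + P.s21 - 2 * P.s1) - P.s21 * P.s1 ^ 2
    + 6 * (P.w1 + 2 * ((d : ℝ) - 1) * P.w2)
      * (2 * P.s1 * (2 - P.s1) + P.s21 * (4 + P.s1 ^ 2 - 6 * P.s1))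

/-- The quantity `R_{d2}` for `d > 1`. -/
def Rd2 (d : ℕ) (P : Params) : ℝ :=
  P.s1 ^ 2 * P.w2 * (2 * (P.s1 - 2) * (2 * P.s21 + P.s22) + P.s21 * P.s22 * (8 - 3 * P.s1))
    - 8 * P.s1 * P.s21 * P.s22 * (P.w1 + 2 * ((d : ℝ) - 1) * P.w2) ^ 2
    + P.s22 * (P.w1 ^ 2 + 4 * ((d : ℝ) - 1) * P.w2 * (P.w1 + ((d : ℝ) - 1) * P.w2))
      * (8 * (P.s1 + P.s21 - P.s1 ^ 2 + (P.s1 - 1) * P.s1 * P.s21) + (2 - P.s21) * P.s1 ^ 3)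

/-- The quantity `Con_{d1}` for `d > 1`. -/
def Cond1 (d : ℕ) (P : Params) : ℝ :=
  3 * P.s1 * (P.s21 + P.s1 - 2) - P.s1 ^ 2 * P.s21
    + 6 * (P.w1 + 2 * ((d : ℝ) - 1) * P.w2) * (2 - P.s1) * (P.s1 + P.s21 * (1 - P.s1))

/-- The quantity `Con_{d2}` for `d > 1`. -/
def Cond2 (d : ℕ) (P : Params) : ℝ :=
  -(P.s22 * P.w1 ^ 2 + 4 * P.s22 * (P.w1 + ((d : ℝ) - 1) * P.w2) * P.w2 * ((d : ℝ) - 1))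
      * (P.s1 - 2) * (P.s1 + P.s21 - P.s1 * P.s21)
    - P.s1 ^ 2 * P.w2 * (2 * P.s21 + P.s22 - 2 * P.s21 * P.s22)

/-- The conditions on the weights and relaxation parameters, with `ε = υ Δt / Δx²`. -/
def Conditions (d : ℕ) (ε : ℝ) (P : Params) : Prop :=
  (d = 1 → ε = 2 * P.w1 * (1 / P.s1 - 1 / 2) ∧ R1 P = 0 ∧ Con1 P = 0) ∧
  (1 < d → ε = (2 * P.w1 + 4 * ((d : ℝ) - 1) * P.w2) * (1 / P.s1 - 1 / 2) ∧
    Rd1 d P = 0 ∧ Rd2 d P = 0 ∧ Cond1 d P = 0 ∧ Cond2 d P = 0)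

/-- The explicit choice of the parameters. For `d = 1` it reads `s₁ = 2 / (6 ε + 1)`,
`s₂ = 24 ε / (6 ε + 1)²`, `w₁ = 1 / 6`. -/
def explicitParams (d : ℕ) (ε s0 : ℝ) : Params where
  s0 := s0
  s1 := 2 / (6 * ε + 1)
  s21 := 24 * ε / (6 * ε + 1) ^ 2
  s22 := 4 / (6 * ε + 3)
  w1 := 1 / 6 - ((d : ℝ) - 1) * ε / 3
  w2 := ε / 6

end MRTLB

end

/-!
The evolution equation is read as an identity between power series in the lattice spacing `h`
whose coefficients are constant-coefficient differential operators acting on smooth functions.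
Such operators are represented by their symbols, so that all the bookkeeping of the asymptotic
expansion takes place in a commutative algebra over `ℝ`: `X i` stands for `∂ᵢ`, `τ` for `η ∂ₜ`, and
the shift by the `k`-th lattice velocity is the truncated exponential `shiftSymbol h τ X k`.

*Algebra.* In moment space the collision is diagonal and all moments but the zeroth relax, so the
equations for the non-conserved moments can be solved modulo `h ^ 6` by a fixed-point iteration
(`approx`, `approx_moment`); this gives symbols `p k` with `∑ k, p k = 1` that express the
distribution functions through the conserved moment `θ`. As the components of a lattice velocity
satisfy `c ^ 3 = c` and at most two of them are nonzero, streaming closes on the natural moments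
(`streaming_zero` and its companions). Expanding the moments of `p`, the conditions on the
parameters make the remainder of the conserved equation a multiple of the symbol
`y = τ - ε ∑ j, X j ^ 2` of the diffusion equation: it equals `h ^ 2 (1 + h ^ 2 q) y` modulo `h ^ 6`
(`IsExpansion.mass_balanced`). Likewise the first moment of `p` is `-(2 W / s₁) h X i` plus a
multiple of `h ^ 3 y`, modulo `h ^ 5` (`IsExpansion.one_balanced`).

*Modified equations.* For a regular family of solutions, differentiating the scheme and expanding
by Taylor's formula (`taylor_stream`) yields `scheme_jet`. The difference between `f k` and `p k`
applied to `θ` solves the moment equations with vanishing zeroth moment up to `O(h ^ 6)`, and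
streaming gains a power of `h`, so the difference is `O(h ^ 6)` with all its derivatives
(`jet_eq_popSymbol`). The conserved equation becomes `h ^ 2 (1 + h ^ 2 q) y θ = O(h ^ 6)`, which
bootstraps to `y θ = O(h ^ 4)` (`jet_heatSymbol`), and the first moments give the gradient and the
numerator `φ i` of the velocity. Burgers' equations follow from an exact identity for the quotients
`φ i / θ` (`burgersDefect_div`): the defect is linear in the diffusion defects of `φ i` and `θ` and
in the errors `φ j + 2 υ ∂ⱼ θ`, with bounded coefficients.

*Truncation error.* For an exact solution `θ` of the diffusion equation the family `p k` applied to
`θ` has density `θ`, and its defect consists of the Taylor remainder and of symbols that are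
divisible by `h ^ 6` or by `y`, the latter annihilating `θ`.
-/

noncomputable section

namespace MRTLB

/-! ### Moments on the lattice -/

theorem dir_cube {d : ℕ} (k : Slot d) (i : Fin d) : dir k i ^ 3 = dir k i := by
  rcases k with u | ⟨l, b⟩ | ⟨⟨⟨l, m⟩, hlm⟩, b, b'⟩
  · simp [dir]
  · cases b <;> simp only [dir, sgn, Pi.single_apply] <;> split_ifs <;> norm_num
  · have hne : l ≠ m := ne_of_lt hlm
    by_cases h1 : i = l
    · subst h1
      cases b <;> simp [dir, sgn, hne]
      norm_num
    · by_cases h2 : i = m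
      · subst h2
        cases b' <;> simp [dir, sgn, h1]
        norm_num
      · simp [dir, h1, h2]

/-- Each lattice velocity has at most two nonzero components. -/
theorem dir_mul_mul {d : ℕ} (k : Slot d) {i j l : Fin d} (hij : i ≠ j) (hil : i ≠ l)
    (hjl : j ≠ l) : dir k i * dir k j * dir k l = 0 := by
  rcases k with u | ⟨a, b⟩ | ⟨⟨⟨a, a'⟩, ha⟩, b, b'⟩
  · simp [dir]
  · simp only [dir, Pi.single_apply]
    split_ifs <;> simp_all
  · simp only [dir, Pi.add_apply, Pi.single_apply]
    split_ifs <;> simp_all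

variable {R : Type*} [CommRing R] [Algebra ℝ R]

/-- The exponential series truncated after the terms of order five. -/
def texp (x : R) : R := ∑ j ∈ Finset.range 6, (1 / (j.factorial : ℝ)) • x ^ j

/-- The functional equation of the exponential holds modulo the truncation order. -/
theorem texp_add (h a b : R) : h ^ 6 ∣ texp (h * (a + b)) - texp (h * a) * texp (h * b) := by
  -- the quotient collects the products of terms of the two factors whose total order exceeds five
  refine ⟨-((1/120:ℝ) • (a*b^5+a^5*b) + (1/48:ℝ)•(a^2*b^4+a^4*b^2) + (1/36:ℝ)•(a^3*b^3)
     + h * ((1/240:ℝ)•(a^2*b^5+a^5*b^2)+ (1/144:ℝ)•(a^3*b^4+a^4*b^3)) +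
     h^2*((1/720:ℝ)•(a^3*b^5+a^5*b^3) + (1/576:ℝ)•(a^4*b^4)) +
     h^3*((1/2880:ℝ)•(a^4*b^5+a^5*b^4)) + h^4 * ((1/14400:ℝ)•(a^5*b^5))), ?_⟩
  simp only [texp, Finset.sum_range_succ, Finset.sum_range_zero, Nat.factorial]
  push_cast
  algebra

theorem texp_zero : texp (0 : R) = 1 := by
  simp [texp, Finset.sum_range_succ]

theorem texp_sum {ι : Type*} (h : R) (s : Finset ι) (a : ι → R) :
    h ^ 6 ∣ texp (h * ∑ i ∈ s, a i) - ∏ i ∈ s, texp (h * a i) := by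
  classical
  induction s using Finset.induction_on with
  | empty => simp [texp_zero]
  | insert i s hi ih =>
    rw [Finset.sum_insert hi, Finset.prod_insert hi]
    have h1 := texp_add h (a i) (∑ i ∈ s, a i)
    have h2 := ih.mul_left (texp (h * a i))
    convert dvd_add h1 h2 using 1
    ring

/-- The odd part of the truncated exponential. -/
def tsinh (x : R) : R := x + (1 / 6 : ℝ) • x ^ 3 + (1 / 120 : ℝ) • x ^ 5

/-- The even part of the truncated exponential, without its constant term. -/
def tcosh (x : R) : R := (1 / 2 : ℝ) • x ^ 2 + (1 / 24 : ℝ) • x ^ 4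

/-- For `e ∈ {-1, 0, 1}` the exponential of `e • x` is quadratic in `e`. -/
theorem texp_smul {e : ℝ} (he : e ^ 3 = e) (x : R) :
    texp (e • x) = 1 + (e • tsinh x + e ^ 2 • tcosh x) := by
  have h4 : e ^ 4 = e ^ 2 := by rw [pow_succ, he, sq]
  have h5 : e ^ 5 = e := by rw [pow_succ, h4, ← pow_succ, he]
  simp only [texp, Finset.sum_range_succ, Finset.sum_range_zero, Nat.factorial, tsinh, tcosh,
    smul_pow, he, h4, h5]
  push_cast
  algebra

variable {d : ℕ}

/-- The operator symbol of the shift by the lattice velocity `dir k` and one time step, truncated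
after the terms of order five in the lattice spacing `h`; `X i` stands for `∂ᵢ` and `h² τ` for
`Δt ∂ₜ`. -/
def shiftSymbol (h τ : R) (X : Fin d → R) (k : Slot d) : R :=
  texp (h * ((∑ i, dir k i • X i) + h * τ))

/-- The contribution of the `i`-th coordinate to the shift. -/
def axisPart (h : R) (X : Fin d → R) (k : Slot d) (i : Fin d) : R :=
  dir k i • tsinh (h * X i) + dir k i ^ 2 • tcosh (h * X i)

theorem shiftSymbol_prod (h τ : R) (X : Fin d → R) (k : Slot d) :
    h ^ 6 ∣ shiftSymbol h τ X k - texp (h * (h * τ)) * ∏ i, (1 + axisPart h X k i) := by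
  have h1 := texp_add h (∑ i, dir k i • X i) (h * τ)
  have h2 := (texp_sum h Finset.univ (fun i => dir k i • X i)).mul_left (texp (h * (h * τ)))
  have h3 : ∀ i, texp (h * dir k i • X i) = 1 + axisPart h X k i := fun i => by
    rw [mul_smul_comm, texp_smul (dir_cube k i), axisPart]
  simp only [h3] at h2
  convert dvd_add h1 h2 using 1
  rw [shiftSymbol]
  ring

omit [Algebra ℝ R] in
theorem prod_one_add_of_mul_eq_zero {ι : Type*} [DecidableEq ι] (s : Finset ι) (c : R) (a : ι → R)
    (hc : ∀ i ∈ s, c * a i = 0) : c * ∏ i ∈ s, (1 + a i) = c := by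
  induction s using Finset.induction_on with
  | empty => simp
  | insert i s hi ih =>
    rw [Finset.prod_insert hi]
    have h1 := ih fun j hj => hc j (Finset.mem_insert_of_mem hj)
    have h2 := hc i (Finset.mem_insert_self _ _)
    linear_combination (1 + a i) * h1 + h2

omit [Algebra ℝ R] in
theorem prod_one_add_of_mul_mul_eq_zero {ι : Type*} [DecidableEq ι] (s : Finset ι) (c : R)
    (a : ι → R) (hc : ∀ i ∈ s, ∀ j ∈ s, i ≠ j → c * a i * a j = 0) :
    c * ∏ i ∈ s, (1 + a i) = c * (1 + ∑ i ∈ s, a i) := by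
  induction s using Finset.induction_on with
  | empty => simp
  | insert i s hi ih =>
    rw [Finset.prod_insert hi, Finset.sum_insert hi]
    have h1 := ih fun j hj l hl => hc j (Finset.mem_insert_of_mem hj) l
      (Finset.mem_insert_of_mem hl)
    have h2 : c * a i * ∑ j ∈ s, a j = 0 := by
      rw [Finset.mul_sum]
      refine Finset.sum_eq_zero fun j hj => hc i (Finset.mem_insert_self _ _) j
        (Finset.mem_insert_of_mem hj) ?_
      rintro rfl
      exact hi hj
    linear_combination (1 + a i) * h1 + h2

/-- If all products of three distinct factors vanish, the product ends with the pairs. -/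
theorem prod_one_add_of_mul_mul_mul_eq_zero {ι : Type*} [DecidableEq ι] (s : Finset ι)
    (a : ι → R) (hc : ∀ i ∈ s, ∀ j ∈ s, ∀ l ∈ s, i ≠ j → i ≠ l → j ≠ l → a i * a j * a l = 0) :
    ∏ i ∈ s, (1 + a i) =
      1 + ∑ i ∈ s, a i + (1 / 2 : ℝ) • ∑ i ∈ s, ∑ j ∈ s.erase i, a i * a j := by
  induction s using Finset.induction_on with
  | empty => simp
  | insert i s hi ih =>
    rw [Finset.prod_insert hi, Finset.sum_insert hi, Finset.sum_insert hi, Finset.erase_insert hi,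
      add_mul, one_mul, prod_one_add_of_mul_mul_eq_zero s (a i) a]
    · rw [ih fun j hj l hl m hm => hc j (Finset.mem_insert_of_mem hj) l
        (Finset.mem_insert_of_mem hl) m (Finset.mem_insert_of_mem hm)]
      have h1 : ∑ j ∈ s, ∑ l ∈ (insert i s).erase j, a j * a l =
          a i * ∑ j ∈ s, a j + ∑ j ∈ s, ∑ l ∈ s.erase j, a j * a l := by
        rw [Finset.mul_sum, ← Finset.sum_add_distrib]
        refine Finset.sum_congr rfl fun j hj => ?_
        have hij : i ≠ j := by rintro rfl; exact hi hj
        rw [Finset.erase_insert_of_ne hij, Finset.sum_insert (by simp [hi])]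
        ring
      rw [h1, ← Finset.mul_sum]
      algebra
    · intro j hj l hl hjl
      refine hc i (Finset.mem_insert_self _ _) j (Finset.mem_insert_of_mem hj) l
        (Finset.mem_insert_of_mem hl) ?_ ?_ hjl
      · rintro rfl; exact hi hj
      · rintro rfl; exact hi hl

/-- The component `dir k i` of a lattice velocity as a constant symbol. -/
def comp (R : Type*) [CommRing R] [Algebra ℝ R] (i : Fin d) (k : Slot d) : R :=
  algebraMap ℝ R (dir k i)

theorem comp_cube (i : Fin d) (k : Slot d) : comp R i k ^ 3 = comp R i k := by
  rw [comp, ← map_pow, dir_cube]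

theorem comp_mul_mul (k : Slot d) {i j l : Fin d} (hij : i ≠ j) (hil : i ≠ l)
    (hjl : j ≠ l) : comp R i k * comp R j k * comp R l k = 0 := by
  rw [comp, comp, comp, ← map_mul, ← map_mul, dir_mul_mul k hij hil hjl, map_zero]

theorem axisPart_eq (h : R) (X : Fin d → R) (k : Slot d) (i : Fin d) :
    axisPart h X k i =
      comp R i k * tsinh (h * X i) + comp R i k ^ 2 * tcosh (h * X i) := by
  rw [axisPart, comp, ← map_pow, Algebra.smul_def, Algebra.smul_def]

/-- The `φ`-moment of `p`. Functions and symbols on the lattice are both of interest as `p`, hence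
the values in an arbitrary real vector space. -/
def moment {V : Type*} [AddCommMonoid V] [Module ℝ V] (φ : Slot d → ℝ) (p : Slot d → V) : V :=
  ∑ k, φ k • p k

/-- The lattice monomial `cᵢ`. -/
def mono1 (i : Fin d) (k : Slot d) : ℝ := dir k i
/-- The lattice monomial `cᵢ cⱼ`. -/
def mono2 (i j : Fin d) (k : Slot d) : ℝ := dir k i * dir k j
/-- The lattice monomial `cᵢ cⱼ²`. -/
def mono3 (i j : Fin d) (k : Slot d) : ℝ := dir k i * dir k j ^ 2
/-- The lattice monomial `cᵢ² cⱼ²`. -/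
def mono4 (i j : Fin d) (k : Slot d) : ℝ := dir k i ^ 2 * dir k j ^ 2

theorem moment_mono1 (i : Fin d) (p : Slot d → R) :
    moment (mono1 i) p = ∑ k, comp R i k * p k := by
  simp [moment, mono1, comp, Algebra.smul_def]

theorem moment_mono2 (i j : Fin d) (p : Slot d → R) :
    moment (mono2 i j) p = ∑ k, comp R i k * comp R j k * p k := by
  simp [moment, mono2, comp, Algebra.smul_def]

theorem moment_mono3 (i j : Fin d) (p : Slot d → R) :
    moment (mono3 i j) p = ∑ k, comp R i k * comp R j k ^ 2 * p k := by
  simp [moment, mono3, comp, Algebra.smul_def]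

theorem moment_mono4 (i j : Fin d) (p : Slot d → R) :
    moment (mono4 i j) p = ∑ k, comp R i k ^ 2 * comp R j k ^ 2 * p k := by
  simp [moment, mono4, comp, Algebra.smul_def]

omit [Algebra ℝ R] in
theorem sum_congr_dvd {h : R} {a b : Slot d → R} (p : Slot d → R)
    (H : ∀ k, h ^ 6 ∣ a k - b k) :
    h ^ 6 ∣ (∑ k, a k * p k) - ∑ k, b k * p k := by
  rw [← Finset.sum_sub_distrib]
  refine Finset.dvd_sum fun k _ => ?_
  rw [← sub_mul]
  exact (H k).mul_right _

/-- Streaming of the zeroth moment. -/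
theorem streaming_zero (h τ : R) (X : Fin d → R) (p : Slot d → R) :
    h ^ 6 ∣ (∑ k, shiftSymbol h τ X k * p k) - texp (h * (h * τ)) * ((∑ k, p k) +
      ∑ i, (tsinh (h * X i) * moment (mono1 i) p + tcosh (h * X i) * moment (mono2 i i) p) +
      ∑ i, ∑ j ∈ Finset.univ.erase i, (1 / 2 : ℝ) • (
        tsinh (h * X i) * tsinh (h * X j) * moment (mono2 i j) p
        + tsinh (h * X i) * tcosh (h * X j) * moment (mono3 i j) p
        + tcosh (h * X i) * tsinh (h * X j) * moment (mono3 j i) p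
        + tcosh (h * X i) * tcosh (h * X j) * moment (mono4 i j) p)) := by
  convert sum_congr_dvd p (shiftSymbol_prod h τ X) using 2
  simp_rw [mul_assoc, ← Finset.mul_sum]
  congr 1
  have H : ∀ k, ∏ i, (1 + axisPart h X k i) = _ := fun k =>
    prod_one_add_of_mul_mul_mul_eq_zero Finset.univ (axisPart h X k) (by
      intro i _ j _ l _ hij hil hjl
      simp only [axisPart_eq]
      linear_combination ((tsinh (h * X i) + comp R i k * tcosh (h * X i)) *
        (tsinh (h * X j) + comp R j k * tcosh (h * X j)) *
        (tsinh (h * X l) + comp R l k * tcosh (h * X l))) * comp_mul_mul (R := R) k hij hil hjl)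
  simp_rw [H, add_mul, one_mul, Finset.sum_add_distrib]
  congr 1
  · congr 1
    simp_rw [Finset.sum_mul, axisPart_eq]
    rw [Finset.sum_comm, ← Finset.sum_add_distrib]
    refine Finset.sum_congr rfl fun i _ => ?_
    rw [moment_mono1, moment_mono2, Finset.mul_sum, Finset.mul_sum, ← Finset.sum_add_distrib]
    exact Finset.sum_congr rfl fun k _ => by ring
  · simp_rw [smul_mul_assoc, ← Finset.smul_sum, Finset.sum_mul]
    congr 1
    rw [Finset.sum_comm]
    refine Finset.sum_congr rfl fun i _ => ?_
    rw [Finset.sum_comm]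
    refine Finset.sum_congr rfl fun j _ => ?_
    rw [moment_mono2, moment_mono3, moment_mono3, moment_mono4]
    simp_rw [Finset.mul_sum, ← Finset.sum_add_distrib, axisPart_eq]
    exact Finset.sum_congr rfl fun k _ => by ring

theorem comp_mul_shiftSymbol (h τ : R) (X : Fin d → R) (k : Slot d) (i : Fin d) :
    h ^ 6 ∣ comp R i k * shiftSymbol h τ X k - texp (h * (h * τ)) *
      (((1 + tcosh (h * X i)) * comp R i k + tsinh (h * X i) * comp R i k ^ 2) *
      (1 + ∑ j ∈ Finset.univ.erase i, axisPart h X k j)) := by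
  have h0 := (shiftSymbol_prod h τ X k).mul_left (comp R i k)
  convert h0 using 1
  rw [← Finset.mul_prod_erase Finset.univ _ (Finset.mem_univ i)]
  have h1 := prod_one_add_of_mul_mul_eq_zero (Finset.univ.erase i) (comp R i k)
    (axisPart h X k) (by
      intro j hj l hl hjl
      simp only [axisPart_eq]
      linear_combination (
        (tsinh (h * X j) + comp R j k * tcosh (h * X j)) *
        (tsinh (h * X l) + comp R l k * tcosh (h * X l))) * comp_mul_mul (R := R) k
          (Finset.ne_of_mem_erase hj).symm (Finset.ne_of_mem_erase hl).symm hjl)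
  rw [axisPart_eq h X k i]
  linear_combination texp (h * (h * τ)) *
    (1 + comp R i k * tsinh (h * X i) + comp R i k ^ 2 * tcosh (h * X i)) * h1 +
    texp (h * (h * τ)) * tcosh (h * X i) * (1 + ∑ j ∈ Finset.univ.erase i, axisPart h X k j) *
      comp_cube (R := R) i k

theorem comp_sq_mul_shiftSymbol (h τ : R) (X : Fin d → R) (k : Slot d) (i : Fin d) :
    h ^ 6 ∣ comp R i k * comp R i k * shiftSymbol h τ X k - texp (h * (h * τ)) *
      (((1 + tcosh (h * X i)) * comp R i k ^ 2 + tsinh (h * X i) * comp R i k) *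
      (1 + ∑ j ∈ Finset.univ.erase i, axisPart h X k j)) := by
  convert (comp_mul_shiftSymbol h τ X k i).mul_left (comp R i k) using 1
  linear_combination texp (h * (h * τ)) * tsinh (h * X i) *
    (1 + ∑ j ∈ Finset.univ.erase i, axisPart h X k j) * comp_cube (R := R) i k

theorem comp_mul_comp_mul_shiftSymbol (h τ : R) (X : Fin d → R) (k : Slot d) {i j : Fin d}
    (hij : i ≠ j) :
    h ^ 6 ∣ comp R i k * comp R j k * shiftSymbol h τ X k - texp (h * (h * τ)) *
      (((1 + tcosh (h * X i)) * comp R i k + tsinh (h * X i) * comp R i k ^ 2) *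
      ((1 + tcosh (h * X j)) * comp R j k + tsinh (h * X j) * comp R j k ^ 2)) := by
  have h0 := (shiftSymbol_prod h τ X k).mul_left (comp R i k * comp R j k)
  convert h0 using 1
  have hj : j ∈ Finset.univ.erase i := Finset.mem_erase.2 ⟨hij.symm, Finset.mem_univ j⟩
  rw [← Finset.mul_prod_erase Finset.univ _ (Finset.mem_univ i),
    ← Finset.mul_prod_erase (Finset.univ.erase i) _ hj]
  have h1 := prod_one_add_of_mul_eq_zero ((Finset.univ.erase i).erase j) (comp R i k * comp R j k)
    (axisPart h X k) (by
      intro l hl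
      simp only [axisPart_eq]
      linear_combination (tsinh (h * X l) + comp R l k * tcosh (h * X l)) *
        comp_mul_mul (R := R) k hij
          (Finset.ne_of_mem_erase (Finset.mem_of_mem_erase hl)).symm
          (Finset.ne_of_mem_erase hl).symm)
  rw [axisPart_eq h X k i, axisPart_eq h X k j]
  linear_combination texp (h * (h * τ)) *
    (1 + comp R i k * tsinh (h * X i) + comp R i k ^ 2 * tcosh (h * X i)) *
    (1 + comp R j k * tsinh (h * X j) + comp R j k ^ 2 * tcosh (h * X j)) * h1 +
    texp (h * (h * τ)) * tcosh (h * X i) * comp R j k *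
      (1 + comp R j k * tsinh (h * X j) + comp R j k ^ 2 * tcosh (h * X j)) *
      comp_cube (R := R) i k +
    texp (h * (h * τ)) * tcosh (h * X j) *
      ((1 + tcosh (h * X i)) * comp R i k + tsinh (h * X i) * comp R i k ^ 2) *
      comp_cube (R := R) j k

theorem sum_comp_mul_axisParts (h : R) (X : Fin d → R) (p : Slot d → R) (i : Fin d) :
    ∑ k, comp R i k * (1 + ∑ j ∈ Finset.univ.erase i, axisPart h X k j) * p k =
      moment (mono1 i) p + ∑ j ∈ Finset.univ.erase i,
        (tsinh (h * X j) * moment (mono2 i j) p + tcosh (h * X j) * moment (mono3 i j) p) := by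
  simp_rw [mul_add, mul_one, add_mul, Finset.sum_add_distrib, ← moment_mono1]
  congr 1
  rw [← Finset.sum_add_distrib]
  simp_rw [Finset.mul_sum, Finset.sum_mul]
  rw [Finset.sum_comm]
  refine Finset.sum_congr rfl fun j _ => ?_
  rw [moment_mono2, moment_mono3]
  simp_rw [Finset.mul_sum, ← Finset.sum_add_distrib, axisPart_eq]
  exact Finset.sum_congr rfl fun k _ => by ring

theorem sum_comp_sq_mul_axisParts (h : R) (X : Fin d → R) (p : Slot d → R) (i : Fin d) :
    ∑ k, comp R i k ^ 2 * (1 + ∑ j ∈ Finset.univ.erase i, axisPart h X k j) * p k =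
      moment (mono2 i i) p + ∑ j ∈ Finset.univ.erase i,
        (tsinh (h * X j) * moment (mono3 j i) p + tcosh (h * X j) * moment (mono4 i j) p) := by
  simp_rw [mul_add, mul_one, add_mul, Finset.sum_add_distrib]
  congr 1
  · rw [moment_mono2]
    exact Finset.sum_congr rfl fun k _ => by ring
  rw [← Finset.sum_add_distrib]
  simp_rw [Finset.mul_sum, Finset.sum_mul]
  rw [Finset.sum_comm]
  refine Finset.sum_congr rfl fun j _ => ?_
  rw [moment_mono3, moment_mono4]
  simp_rw [Finset.mul_sum, ← Finset.sum_add_distrib, axisPart_eq]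
  exact Finset.sum_congr rfl fun k _ => by ring

/-- Streaming of the first moments. -/
theorem streaming_one (h τ : R) (X : Fin d → R) (p : Slot d → R) (i : Fin d) :
    h ^ 6 ∣ moment (mono1 i) (fun k => shiftSymbol h τ X k * p k) - texp (h * (h * τ)) * (
      (1 + tcosh (h * X i)) * (moment (mono1 i) p + ∑ j ∈ Finset.univ.erase i,
        (tsinh (h * X j) * moment (mono2 i j) p + tcosh (h * X j) * moment (mono3 i j) p)) +
      tsinh (h * X i) * (moment (mono2 i i) p + ∑ j ∈ Finset.univ.erase i,
        (tsinh (h * X j) * moment (mono3 j i) p + tcosh (h * X j) * moment (mono4 i j) p))) := by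
  convert sum_congr_dvd p (fun k => comp_mul_shiftSymbol h τ X k i) using 2
  · rw [moment_mono1]
    exact Finset.sum_congr rfl fun k _ => by ring
  · rw [← sum_comp_mul_axisParts, ← sum_comp_sq_mul_axisParts]
    simp_rw [Finset.mul_sum, ← Finset.sum_add_distrib, Finset.mul_sum]
    exact Finset.sum_congr rfl fun k _ => by ring

/-- Streaming of the moments `cᵢ²`. -/
theorem streaming_sq (h τ : R) (X : Fin d → R) (p : Slot d → R) (i : Fin d) :
    h ^ 6 ∣ moment (mono2 i i) (fun k => shiftSymbol h τ X k * p k) - texp (h * (h * τ)) * (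
      (1 + tcosh (h * X i)) * (moment (mono2 i i) p + ∑ j ∈ Finset.univ.erase i,
        (tsinh (h * X j) * moment (mono3 j i) p + tcosh (h * X j) * moment (mono4 i j) p)) +
      tsinh (h * X i) * (moment (mono1 i) p + ∑ j ∈ Finset.univ.erase i,
        (tsinh (h * X j) * moment (mono2 i j) p + tcosh (h * X j) * moment (mono3 i j) p))) := by
  convert sum_congr_dvd p (fun k => comp_sq_mul_shiftSymbol h τ X k i) using 2
  · rw [moment_mono2]
    exact Finset.sum_congr rfl fun k _ => by ring
  · rw [← sum_comp_mul_axisParts, ← sum_comp_sq_mul_axisParts]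
    simp_rw [Finset.mul_sum, ← Finset.sum_add_distrib, Finset.mul_sum]
    exact Finset.sum_congr rfl fun k _ => by ring

/-- Streaming of the moments `cᵢ cⱼ`. -/
theorem streaming_mixed (h τ : R) (X : Fin d → R) (p : Slot d → R) {i j : Fin d} (hij : i ≠ j) :
    h ^ 6 ∣ moment (mono2 i j) (fun k => shiftSymbol h τ X k * p k) - texp (h * (h * τ)) * (
      (1 + tcosh (h * X i)) * (1 + tcosh (h * X j)) * moment (mono2 i j) p +
      (1 + tcosh (h * X i)) * tsinh (h * X j) * moment (mono3 i j) p +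
      tsinh (h * X i) * (1 + tcosh (h * X j)) * moment (mono3 j i) p +
      tsinh (h * X i) * tsinh (h * X j) * moment (mono4 i j) p) := by
  convert sum_congr_dvd p (fun k => comp_mul_comp_mul_shiftSymbol h τ X k hij) using 2
  · rw [moment_mono2]
    exact Finset.sum_congr rfl fun k _ => by ring
  · rw [moment_mono2, moment_mono3, moment_mono3, moment_mono4]
    simp_rw [Finset.mul_sum, ← Finset.sum_add_distrib, Finset.mul_sum]
    exact Finset.sum_congr rfl fun k _ => by ring

/-- Streaming of the moments `cᵢ cⱼ²`. -/
theorem streaming_cubic (h τ : R) (X : Fin d → R) (p : Slot d → R) {i j : Fin d} (hij : i ≠ j) :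
    h ^ 6 ∣ moment (mono3 i j) (fun k => shiftSymbol h τ X k * p k) - texp (h * (h * τ)) * (
      (1 + tcosh (h * X i)) * (1 + tcosh (h * X j)) * moment (mono3 i j) p +
      (1 + tcosh (h * X i)) * tsinh (h * X j) * moment (mono2 i j) p +
      tsinh (h * X i) * (1 + tcosh (h * X j)) * moment (mono4 i j) p +
      tsinh (h * X i) * tsinh (h * X j) * moment (mono3 j i) p) := by
  convert sum_congr_dvd p
    (fun k => by simpa only [mul_sub] using
      (comp_mul_comp_mul_shiftSymbol h τ X k hij).mul_left (comp R j k)) using 2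
  · rw [moment_mono3]
    exact Finset.sum_congr rfl fun k _ => by ring
  · rw [moment_mono2, moment_mono3, moment_mono3, moment_mono4]
    simp_rw [Finset.mul_sum, ← Finset.sum_add_distrib, Finset.mul_sum]
    exact Finset.sum_congr rfl fun k _ => by
      linear_combination -(texp (h * (h * τ)) * tsinh (h * X j) * p k *
        ((1 + tcosh (h * X i)) * comp R i k + tsinh (h * X i) * comp R i k ^ 2)) *
        comp_cube (R := R) j k

/-- Streaming of the moments `cᵢ² cⱼ²`. -/
theorem streaming_quartic (h τ : R) (X : Fin d → R) (p : Slot d → R) {i j : Fin d} (hij : i ≠ j) :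
    h ^ 6 ∣ moment (mono4 i j) (fun k => shiftSymbol h τ X k * p k) - texp (h * (h * τ)) * (
      (1 + tcosh (h * X i)) * (1 + tcosh (h * X j)) * moment (mono4 i j) p +
      (1 + tcosh (h * X i)) * tsinh (h * X j) * moment (mono3 j i) p +
      tsinh (h * X i) * (1 + tcosh (h * X j)) * moment (mono3 i j) p +
      tsinh (h * X i) * tsinh (h * X j) * moment (mono2 i j) p) := by
  convert sum_congr_dvd p
    (fun k => by simpa only [mul_sub] using
      (comp_mul_comp_mul_shiftSymbol h τ X k hij).mul_left (comp R i k * comp R j k)) using 2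
  · rw [moment_mono4]
    exact Finset.sum_congr rfl fun k _ => by ring
  · rw [moment_mono2, moment_mono3, moment_mono3, moment_mono4]
    simp_rw [Finset.mul_sum, ← Finset.sum_add_distrib, Finset.mul_sum]
    exact Finset.sum_congr rfl fun k _ => by
      linear_combination -(texp (h * (h * τ)) * tsinh (h * X i) * p k * comp R j k *
        ((1 + tcosh (h * X j)) * comp R j k + tsinh (h * X j) * comp R j k ^ 2)) *
        comp_cube (R := R) i k - (texp (h * (h * τ)) * tsinh (h * X j) * p k *
        ((1 + tcosh (h * X i)) * comp R i k ^ 2 + tsinh (h * X i) * comp R i k)) *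
        comp_cube (R := R) j k

/-! ### Expansion of the moments -/

section Expansion

variable {R : Type*} [CommRing R] [Algebra ℝ R]

theorem dvd_of_dvd_smul {a x : R} {s : ℝ} (hs : s ≠ 0) (H : a ∣ s • x) : a ∣ x := by
  obtain ⟨y, hy⟩ := H
  refine ⟨s⁻¹ • y, ?_⟩
  rw [mul_smul_comm, ← hy, smul_smul, inv_mul_cancel₀ hs, one_smul]

theorem dvd_smul_right' {a x : R} (s : ℝ) (H : a ∣ x) : a ∣ s • x := by
  obtain ⟨y, rfl⟩ := H
  exact ⟨s • y, (mul_smul_comm _ _ _).symm⟩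

theorem texp_expand (h τ : R) : ∃ r, texp (h * (h * τ)) =
    1 + h ^ 2 * τ + h ^ 4 * ((1 / 2 : ℝ) • τ ^ 2) + h ^ 6 * r := by
  refine ⟨(1/6:ℝ) • τ^3 + h^2 * ((1/24:ℝ) • τ^4) + h^4*((1/120:ℝ) • τ^5), ?_⟩
  simp only [texp, Finset.sum_range_succ, Finset.sum_range_zero, Nat.factorial]
  push_cast
  algebra

theorem texp_expand_four (h τ : R) : ∃ r, texp (h * (h * τ)) = 1 + h ^ 2 * τ + h ^ 4 * r := by
  obtain ⟨r, hr⟩ := texp_expand h τ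
  exact ⟨(1 / 2 : ℝ) • τ ^ 2 + h ^ 2 * r, by rw [hr]; ring⟩

theorem tsinh_expand (h x : R) : ∃ r, tsinh (h * x) =
    h * x + h ^ 3 * ((1 / 6 : ℝ) • x ^ 3) + h ^ 5 * r := by
  refine ⟨(1/120:ℝ) • x^5, ?_⟩
  rw [tsinh]
  algebra

theorem tsinh_expand_three (h x : R) : ∃ r, tsinh (h * x) = h * x + h ^ 3 * r := by
  obtain ⟨r, hr⟩ := tsinh_expand h x
  exact ⟨(1 / 6 : ℝ) • x ^ 3 + h ^ 2 * r, by rw [hr]; ring⟩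

theorem tcosh_expand (h x : R) : tcosh (h * x) =
    h ^ 2 * ((1 / 2 : ℝ) • x ^ 2) + h ^ 4 * ((1 / 24 : ℝ) • x ^ 4) := by
  rw [tcosh]
  algebra

theorem tcosh_expand_two (h x : R) : ∃ r, tcosh (h * x) = h ^ 2 * r :=
  ⟨(1 / 2 : ℝ) • x ^ 2 + h ^ 2 * ((1 / 24 : ℝ) • x ^ 4), by rw [tcosh_expand]; ring⟩

theorem texp_mul_one_add_tcosh (h τ x : R) : ∃ r, texp (h * (h * τ)) * (1 + tcosh (h * x)) =
    1 + h ^ 2 * (τ + (1 / 2 : ℝ) • x ^ 2) + h ^ 4 * r := by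
  obtain ⟨e, he⟩ := texp_expand_four h τ
  refine ⟨e + τ * (1 / 2 : ℝ) • x ^ 2 + (1 / 24 : ℝ) • x ^ 4 +
    h ^ 2 * (e * (1 / 2 : ℝ) • x ^ 2 + τ * (1 / 24 : ℝ) • x ^ 4) +
    h ^ 4 * (e * (1 / 24 : ℝ) • x ^ 4), ?_⟩
  rw [he, tcosh_expand]
  ring

theorem texp_mul_tsinh (h τ x : R) : ∃ r, texp (h * (h * τ)) * tsinh (h * x) =
    h * (x + h ^ 2 * (τ * x + (1 / 6 : ℝ) • x ^ 3) + h ^ 4 * r) := by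
  obtain ⟨e, he⟩ := texp_expand_four h τ
  obtain ⟨r, hr⟩ := tsinh_expand h x
  refine ⟨e * x + τ * (1 / 6 : ℝ) • x ^ 3 + r + h ^ 2 * (τ * r + e * (1 / 6 : ℝ) • x ^ 3) +
    h ^ 4 * (e * r), ?_⟩
  rw [he, hr]
  ring

theorem texp_mul_tcosh_tcosh (h τ x y : R) : ∃ r,
    texp (h * (h * τ)) * ((1 + tcosh (h * x)) * (1 + tcosh (h * y))) = 1 + h ^ 2 * r := by
  obtain ⟨e, he⟩ := texp_mul_one_add_tcosh h τ x
  obtain ⟨c, hc⟩ := tcosh_expand_two h y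
  refine ⟨τ + (1 / 2 : ℝ) • x ^ 2 + h ^ 2 * e + c +
    c * (h ^ 2 * (τ + (1 / 2 : ℝ) • x ^ 2) + h ^ 4 * e), ?_⟩
  rw [← mul_assoc, he, hc]
  ring

theorem texp_mul_tsinh_tcosh (h τ x y : R) : ∃ r,
    texp (h * (h * τ)) * (tsinh (h * x) * (1 + tcosh (h * y))) = h * (x + h ^ 2 * r) := by
  obtain ⟨e, he⟩ := texp_mul_tsinh h τ x
  obtain ⟨c, hc⟩ := tcosh_expand_two h y
  refine ⟨τ * x + (1 / 6 : ℝ) • x ^ 3 + h ^ 2 * e +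
    c * (x + h ^ 2 * (τ * x + (1 / 6 : ℝ) • x ^ 3) + h ^ 4 * e), ?_⟩
  rw [← mul_assoc, he, hc]
  ring

theorem texp_mul_tsinh_tsinh (h τ x y : R) : ∃ r,
    texp (h * (h * τ)) * (tsinh (h * x) * tsinh (h * y)) = h ^ 2 * (x * y + h ^ 2 * r) := by
  obtain ⟨e, he⟩ := texp_mul_tsinh h τ x
  obtain ⟨c, hc⟩ := tsinh_expand_three h y
  refine ⟨(τ * x + (1 / 6 : ℝ) • x ^ 3 + h ^ 2 * e) * (y + h ^ 2 * c) + x * c, ?_⟩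
  rw [← mul_assoc, he, hc]
  ring

variable {d : ℕ} {h τ : R} {X : Fin d → R} {p : Slot d → R} {s1 s21 s22 W w2 : ℝ}

theorem moment_shift_sub (φ : Slot d → ℝ) (a p : Slot d → R) :
    moment φ (fun k => (a k - 1) * p k) = moment φ (fun k => a k * p k) - moment φ p := by
  simp [moment, sub_mul, smul_sub]

/-- The equations for the non-conserved moments of the symbols `p k` of the distribution functions,
up to order `h ^ 6`. The symbols act on the conserved moment, so their sum is `1`; `2 * W` and
`4 * w2` are the second and fourth moments of the equilibrium, and the moments of third and fourth
degree relax with parameter `1`. -/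
structure IsExpansion (h τ : R) (X : Fin d → R) (s1 s21 s22 W w2 : ℝ) (p : Slot d → R) :
    Prop where
  sum_eq : ∑ k, p k = 1
  one : ∀ i, h ^ 6 ∣ moment (mono1 i) (fun k => (shiftSymbol h τ X k - 1) * p k) +
    s1 • moment (mono1 i) p
  sq : ∀ i, h ^ 6 ∣ moment (mono2 i i) (fun k => (shiftSymbol h τ X k - 1) * p k) +
    s21 • (moment (mono2 i i) p - algebraMap ℝ R (2 * W))
  mixed : ∀ i j, i ≠ j → h ^ 6 ∣ moment (mono2 i j) (fun k => (shiftSymbol h τ X k - 1) * p k) +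
    s22 • moment (mono2 i j) p
  cubic : ∀ i j, i ≠ j → h ^ 6 ∣ moment (mono3 i j) (fun k => (shiftSymbol h τ X k - 1) * p k) +
    moment (mono3 i j) p
  quartic : ∀ i j, i ≠ j →
    h ^ 6 ∣ moment (mono4 i j) (fun k => (shiftSymbol h τ X k - 1) * p k) +
    (moment (mono4 i j) p - algebraMap ℝ R (4 * w2))

namespace IsExpansion

variable (H : IsExpansion h τ X s1 s21 s22 W w2 p)
include H

theorem cubic_eq {i j : Fin d} (hij : i ≠ j) : ∃ a b c e, h ^ 6 ∣
    (1 + h ^ 2 * a) * moment (mono3 i j) p + h * (X j + h ^ 2 * b) * moment (mono2 i j) p +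
      h * (X i + h ^ 2 * c) * moment (mono4 i j) p +
      h ^ 2 * (X i * X j + h ^ 2 * e) * moment (mono3 j i) p := by
  obtain ⟨a, ha⟩ := texp_mul_tcosh_tcosh h τ (X i) (X j)
  obtain ⟨b, hb⟩ := texp_mul_tsinh_tcosh h τ (X j) (X i)
  obtain ⟨c, hc⟩ := texp_mul_tsinh_tcosh h τ (X i) (X j)
  obtain ⟨e, he⟩ := texp_mul_tsinh_tsinh h τ (X i) (X j)
  refine ⟨a, b, c, e, ?_⟩
  convert dvd_sub (H.cubic i j hij) (streaming_cubic h τ X p hij) using 1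
  rw [moment_shift_sub, ← ha, ← hb, ← hc, ← he]
  ring

theorem quartic_eq {i j : Fin d} (hij : i ≠ j) : ∃ a b c e, h ^ 6 ∣
    (1 + h ^ 2 * a) * moment (mono4 i j) p + h * (X j + h ^ 2 * b) * moment (mono3 j i) p +
      h * (X i + h ^ 2 * c) * moment (mono3 i j) p +
      h ^ 2 * (X i * X j + h ^ 2 * e) * moment (mono2 i j) p - algebraMap ℝ R (4 * w2) := by
  obtain ⟨a, ha⟩ := texp_mul_tcosh_tcosh h τ (X i) (X j)
  obtain ⟨b, hb⟩ := texp_mul_tsinh_tcosh h τ (X j) (X i)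
  obtain ⟨c, hc⟩ := texp_mul_tsinh_tcosh h τ (X i) (X j)
  obtain ⟨e, he⟩ := texp_mul_tsinh_tsinh h τ (X i) (X j)
  refine ⟨a, b, c, e, ?_⟩
  convert dvd_sub (H.quartic i j hij) (streaming_quartic h τ X p hij) using 1
  rw [moment_shift_sub, ← ha, ← hb, ← hc, ← he]
  ring

theorem mixed_eq {i j : Fin d} (hij : i ≠ j) : ∃ a b c e, h ^ 6 ∣
    (1 + h ^ 2 * a) * moment (mono2 i j) p + h * (X j + h ^ 2 * b) * moment (mono3 i j) p +
      h * (X i + h ^ 2 * c) * moment (mono3 j i) p +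
      h ^ 2 * (X i * X j + h ^ 2 * e) * moment (mono4 i j) p - moment (mono2 i j) p +
      s22 • moment (mono2 i j) p := by
  obtain ⟨a, ha⟩ := texp_mul_tcosh_tcosh h τ (X i) (X j)
  obtain ⟨b, hb⟩ := texp_mul_tsinh_tcosh h τ (X j) (X i)
  obtain ⟨c, hc⟩ := texp_mul_tsinh_tcosh h τ (X i) (X j)
  obtain ⟨e, he⟩ := texp_mul_tsinh_tsinh h τ (X i) (X j)
  refine ⟨a, b, c, e, ?_⟩
  convert dvd_sub (H.mixed i j hij) (streaming_mixed h τ X p hij) using 1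
  rw [moment_shift_sub, ← ha, ← hb, ← hc, ← he]
  ring

theorem dvd_cubic {i j : Fin d} (hij : i ≠ j) : h ∣ moment (mono3 i j) p := by
  obtain ⟨a, b, c, e, ha⟩ := H.cubic_eq hij
  refine (dvd_iff_dvd_of_dvd_sub ⟨h * a * moment (mono3 i j) p +
    (X j + h ^ 2 * b) * moment (mono2 i j) p + (X i + h ^ 2 * c) * moment (mono4 i j) p +
    h * (X i * X j + h ^ 2 * e) * moment (mono3 j i) p, ?_⟩).1
    ((dvd_pow_self h (by norm_num)).trans ha)
  ring

theorem dvd_mixed (h22 : s22 ≠ 0) {i j : Fin d} (hij : i ≠ j) :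
    h ^ 2 ∣ moment (mono2 i j) p := by
  obtain ⟨a, b, c, e, ha⟩ := H.mixed_eq hij
  obtain ⟨m, hm⟩ := H.dvd_cubic hij
  obtain ⟨n, hn⟩ := H.dvd_cubic hij.symm
  refine dvd_of_dvd_smul h22 ((dvd_iff_dvd_of_dvd_sub ⟨a * moment (mono2 i j) p +
    (X j + h ^ 2 * b) * m + (X i + h ^ 2 * c) * n +
    (X i * X j + h ^ 2 * e) * moment (mono4 i j) p, ?_⟩).1
    ((pow_dvd_pow h (by norm_num : 2 ≤ 6)).trans ha))
  rw [hm, hn]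
  ring

theorem quartic_expand {i j : Fin d} (hij : i ≠ j) :
    h ^ 2 ∣ moment (mono4 i j) p - algebraMap ℝ R (4 * w2) := by
  obtain ⟨a, b, c, e, ha⟩ := H.quartic_eq hij
  obtain ⟨m, hm⟩ := H.dvd_cubic hij
  obtain ⟨n, hn⟩ := H.dvd_cubic hij.symm
  refine (dvd_iff_dvd_of_dvd_sub ⟨a * moment (mono4 i j) p +
    (X j + h ^ 2 * b) * n + (X i + h ^ 2 * c) * m +
    (X i * X j + h ^ 2 * e) * moment (mono2 i j) p, ?_⟩).1
    ((pow_dvd_pow h (by norm_num : 2 ≤ 6)).trans ha)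
  rw [hm, hn]
  ring

theorem cubic_expand (h22 : s22 ≠ 0) {i j : Fin d} (hij : i ≠ j) :
    h ^ 3 ∣ moment (mono3 i j) p + h * algebraMap ℝ R (4 * w2) * X i := by
  obtain ⟨a, b, c, e, ha⟩ := H.cubic_eq hij
  obtain ⟨m, hm⟩ := H.dvd_cubic hij
  obtain ⟨n, hn⟩ := H.dvd_cubic hij.symm
  obtain ⟨q, hq⟩ := H.dvd_mixed h22 hij
  obtain ⟨r, hr⟩ := H.quartic_expand hij
  refine (dvd_iff_dvd_of_dvd_sub ⟨a * m + (X j + h ^ 2 * b) * q + X i * r + c * moment (mono4 i j) p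
     + (X i * X j + h ^ 2 * e) * n, ?_⟩).1
    ((pow_dvd_pow h (by norm_num : 3 ≤ 6)).trans ha)
  rw [hm, hn, hq, eq_add_of_sub_eq hr]
  ring

theorem mixed_expand (h22 : s22 ≠ 0) {i j : Fin d} (hij : i ≠ j) :
    h ^ 4 ∣ moment (mono2 i j) p - h ^ 2 * algebraMap ℝ R (4 * w2 / s22) * (X i * X j) := by
  obtain ⟨a, b, c, e, ha⟩ := H.mixed_eq hij
  obtain ⟨m, hm⟩ := H.cubic_expand h22 hij
  obtain ⟨n, hn⟩ := H.cubic_expand h22 hij.symm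
  obtain ⟨q, hq⟩ := H.dvd_mixed h22 hij
  obtain ⟨r, hr⟩ := H.quartic_expand hij
  have hs : s22 • (moment (mono2 i j) p - h ^ 2 * algebraMap ℝ R (4 * w2 / s22) * (X i * X j)) =
      s22 • moment (mono2 i j) p - h ^ 2 * algebraMap ℝ R (4 * w2) * (X i * X j) := by
    have : algebraMap ℝ R s22 * algebraMap ℝ R (4 * w2 / s22) = algebraMap ℝ R (4 * w2) := by
      rw [← map_mul, mul_div_cancel₀ _ h22]
    rw [smul_sub, Algebra.smul_def s22 (_ * _), ← this]
    ring
  refine dvd_of_dvd_smul h22 (hs ▸ (dvd_iff_dvd_of_dvd_sub ⟨a * q + X j * m + X i * n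
     - algebraMap ℝ R (4 * w2) * (b * X i + c * X j - e) + h ^ 2 * (b * m + c * n)
     + X i * X j * r + h ^ 2 * e * r, ?_⟩).1
    ((pow_dvd_pow h (by norm_num : 4 ≤ 6)).trans ha))
  rw [eq_sub_of_add_eq hm, eq_sub_of_add_eq hn, hq, eq_add_of_sub_eq hr]
  ring

theorem one_eq (i : Fin d) : ∃ a b, h ^ 6 ∣
    (1 + h ^ 2 * (τ + (1 / 2 : ℝ) • X i ^ 2) + h ^ 4 * a) *
      (moment (mono1 i) p + ∑ j ∈ Finset.univ.erase i,
        (tsinh (h * X j) * moment (mono2 i j) p + tcosh (h * X j) * moment (mono3 i j) p)) +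
    h * (X i + h ^ 2 * (τ * X i + (1 / 6 : ℝ) • X i ^ 3) + h ^ 4 * b) *
      (moment (mono2 i i) p + ∑ j ∈ Finset.univ.erase i,
        (tsinh (h * X j) * moment (mono3 j i) p + tcosh (h * X j) * moment (mono4 i j) p)) -
    moment (mono1 i) p + s1 • moment (mono1 i) p := by
  obtain ⟨a, ha⟩ := texp_mul_one_add_tcosh h τ (X i)
  obtain ⟨b, hb⟩ := texp_mul_tsinh h τ (X i)
  refine ⟨a, b, ?_⟩
  convert dvd_sub (H.one i) (streaming_one h τ X p i) using 1
  rw [moment_shift_sub, ← ha, ← hb]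
  ring

theorem sq_eq (i : Fin d) : ∃ a b, h ^ 6 ∣
    (1 + h ^ 2 * (τ + (1 / 2 : ℝ) • X i ^ 2) + h ^ 4 * a) *
      (moment (mono2 i i) p + ∑ j ∈ Finset.univ.erase i,
        (tsinh (h * X j) * moment (mono3 j i) p + tcosh (h * X j) * moment (mono4 i j) p)) +
    h * (X i + h ^ 2 * (τ * X i + (1 / 6 : ℝ) • X i ^ 3) + h ^ 4 * b) *
      (moment (mono1 i) p + ∑ j ∈ Finset.univ.erase i,
        (tsinh (h * X j) * moment (mono2 i j) p + tcosh (h * X j) * moment (mono3 i j) p)) -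
    moment (mono2 i i) p + s21 • (moment (mono2 i i) p - algebraMap ℝ R (2 * W)) := by
  obtain ⟨a, ha⟩ := texp_mul_one_add_tcosh h τ (X i)
  obtain ⟨b, hb⟩ := texp_mul_tsinh h τ (X i)
  refine ⟨a, b, ?_⟩
  convert dvd_sub (H.sq i) (streaming_sq h τ X p i) using 1
  rw [moment_shift_sub, ← ha, ← hb]
  ring

/-- The terms of the other coordinates in the streaming of `cᵢ`. -/
theorem odd_line_expand (h22 : s22 ≠ 0) (i : Fin d) :
    h ^ 5 ∣ ∑ j ∈ Finset.univ.erase i,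
      (tsinh (h * X j) * moment (mono2 i j) p + tcosh (h * X j) * moment (mono3 i j) p) -
      h ^ 3 * (X i * ((4 * w2 / s22 - 2 * w2) • ∑ j ∈ Finset.univ.erase i, X j ^ 2)) := by
  rw [Finset.smul_sum, Finset.mul_sum, Finset.mul_sum, ← Finset.sum_sub_distrib]
  refine Finset.dvd_sum fun j hj => ?_
  have hij := (Finset.ne_of_mem_erase hj).symm
  obtain ⟨u, hu⟩ := tsinh_expand_three h (X j)
  obtain ⟨m, hm⟩ := H.cubic_expand h22 hij
  obtain ⟨q, hq⟩ := H.mixed_expand h22 hij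
  rw [hu, tcosh_expand, eq_sub_of_add_eq hm, eq_add_of_sub_eq hq]
  refine ⟨X j * q + u * (algebraMap ℝ R (4 * w2 / s22) * (X i * X j)) + h ^ 2 * (u * q) +
    (1 / 2 : ℝ) • X j ^ 2 * m + (1 / 24 : ℝ) • X j ^ 4 *
      (h ^ 2 * m - algebraMap ℝ R (4 * w2) * X i), ?_⟩
  algebra

/-- The terms of the other coordinates in the streaming of `cᵢ²`. -/
theorem even_line_expand (h22 : s22 ≠ 0) (i : Fin d) :
    h ^ 4 ∣ ∑ j ∈ Finset.univ.erase i,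
      (tsinh (h * X j) * moment (mono3 j i) p + tcosh (h * X j) * moment (mono4 i j) p) -
      h ^ 2 * ((-2 * w2) • ∑ j ∈ Finset.univ.erase i, X j ^ 2) := by
  rw [Finset.smul_sum, Finset.mul_sum, ← Finset.sum_sub_distrib]
  refine Finset.dvd_sum fun j hj => ?_
  have hij := (Finset.ne_of_mem_erase hj).symm
  obtain ⟨u, hu⟩ := tsinh_expand_three h (X j)
  obtain ⟨m, hm⟩ := H.cubic_expand h22 hij.symm
  obtain ⟨q, hq⟩ := H.quartic_expand hij
  rw [hu, tcosh_expand, eq_sub_of_add_eq hm, eq_add_of_sub_eq hq]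
  refine ⟨X j * m - u * (algebraMap ℝ R (4 * w2) * X j) + h ^ 2 * (u * m) +
    (1 / 2 : ℝ) • X j ^ 2 * q + (1 / 24 : ℝ) • X j ^ 4 *
      (h ^ 2 * q + algebraMap ℝ R (4 * w2)), ?_⟩
  algebra

theorem dvd_one (h1 : s1 ≠ 0) (h22 : s22 ≠ 0) (i : Fin d) : h ∣ moment (mono1 i) p := by
  obtain ⟨a, b, hab⟩ := H.one_eq i
  obtain ⟨g, hg⟩ := H.odd_line_expand h22 i
  rw [eq_add_of_sub_eq hg] at hab
  refine dvd_of_dvd_smul h1 ((dvd_iff_dvd_of_dvd_sub ?_).1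
    ((dvd_pow_self h (by norm_num)).trans hab))
  exact ⟨(h * (τ + (1 / 2 : ℝ) • X i ^ 2) + h ^ 3 * a) * moment (mono1 i) p +
    (1 + h ^ 2 * (τ + (1 / 2 : ℝ) • X i ^ 2) + h ^ 4 * a) * (h ^ 4 * g +
    h ^ 2 * (X i * ((4 * w2 / s22 - 2 * w2) • ∑ j ∈ Finset.univ.erase i, X j ^ 2))) +
    (X i + h ^ 2 * (τ * X i + (1 / 6 : ℝ) • X i ^ 3) + h ^ 4 * b) *
      (moment (mono2 i i) p + ∑ j ∈ Finset.univ.erase i,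
        (tsinh (h * X j) * moment (mono3 j i) p + tcosh (h * X j) * moment (mono4 i j) p)),
    by ring⟩

theorem dvd_sq_sub (h1 : s1 ≠ 0) (h21 : s21 ≠ 0) (h22 : s22 ≠ 0) (i : Fin d) :
    h ^ 2 ∣ moment (mono2 i i) p - algebraMap ℝ R (2 * W) := by
  obtain ⟨a, b, hab⟩ := H.sq_eq i
  obtain ⟨g, hg⟩ := H.odd_line_expand h22 i
  obtain ⟨k, hk⟩ := H.even_line_expand h22 i
  obtain ⟨m, hm⟩ := H.dvd_one h1 h22 i
  rw [eq_add_of_sub_eq hg, eq_add_of_sub_eq hk, hm] at hab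
  generalize (X i * ((4 * w2 / s22 - 2 * w2) • ∑ j ∈ Finset.univ.erase i, X j ^ 2)) = g0 at hab
  generalize ((-2 * w2) • ∑ j ∈ Finset.univ.erase i, X j ^ 2) = k0 at hab
  refine dvd_of_dvd_smul h21 ((dvd_iff_dvd_of_dvd_sub ?_).1
    ((pow_dvd_pow h (by norm_num : 2 ≤ 6)).trans hab))
  exact ⟨((τ + (1 / 2 : ℝ) • X i ^ 2) + h ^ 2 * a) * moment (mono2 i i) p +
    (1 + h ^ 2 * (τ + (1 / 2 : ℝ) • X i ^ 2) + h ^ 4 * a) * (h ^ 2 * k + k0) +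
    (X i + h ^ 2 * (τ * X i + (1 / 6 : ℝ) • X i ^ 3) + h ^ 4 * b) *
      (m + h ^ 4 * g + h ^ 2 * g0), by ring⟩

theorem one_expand_three (h1 : s1 ≠ 0) (h21 : s21 ≠ 0) (h22 : s22 ≠ 0) (i : Fin d) :
    h ^ 3 ∣ moment (mono1 i) p + h * ((2 * W / s1) • X i) := by
  obtain ⟨a, b, hab⟩ := H.one_eq i
  obtain ⟨g, hg⟩ := H.odd_line_expand h22 i
  obtain ⟨k, hk⟩ := H.even_line_expand h22 i
  obtain ⟨m, hm⟩ := H.dvd_one h1 h22 i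
  obtain ⟨q, hq⟩ := H.dvd_sq_sub h1 h21 h22 i
  have hs : s1 • (moment (mono1 i) p + h * ((2 * W / s1) • X i)) =
      s1 • moment (mono1 i) p + h * (algebraMap ℝ R (2 * W) * X i) := by
    rw [smul_add, mul_smul_comm, smul_smul, mul_div_cancel₀ _ h1]
    algebra
  rw [eq_add_of_sub_eq hg, eq_add_of_sub_eq hk, eq_add_of_sub_eq hq] at hab
  generalize (X i * ((4 * w2 / s22 - 2 * w2) • ∑ j ∈ Finset.univ.erase i, X j ^ 2)) = g0 at hab
  generalize ((-2 * w2) • ∑ j ∈ Finset.univ.erase i, X j ^ 2) = k0 at hab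
  refine dvd_of_dvd_smul h1 (hs ▸ (dvd_iff_dvd_of_dvd_sub ?_).1
    ((pow_dvd_pow h (by norm_num : 3 ≤ 6)).trans hab))
  exact ⟨((τ + (1 / 2 : ℝ) • X i ^ 2) + h ^ 2 * a) * m +
    (1 + h ^ 2 * (τ + (1 / 2 : ℝ) • X i ^ 2) + h ^ 4 * a) * (h ^ 2 * g + g0) +
    ((τ * X i + (1 / 6 : ℝ) • X i ^ 3) + h ^ 2 * b) *
      (h ^ 2 * q + algebraMap ℝ R (2 * W) + (h ^ 4 * k + h ^ 2 * k0)) +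
    X i * (q + h ^ 2 * k + k0), by rw [hm]; ring⟩

theorem sq_expand (h1 : s1 ≠ 0) (h21 : s21 ≠ 0) (h22 : s22 ≠ 0) (i : Fin d) :
    h ^ 4 ∣ moment (mono2 i i) p - algebraMap ℝ R (2 * W) +
      h ^ 2 * ((1 / s21) • ((2 * W) • τ + (W - 2 * W / s1) • X i ^ 2 -
        (2 * w2) • ∑ j ∈ Finset.univ.erase i, X j ^ 2)) := by
  obtain ⟨a, b, hab⟩ := H.sq_eq i
  obtain ⟨g, hg⟩ := H.odd_line_expand h22 i
  obtain ⟨k, hk⟩ := H.even_line_expand h22 i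
  obtain ⟨m, hm⟩ := H.one_expand_three h1 h21 h22 i
  obtain ⟨q, hq⟩ := H.dvd_sq_sub h1 h21 h22 i
  have hs (x y : R) : s21 • (x + h ^ 2 * ((1 / s21) • y)) = s21 • x + h ^ 2 * y := by
    rw [smul_add, mul_smul_comm, smul_smul, mul_one_div_cancel h21, one_smul]
  rw [eq_add_of_sub_eq hg, eq_add_of_sub_eq hk, eq_sub_of_add_eq hm] at hab
  generalize (X i * ((4 * w2 / s22 - 2 * w2) • ∑ j ∈ Finset.univ.erase i, X j ^ 2)) = g0 at hab
  generalize ∑ j ∈ Finset.univ.erase i, X j ^ 2 = k0 at hab ⊢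
  refine dvd_of_dvd_smul h21 ((hs _ _).symm ▸ (dvd_iff_dvd_of_dvd_sub ?_).1
    ((pow_dvd_pow h (by norm_num : 4 ≤ 6)).trans hab))
  refine ⟨(τ + (1 / 2 : ℝ) • X i ^ 2) * (q + h ^ 2 * k + (-2 * w2) • k0) +
    a * moment (mono2 i i) p + k + h ^ 2 * a * (h ^ 2 * k + (-2 * w2) • k0) +
    X i * (m + h ^ 2 * g + g0) +
    (τ * X i + (1 / 6 : ℝ) • X i ^ 3 + h ^ 2 * b) *
      (h ^ 2 * m - ((2 * W / s1) • X i) + h ^ 4 * g + h ^ 2 * g0), ?_⟩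
  rw [eq_add_of_sub_eq hq]
  algebra

theorem one_expand (h1 : s1 ≠ 0) (h21 : s21 ≠ 0) (h22 : s22 ≠ 0) (i : Fin d) :
    h ^ 5 ∣ s1 • moment (mono1 i) p + h * ((2 * W) • X i) +
      h ^ 3 * (-((2 * W / s1) • (X i * (τ + (1 / 2 : ℝ) • X i ^ 2))) +
        X i * ((4 * w2 / s22 - 2 * w2) • ∑ j ∈ Finset.univ.erase i, X j ^ 2) +
        (2 * W) • (τ * X i + (1 / 6 : ℝ) • X i ^ 3) -
        X i * ((1 / s21) • ((2 * W) • τ + (W - 2 * W / s1) • X i ^ 2 -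
          (2 * w2) • ∑ j ∈ Finset.univ.erase i, X j ^ 2) +
          (2 * w2) • ∑ j ∈ Finset.univ.erase i, X j ^ 2)) := by
  obtain ⟨a, b, hab⟩ := H.one_eq i
  obtain ⟨g, hg⟩ := H.odd_line_expand h22 i
  obtain ⟨k, hk⟩ := H.even_line_expand h22 i
  obtain ⟨m, hm⟩ := H.one_expand_three h1 h21 h22 i
  obtain ⟨q, hq⟩ := H.sq_expand h1 h21 h22 i
  rw [eq_add_of_sub_eq hg, eq_add_of_sub_eq hk] at hab
  generalize ∑ j ∈ Finset.univ.erase i, X j ^ 2 = k0 at hab hq ⊢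
  set Q := (1 / s21) • ((2 * W) • τ + (W - 2 * W / s1) • X i ^ 2 - (2 * w2) • k0)
  refine (dvd_iff_dvd_of_dvd_sub ?_).1 ((pow_dvd_pow h (by norm_num : 5 ≤ 6)).trans hab)
  refine ⟨g + (τ + (1 / 2 : ℝ) • X i ^ 2) *
      (m + X i * ((4 * w2 / s22 - 2 * w2) • k0) + h ^ 2 * g) +
    a * (h ^ 2 * m - (2 * W / s1) • X i + h ^ 2 * (X i * ((4 * w2 / s22 - 2 * w2) • k0)) +
      h ^ 4 * g) + X i * (q + k) +
    (τ * X i + (1 / 6 : ℝ) • X i ^ 3) * (-Q + h ^ 2 * q + h ^ 2 * k + (-2 * w2) • k0) +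
    b * (moment (mono2 i i) p + (h ^ 4 * k + h ^ 2 * ((-2 * w2) • k0))), ?_⟩
  rw [eq_sub_of_add_eq hm, eq_add_of_sub_eq (eq_sub_of_add_eq hq)]
  clear_value Q
  algebra

/-- Under the balance conditions the first moment is `- (2 W / s₁) h ∂ᵢ` up to order five, except
for a multiple of the symbol of the diffusion equation. -/
theorem one_balanced {ε : ℝ} (h1 : s1 ≠ 0) (h21 : s21 ≠ 0) (h22 : s22 ≠ 0) (i : Fin d)
    (hA : (2 * W - 2 * W / s1 - 2 * W / s21) * ε - W / s1 + W / 3 - (W - 2 * W / s1) / s21 = 0)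
    (hB : ((2 * W - 2 * W / s1 - 2 * W / s21) * ε + 4 * w2 / s22 - 4 * w2 + 2 * w2 / s21) •
      ∑ j ∈ Finset.univ.erase i, X j ^ 2 = 0) :
    h ^ 5 ∣ moment (mono1 i) p + h * ((2 * W / s1) • X i) +
      h ^ 3 * (((2 * W - 2 * W / s1 - 2 * W / s21) / s1) • (X i * (τ - ε • ∑ j, X j ^ 2))) := by
  refine dvd_of_dvd_smul h1 ?_
  convert H.one_expand h1 h21 h22 i using 1
  have hs (x y z : R) (c c' : ℝ) : s1 • (x + h * ((c / s1) • y) + h ^ 3 * ((c' / s1) • z)) =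
      s1 • x + h * (c • y) + h ^ 3 * (c' • z) := by
    rw [smul_add, smul_add, mul_smul_comm, smul_smul, mul_div_cancel₀ _ h1, mul_smul_comm,
      smul_smul, mul_div_cancel₀ _ h1, mul_smul_comm, mul_smul_comm]
  rw [hs, add_right_inj, ← Finset.add_sum_erase Finset.univ _ (Finset.mem_univ i)]
  generalize ∑ j ∈ Finset.univ.erase i, X j ^ 2 = k0 at hB ⊢
  have hA' : algebraMap ℝ R ((2 * W - 2 * W / s1 - 2 * W / s21) * ε - W / s1 + W / 3 -
    (W - 2 * W / s1) / s21) = 0 := by rw [hA, map_zero]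
  have key : h ^ 3 * (X i * (X i ^ 2 * algebraMap ℝ R ((2 * W - 2 * W / s1 - 2 * W / s21) * ε
    - W / s1 + W / 3 - (W - 2 * W / s1) / s21) +
    ((2 * W - 2 * W / s1 - 2 * W / s21) * ε + 4 * w2 / s22 - 4 * w2 + 2 * w2 / s21) • k0)) = 0 := by
    rw [hA', hB]
    simp
  rw [← sub_eq_zero, ← neg_eq_zero, ← key]
  algebra

/-- The terms of a single coordinate in the evolution of the conserved moment. -/
theorem mass_axis_expand (h1 : s1 ≠ 0) (h21 : s21 ≠ 0) (h22 : s22 ≠ 0) (i : Fin d) (μ : ℝ) (y : R)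
    (hm1 : h ^ 5 ∣ moment (mono1 i) p + h * ((2 * W / s1) • X i) +
      h ^ 3 * ((μ / s1) • (X i * y))) :
    h ^ 6 ∣ tsinh (h * X i) * moment (mono1 i) p + tcosh (h * X i) * moment (mono2 i i) p -
      (h ^ 2 * ((W - 2 * W / s1) • X i ^ 2) +
        h ^ 4 * ((-(μ / s1)) • (X i ^ 2 * y) + (W / 12 - W / (3 * s1)) • X i ^ 4 -
          (1 / (2 * s21)) • (X i ^ 2 * ((2 * W) • τ + (W - 2 * W / s1) • X i ^ 2 -
            (2 * w2) • ∑ j ∈ Finset.univ.erase i, X j ^ 2)))) := by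
  obtain ⟨m, hm⟩ := hm1
  obtain ⟨q, hq⟩ := H.sq_expand h1 h21 h22 i
  obtain ⟨u, hu⟩ := tsinh_expand h (X i)
  have hm' := eq_sub_of_add_eq (eq_sub_of_add_eq hm)
  generalize ∑ j ∈ Finset.univ.erase i, X j ^ 2 = k0 at hq ⊢
  have hq' := eq_add_of_sub_eq (eq_sub_of_add_eq hq)
  refine ⟨X i * m + (1 / 6 : ℝ) • X i ^ 3 * (h ^ 2 * m - (μ / s1) • (X i * y)) +
    u * (h ^ 4 * m - h ^ 2 * ((μ / s1) • (X i * y)) - (2 * W / s1) • X i) +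
    (1 / 2 : ℝ) • X i ^ 2 * q + (1 / 24 : ℝ) • X i ^ 4 * (h ^ 2 * q -
      ((1 / s21) • ((2 * W) • τ + (W - 2 * W / s1) • X i ^ 2 - (2 * w2) • k0))), ?_⟩
  rw [hu, tcosh_expand, hm', hq']
  algebra

/-- The terms of a pair of coordinates in the evolution of the conserved moment. -/
theorem mass_pair_expand (h22 : s22 ≠ 0) {i j : Fin d} (hij : i ≠ j) :
    h ^ 6 ∣ (1 / 2 : ℝ) • (
        tsinh (h * X i) * tsinh (h * X j) * moment (mono2 i j) p
        + tsinh (h * X i) * tcosh (h * X j) * moment (mono3 i j) p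
        + tcosh (h * X i) * tsinh (h * X j) * moment (mono3 j i) p
        + tcosh (h * X i) * tcosh (h * X j) * moment (mono4 i j) p) -
      h ^ 4 * ((2 * w2 / s22 - 3 / 2 * w2) • (X i ^ 2 * X j ^ 2)) := by
  obtain ⟨u, hu⟩ := tsinh_expand_three h (X i)
  obtain ⟨v, hv⟩ := tsinh_expand_three h (X j)
  obtain ⟨m, hm⟩ := H.cubic_expand h22 hij
  obtain ⟨n, hn⟩ := H.cubic_expand h22 hij.symm
  obtain ⟨q, hq⟩ := H.mixed_expand h22 hij
  obtain ⟨r, hr⟩ := H.quartic_expand hij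
  rw [hu, hv, tcosh_expand, tcosh_expand, eq_sub_of_add_eq hm, eq_sub_of_add_eq hn,
    eq_add_of_sub_eq hq, eq_add_of_sub_eq hr]
  refine ⟨(1 / 2 : ℝ) • (
    (X i + h ^ 2 * u) * (X j + h ^ 2 * v) * q +
    (X i * v + X j * u + h ^ 2 * (u * v)) * (algebraMap ℝ R (4 * w2 / s22) * (X i * X j)) +
    (X i + h ^ 2 * u) * ((1 / 2 : ℝ) • X j ^ 2 + h ^ 2 * (1 / 24 : ℝ) • X j ^ 4) * m -
    (X i * (1 / 24 : ℝ) • X j ^ 4 + u * (1 / 2 : ℝ) • X j ^ 2 + h ^ 2 * (u * (1 / 24 : ℝ) • X j ^ 4))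
      * (algebraMap ℝ R (4 * w2) * X i) +
    (X j + h ^ 2 * v) * ((1 / 2 : ℝ) • X i ^ 2 + h ^ 2 * (1 / 24 : ℝ) • X i ^ 4) * n -
    (X j * (1 / 24 : ℝ) • X i ^ 4 + v * (1 / 2 : ℝ) • X i ^ 2 + h ^ 2 * (v * (1 / 24 : ℝ) • X i ^ 4))
      * (algebraMap ℝ R (4 * w2) * X j) +
    ((1 / 2 : ℝ) • X i ^ 2 + h ^ 2 * (1 / 24 : ℝ) • X i ^ 4) *
      ((1 / 2 : ℝ) • X j ^ 2 + h ^ 2 * (1 / 24 : ℝ) • X j ^ 4) * r +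
    ((1 / 2 : ℝ) • X i ^ 2 * (1 / 24 : ℝ) • X j ^ 4 + (1 / 24 : ℝ) • X i ^ 4 * (1 / 2 : ℝ) • X j ^ 2 +
      h ^ 2 * ((1 / 24 : ℝ) • X i ^ 4 * (1 / 24 : ℝ) • X j ^ 4)) * algebraMap ℝ R (4 * w2)), ?_⟩
  algebra

/-- Under the balance conditions the symbol of the evolution of the conserved moment is a multiple
of the symbol of the diffusion equation, up to order six. -/
theorem mass_balanced {ε : ℝ} (h1 : s1 ≠ 0) (h21 : s21 ≠ 0) (h22 : s22 ≠ 0)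
    (hε : ε = 2 * W / s1 - W)
    (hA : (2 * W - 2 * W / s1 - 2 * W / s21) * ε - W / s1 + W / 3 - (W - 2 * W / s1) / s21 = 0)
    (hB : ∀ i, ((2 * W - 2 * W / s1 - 2 * W / s21) * ε + 4 * w2 / s22 - 4 * w2 + 2 * w2 / s21) •
      ∑ j ∈ Finset.univ.erase i, X j ^ 2 = 0)
    (hA2 : -ε ^ 2 / 2 - W / (3 * s1) + W / 12 - W * ε / s21 - (W - 2 * W / s1) / (2 * s21) = 0)
    (hB2 : ∀ i, (-ε ^ 2 / 2 - W * ε / s21 + w2 / s21 + 2 * w2 / s22 - 3 / 2 * w2) •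
      ∑ j ∈ Finset.univ.erase i, X j ^ 2 = 0) :
    ∃ q, h ^ 6 ∣ ∑ k, (shiftSymbol h τ X k - 1) * p k -
      h ^ 2 * ((1 + h ^ 2 * q) * (τ - ε • ∑ j, X j ^ 2)) := by
  set μ := 2 * W - 2 * W / s1 - 2 * W / s21 with hμ
  set L := ∑ j, X j ^ 2 with hL
  set y := τ - ε • L with hy
  have hLi (i : Fin d) : L = X i ^ 2 + ∑ j ∈ Finset.univ.erase i, X j ^ 2 :=
    (Finset.add_sum_erase Finset.univ _ (Finset.mem_univ i)).symm
  -- the terms of order `h ^ 4` that belong to the coordinate `i`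
  set P : Fin d → R := fun i => (-(μ / s1)) • (X i ^ 2 * y) + (W / 12 - W / (3 * s1)) • X i ^ 4 -
      (1 / (2 * s21)) • (X i ^ 2 * ((2 * W) • τ + (W - 2 * W / s1) • X i ^ 2 -
        (2 * w2) • ∑ j ∈ Finset.univ.erase i, X j ^ 2)) +
      (2 * w2 / s22 - 3 / 2 * w2) • (X i ^ 2 * ∑ j ∈ Finset.univ.erase i, X j ^ 2) with hP
  clear_value P
  have hP' (i : Fin d) :
      P i = (-(μ / s1 + W / s21)) • (X i ^ 2 * y) + (ε ^ 2 / 2) • (X i ^ 2 * L) := by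
    have hA' : algebraMap ℝ R (-ε ^ 2 / 2 - W / (3 * s1) + W / 12 - W * ε / s21 -
      (W - 2 * W / s1) / (2 * s21)) = 0 := by rw [hA2, map_zero]
    have hB' := hB2 i
    have hτ : τ = y + ε • L := by rw [hy]; ring
    simp only [hP]
    rw [hτ, hLi i]
    generalize ∑ j ∈ Finset.univ.erase i, X j ^ 2 = k0 at hB' ⊢
    clear_value y
    have key : X i ^ 4 * algebraMap ℝ R (-ε ^ 2 / 2 - W / (3 * s1) + W / 12 - W * ε / s21 -
        (W - 2 * W / s1) / (2 * s21)) + X i ^ 2 *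
        ((-ε ^ 2 / 2 - W * ε / s21 + w2 / s21 + 2 * w2 / s22 - 3 / 2 * w2) • k0) = 0 := by
      rw [hA', hB']
      ring
    rw [← sub_eq_zero, ← key]
    algebra
  have hsumP : ∑ i, P i = (-(μ / s1 + W / s21)) • (L * y) + (ε ^ 2 / 2) • (L * L) := by
    simp_rw [hP', Finset.sum_add_distrib, ← Finset.smul_sum, ← Finset.sum_mul, ← hL]
  have hexp : h ^ 6 ∣ ∑ i, (tsinh (h * X i) * moment (mono1 i) p +
        tcosh (h * X i) * moment (mono2 i i) p) +
      ∑ i, ∑ j ∈ Finset.univ.erase i, (1 / 2 : ℝ) • (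
        tsinh (h * X i) * tsinh (h * X j) * moment (mono2 i j) p
        + tsinh (h * X i) * tcosh (h * X j) * moment (mono3 i j) p
        + tcosh (h * X i) * tsinh (h * X j) * moment (mono3 j i) p
        + tcosh (h * X i) * tcosh (h * X j) * moment (mono4 i j) p) -
      (h ^ 2 * (-(ε • L)) + h ^ 4 * ∑ i, P i) := by
    have h3 : h ^ 2 * (-(ε • L)) + h ^ 4 * ∑ i, P i =
        ∑ i, (h ^ 2 * ((W - 2 * W / s1) • X i ^ 2) + h ^ 4 * P i) := by
      rw [Finset.sum_add_distrib, ← Finset.mul_sum, ← Finset.mul_sum, ← Finset.smul_sum, ← hL, hε,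
        ← neg_smul, neg_sub]
    rw [h3, ← Finset.sum_add_distrib, ← Finset.sum_sub_distrib]
    refine Finset.dvd_sum fun i _ => ?_
    have h4 := H.mass_axis_expand h1 h21 h22 i μ y (H.one_balanced h1 h21 h22 i hA (hB i))
    have h5 := Finset.dvd_sum (s := Finset.univ.erase i) fun j hj =>
      H.mass_pair_expand h22 (Finset.ne_of_mem_erase hj).symm
    have h6 : ∑ j ∈ Finset.univ.erase i,
        h ^ 4 * ((2 * w2 / s22 - 3 / 2 * w2) • (X i ^ 2 * X j ^ 2)) =
        h ^ 4 * ((2 * w2 / s22 - 3 / 2 * w2) •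
          (X i ^ 2 * ∑ j ∈ Finset.univ.erase i, X j ^ 2)) := by
      rw [Finset.mul_sum, Finset.smul_sum, Finset.mul_sum]
    rw [Finset.sum_sub_distrib, h6] at h5
    convert dvd_add h4 h5 using 1
    simp only [hP]
    ring
  obtain ⟨r, hr⟩ := hexp
  obtain ⟨e, he⟩ := texp_expand h τ
  obtain ⟨t, ht⟩ := streaming_zero h τ X p
  refine ⟨(1 / 2 : ℝ) • y - (μ / s1 + W / s21) • L, ?_⟩
  have h6 : ∑ k, (shiftSymbol h τ X k - 1) * p k = ∑ k, shiftSymbol h τ X k * p k - 1 := by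
    simp_rw [sub_mul, one_mul, Finset.sum_sub_distrib, H.sum_eq]
  rw [h6, eq_add_of_sub_eq ht, H.sum_eq, add_assoc 1, eq_add_of_sub_eq hr, he]
  refine ⟨t + e + r + τ * (∑ i, P i) + (1 / 2 : ℝ) • τ ^ 2 * (-(ε • L)) +
    h ^ 2 * (τ * r + (1 / 2 : ℝ) • τ ^ 2 * (∑ i, P i) + e * (-(ε • L))) +
    h ^ 4 * ((1 / 2 : ℝ) • τ ^ 2 * r + e * (∑ i, P i)) + h ^ 6 * (e * r), ?_⟩
  have hτ : τ = y + ε • L := by rw [hy]; ring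
  rw [hsumP, hτ]
  clear_value y L
  algebra

end IsExpansion

end Expansion

/-! ### The moment matrix and the equilibrium -/

section Lattice

variable {d : ℕ}

/-- The rows of the moment matrix for unit lattice speed. -/
def row (r k : Slot d) : ℝ := monomial r (dir k)

theorem momentMatrix_one_apply (r k : Slot d) : momentMatrix d 1 r k = row r k := by
  simp [momentMatrix, vel, row]

theorem dir_pair_mul (q q' : Pair d) (b b' : Bool) :
    dir (.inr (.inr (q', b, b'))) q.1.1 * dir (.inr (.inr (q', b, b'))) q.1.2 =
      if q' = q then sgn b * sgn b' else 0 := by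
  obtain ⟨⟨i, j⟩, hij⟩ := q
  obtain ⟨⟨l, m⟩, hlm⟩ := q'
  simp only at hij hlm
  simp only [dir, Pi.add_apply, Pi.single_apply, Subtype.mk.injEq, Prod.mk.injEq]
  have h1 : i ≠ j := hij.ne
  have h2 : l ≠ m := hlm.ne
  by_cases a : i = l <;> by_cases b : j = m <;> by_cases c : i = m <;> by_cases e : j = l <;>
    (simp_all [eq_comm]; try omega)

theorem dir_pair_fst (q : Pair d) (b b' : Bool) :
    dir (.inr (.inr (q, b, b'))) q.1.1 = sgn b := by
  simp [dir, q.2.ne]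

theorem dir_pair_snd (q : Pair d) (b b' : Bool) :
    dir (.inr (.inr (q, b, b'))) q.1.2 = sgn b' := by
  simp [dir, q.2.ne']

/-- A monomial in two coordinates only sees the four velocities in their plane. -/
theorem sum_mul_pair (q : Pair d) (g : ℝ → ℝ → ℝ) (v : Slot d → ℝ) :
    ∑ k, dir k q.1.1 * dir k q.1.2 * g (dir k q.1.1) (dir k q.1.2) * v k =
      ∑ b, ∑ b', sgn b * sgn b' * g (sgn b) (sgn b') * v (.inr (.inr (q, b, b'))) := by
  simp only [Fintype.sum_sum_type, Fintype.sum_prod_type, dir_pair_mul]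
  have h1 : ∀ (i : Fin d) (b : Bool), dir (.inr (.inl (i, b))) q.1.1 *
      dir (.inr (.inl (i, b))) q.1.2 = 0 := by
    intro i b
    simp only [dir, Pi.single_apply]
    have := q.2.ne
    split_ifs <;> simp_all
  simp only [h1, zero_mul, Finset.sum_const_zero, zero_add]
  rw [Finset.sum_eq_single q]
  · simp only [dir_pair_fst, dir_pair_snd, if_true]
    simp [dir]
  · intro q' _ hq'
    simp [hq']
  · simp

theorem sum_row_pair (q : Pair d) (a a' : Bool) (v : Slot d → ℝ) :
    ∑ k, row (.inr (.inr (q, a, a'))) k * v k =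
      ∑ b, ∑ b', sgn b * sgn b' * ((if a then sgn b else 1) * (if a' then sgn b' else 1)) *
        v (.inr (.inr (q, b, b'))) := by
  rw [← sum_mul_pair q (fun x y => (if a then x else 1) * (if a' then y else 1))]
  refine Finset.sum_congr rfl fun k _ => ?_
  cases a <;> cases a' <;> simp only [row, monomial, if_true, if_false, Bool.false_eq_true] <;>
    ring

theorem eq_zero_of_sum_row_mul_eq_zero (v : Slot d → ℝ) (hv : ∀ r, ∑ k, row r k * v k = 0) : v = 0 := by
  have h3 : ∀ q b b', v (.inr (.inr (q, b, b'))) = 0 := by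
    intro q
    have h00 := hv (.inr (.inr (q, false, false)))
    have h01 := hv (.inr (.inr (q, false, true)))
    have h10 := hv (.inr (.inr (q, true, false)))
    have h11 := hv (.inr (.inr (q, true, true)))
    rw [sum_row_pair] at h00 h01 h10 h11
    simp [sgn] at h00 h01 h10 h11
    intro b b'
    cases b <;> cases b' <;> linarith
  have h2 : ∀ i b, v (.inr (.inl (i, b))) = 0 := by
    intro i
    have h0 := hv (.inr (.inl (i, false)))
    have h1 := hv (.inr (.inl (i, true)))
    simp only [Fintype.sum_sum_type, Fintype.sum_prod_type, h3] at h0 h1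
    simp [row, monomial, dir, Pi.single_apply, sgn] at h0 h1
    intro b
    cases b <;> linarith
  have h1 : v (.inl ()) = 0 := by
    have h0 := hv (.inl ())
    simpa [Fintype.sum_sum_type, Fintype.sum_prod_type, h3, h2, row, monomial] using h0
  funext k
  rcases k with u | ⟨i, b⟩ | ⟨q, b, b'⟩
  · exact h1
  · exact h2 i b
  · exact h3 q b b'

theorem isUnit_momentMatrix : IsUnit (momentMatrix d 1) := by
  rw [← Matrix.mulVec_injective_iff_isUnit]
  refine (injective_iff_map_eq_zero (Matrix.mulVecLin (momentMatrix d 1))).2 ?_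
  intro v hv
  refine eq_zero_of_sum_row_mul_eq_zero v fun r => ?_
  have := congrFun hv r
  simpa [Matrix.mulVec, dotProduct, momentMatrix_one_apply] using this

/-- Each coordinate belongs to `d - 1` pairs. -/
theorem sum_pair_indicator (i : Fin d) :
    ∑ q : Pair d, ((if i = q.1.1 then 1 else 0) + (if i = q.1.2 then 1 else 0) : ℝ) = d - 1 := by
  rw [← Finset.sum_subtype (Finset.univ.filter fun q : Fin d × Fin d => q.1 < q.2) (by simp)
    (fun q => ((if i = q.1 then 1 else 0) + (if i = q.2 then 1 else 0) : ℝ)),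
    Finset.sum_filter, Fintype.sum_prod_type]
  have h1 : ∀ a b : Fin d, (if a < b then
      ((if i = a then 1 else 0) + (if i = b then 1 else 0) : ℝ) else 0) =
      (if i = a then (if i < b then 1 else 0) else 0) +
        (if i = b then (if a < i then 1 else 0) else 0) := by
    intro a b
    split_ifs <;> simp_all <;> omega
  simp only [h1, Finset.sum_add_distrib]
  rw [Finset.sum_comm]
  simp only [Finset.sum_ite_eq, Finset.mem_univ, if_true]
  rw [← Finset.sum_add_distrib]
  have h2 : ∀ b : Fin d, ((if i < b then 1 else 0) + (if b < i then 1 else 0) : ℝ) =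
      1 - if i = b then 1 else 0 := by
    intro b
    rcases lt_trichotomy i b with h | h | h
    · simp [h, h.ne, h.not_gt]
    · simp [h]
    · simp [h, h.ne', h.not_gt]
  simp [h2]

theorem card_pair : (Fintype.card (Pair d) : ℝ) * 2 = d * (d - 1) := by
  have h1 : ∑ i : Fin d, ∑ q : Pair d,
      ((if i = q.1.1 then 1 else 0) + (if i = q.1.2 then 1 else 0) : ℝ) = d * (d - 1) := by
    simp only [sum_pair_indicator, Finset.sum_const, Finset.card_univ, Fintype.card_fin,
      nsmul_eq_mul]
  rw [← h1, Finset.sum_comm]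
  simp [Finset.sum_add_distrib]
  ring

theorem equilibrium_pair (P : Params) (q : Pair d) (a a' : Bool) :
    ∑ k, row (.inr (.inr (q, a, a'))) k * weight P k = if a && a' then 4 * P.w2 else 0 := by
  rw [sum_row_pair]
  cases a <;> cases a' <;> simp [sgn, weight]
  ring

theorem equilibrium_one (P : Params) (i : Fin d) :
    ∑ k, row (.inr (.inl (i, false))) k * weight P k = 0 := by
  have h1 : ∀ q : Pair d, ∑ b, ∑ b', dir (.inr (.inr (q, b, b'))) i * P.w2 = 0 := by
    intro q
    simp only [dir, sgn, Fintype.sum_bool, Pi.add_apply, Pi.single_apply]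
    split_ifs <;> simp_all
    ring
  simp only [row, monomial, Fintype.sum_sum_type, Fintype.sum_prod_type, weight, h1]
  simp [dir, Pi.single_apply, sgn]

theorem equilibrium_sq (P : Params) (i : Fin d) :
    ∑ k, row (.inr (.inl (i, true))) k * weight P k =
      2 * (P.w1 + 2 * ((d : ℝ) - 1) * P.w2) := by
  have h1 : ∀ q : Pair d, ∑ b, ∑ b', (dir (.inr (.inr (q, b, b'))) i) ^ 2 * P.w2 =
      ((if i = q.1.1 then 1 else 0) + (if i = q.1.2 then 1 else 0) : ℝ) * (4 * P.w2) := by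
    intro q
    have := q.2.ne
    simp only [dir, sgn, Fintype.sum_bool, Pi.add_apply, Pi.single_apply]
    split_ifs <;> simp_all <;> ring
  simp only [row, monomial, Fintype.sum_sum_type, Fintype.sum_prod_type, weight]
  simp_rw [← Fintype.sum_prod_type', Fintype.sum_prod_type, h1, ← Finset.sum_mul, sum_pair_indicator]
  simp [dir, Pi.single_apply, sgn]
  ring

theorem equilibrium_zero (P : Params) :
    ∑ k : Slot d, weight P k = 1 := by
  simp [weight, Fintype.sum_sum_type]
  linear_combination (2 * P.w2) * card_pair (d := d)

/-- Changing the lattice speed rescales the rows of the moment matrix. -/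
theorem momentMatrix_eq (c : ℝ) :
    ∃ D : Slot d → ℝ, (c ≠ 0 → ∀ r, D r ≠ 0) ∧
      momentMatrix d c = Matrix.diagonal D * momentMatrix d 1 := by
  refine ⟨fun r => match r with
    | .inl _ => 1
    | .inr (.inl (_, false)) => c
    | .inr (.inl (_, true)) => c ^ 2
    | .inr (.inr (_, false, false)) => c ^ 2
    | .inr (.inr (_, false, true)) => c ^ 3
    | .inr (.inr (_, true, false)) => c ^ 3
    | .inr (.inr (_, true, true)) => c ^ 4, ?_, ?_⟩
  · rintro hc (_ | ⟨_, _ | _⟩ | ⟨_, _ | _, _ | _⟩) <;> simp [hc]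
  · ext r k
    rw [Matrix.diagonal_mul]
    rcases r with (_ | ⟨_, _ | _⟩ | ⟨_, _ | _, _ | _⟩) <;>
      simp only [momentMatrix, Matrix.of_apply, monomial, vel, Pi.smul_apply, smul_eq_mul] <;> ring

/-- The collision matrix does not depend on the lattice speed, as the moments are monomials. -/
theorem collision_eq (P : Params) {c : ℝ} (hc : c ≠ 0) :
    collision d P c = collision d P 1 := by
  obtain ⟨D, hD, hM⟩ := momentMatrix_eq (d := d) c
  have hDu : IsUnit (Matrix.diagonal D) := by
    rw [Matrix.isUnit_diagonal, Pi.isUnit_iff]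
    exact fun r => (hD hc r).isUnit
  have hDd := (Matrix.isUnit_iff_isUnit_det _).1 hDu
  rw [collision, collision, hM, Matrix.mul_inv_rev]
  have h1 : (Matrix.diagonal D)⁻¹ * (Matrix.diagonal (relax P) * Matrix.diagonal D) =
      Matrix.diagonal (relax P) := by
    rw [Matrix.diagonal_mul_diagonal, funext fun r => mul_comm (relax P r) (D r),
      ← Matrix.diagonal_mul_diagonal, ← mul_assoc, Matrix.nonsing_inv_mul _ hDd, one_mul]
  calc _ = (momentMatrix d 1)⁻¹ * ((Matrix.diagonal D)⁻¹ * (Matrix.diagonal (relax P) *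
        Matrix.diagonal D)) * momentMatrix d 1 := by simp only [mul_assoc]
    _ = _ := by rw [h1]

variable {V : Type*} [AddCommGroup V] [Module ℝ V]

theorem moment_matrix_mul (A : Matrix (Slot d) (Slot d) ℝ) (r : Slot d) (x : Slot d → V) :
    moment (row r) (fun k => ∑ l, A k l • x l) = ∑ l, (momentMatrix d 1 * A) r l • x l := by
  simp only [moment, Finset.smul_sum, smul_smul]
  rw [Finset.sum_comm]
  refine Finset.sum_congr rfl fun l _ => ?_
  rw [← Finset.sum_smul, Matrix.mul_apply]
  simp only [momentMatrix_one_apply]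

theorem moment_collision (P : Params) (r : Slot d) (x : Slot d → V) :
    moment (row r) (fun k => ∑ l, collision d P 1 k l • x l) = relax P r • moment (row r) x := by
  have hM := (Matrix.isUnit_iff_isUnit_det _).1 (isUnit_momentMatrix (d := d))
  rw [moment_matrix_mul, collision, ← mul_assoc, ← mul_assoc, Matrix.mul_nonsing_inv _ hM, one_mul,
    moment, Finset.smul_sum]
  refine Finset.sum_congr rfl fun l _ => ?_
  rw [Matrix.diagonal_mul, momentMatrix_one_apply, smul_smul]

/-- The distribution functions with prescribed moments. -/
def ofMoments (m : Slot d → V) (k : Slot d) : V := ∑ r, (momentMatrix d 1)⁻¹ k r • m r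

theorem moment_ofMoments (m : Slot d → V) (r : Slot d) :
    moment (row r) (ofMoments m) = m r := by
  have hM := (Matrix.isUnit_iff_isUnit_det _).1 (isUnit_momentMatrix (d := d))
  change moment (row r) (fun k => ∑ r, (momentMatrix d 1)⁻¹ k r • m r) = m r
  rw [moment_matrix_mul, Matrix.mul_nonsing_inv _ hM]
  simp [Matrix.one_apply]

theorem ofMoments_moment (x : Slot d → V) : ofMoments (fun r => moment (row r) x) = x := by
  have hM := (Matrix.isUnit_iff_isUnit_det _).1 (isUnit_momentMatrix (d := d))
  funext k
  simp only [ofMoments, moment, Finset.smul_sum, smul_smul]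
  rw [Finset.sum_comm]
  have h1 : ∀ l, ∑ r, ((momentMatrix d 1)⁻¹ k r * row r l) • x l =
      (1 : Matrix (Slot d) (Slot d) ℝ) k l • x l := by
    intro l
    rw [← Finset.sum_smul, ← Matrix.nonsing_inv_mul _ hM, Matrix.mul_apply]
    simp only [momentMatrix_one_apply]
  simp [h1, Matrix.one_apply]

theorem moment_row_zero (x : Slot d → V) : moment (row (.inl ())) x = ∑ k, x k := by
  simp [moment, row, monomial]

end Lattice

/-! ### Existence of the expansion -/

section Existence

variable {R : Type*} [CommRing R] [Algebra ℝ R] {d : ℕ}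

theorem dvd_shiftSymbol_sub_one (h τ : R) (X : Fin d → R) (k : Slot d) :
    h ∣ shiftSymbol h τ X k - 1 := by
  rw [shiftSymbol]
  generalize (∑ i, dir k i • X i) + h * τ = x
  refine ⟨x + (1 / 2 : ℝ) • (h * x ^ 2) + (1 / 6 : ℝ) • (h ^ 2 * x ^ 3) +
    (1 / 24 : ℝ) • (h ^ 3 * x ^ 4) + (1 / 120 : ℝ) • (h ^ 4 * x ^ 5), ?_⟩
  simp only [texp, Finset.sum_range_succ, Finset.sum_range_zero, Nat.factorial]
  push_cast
  algebra

/-- The non-equilibrium parts obtained from the equations for the non-conserved moments when the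
streaming terms are evaluated at `p`. -/
def correction (P : Params) (h τ : R) (X : Fin d → R) (p : Slot d → R) : Slot d → R :=
  ofMoments fun r => (if r = .inl () then 0 else (relax P r)⁻¹) •
    moment (row r) (fun k => (shiftSymbol h τ X k - 1) * p k)

theorem dvd_correction (P : Params) {h τ : R} {X : Fin d → R} {p : Slot d → R} {n : ℕ}
    (hp : ∀ k, h ^ n ∣ p k) (k : Slot d) : h ^ (n + 1) ∣ correction P h τ X p k := by
  refine Finset.dvd_sum fun r _ => dvd_smul_right' _ (dvd_smul_right' _ ?_)
  refine Finset.dvd_sum fun l _ => dvd_smul_right' _ ?_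
  rw [pow_succ']
  exact mul_dvd_mul (dvd_shiftSymbol_sub_one h τ X l) (hp l)

theorem correction_sub (P : Params) (h τ : R) (X : Fin d → R) (p p' : Slot d → R) (k : Slot d) :
    correction P h τ X p k - correction P h τ X p' k =
      correction P h τ X (fun k => p k - p' k) k := by
  simp only [correction, ofMoments, moment, mul_sub, smul_sub, Finset.sum_sub_distrib]

/-- Successive approximations of the distribution functions, as symbols acting on the conserved
moment, starting from the equilibrium. -/
def approx (P : Params) (h τ : R) (X : Fin d → R) : ℕ → Slot d → R
  | 0 => fun k => algebraMap ℝ R (weight P k)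
  | n + 1 => fun k => algebraMap ℝ R (weight P k) - correction P h τ X (approx P h τ X n) k

theorem dvd_approx_sub (P : Params) (h τ : R) (X : Fin d → R) (n : ℕ) (k : Slot d) :
    h ^ (n + 1) ∣ approx P h τ X (n + 1) k - approx P h τ X n k := by
  induction n generalizing k with
  | zero =>
    rw [approx, approx, sub_sub_cancel_left, dvd_neg]
    exact dvd_correction P (n := 0) (by simp) k
  | succ n ih =>
    have h1 : approx P h τ X (n + 1 + 1) k - approx P h τ X (n + 1) k =
        -correction P h τ X (fun k => approx P h τ X (n + 1) k - approx P h τ X n k) k := by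
      rw [← correction_sub, approx, approx]
      ring
    rw [h1, dvd_neg]
    exact dvd_correction P ih k

theorem sum_approx (P : Params) (h τ : R) (X : Fin d → R) (n : ℕ) :
    ∑ k, approx P h τ X n k = 1 := by
  have h1 : ∑ k : Slot d, algebraMap ℝ R (weight P k) = 1 := by
    rw [← map_sum, equilibrium_zero, map_one]
  cases n with
  | zero => exact h1
  | succ n =>
    simp only [approx, Finset.sum_sub_distrib, h1]
    rw [← moment_row_zero (correction P h τ X _), correction, moment_ofMoments]
    simp

/-- Each iteration gains one order in the equations for the non-conserved moments. -/
theorem approx_moment (P : Params) (h τ : R) (X : Fin d → R) (n : ℕ) {r : Slot d}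
    (hr : r ≠ .inl ()) (hs : relax P r ≠ 0) :
    h ^ (n + 1) ∣ moment (row r) (fun k => (shiftSymbol h τ X k - 1) * approx P h τ X n k) +
      relax P r • (moment (row r) (approx P h τ X n) -
        algebraMap ℝ R (∑ k, row r k * weight P k)) := by
  have h1 : h ^ (n + 1) ∣ relax P r • moment (row r)
      (fun k => approx P h τ X n k - approx P h τ X (n + 1) k) := by
    refine dvd_smul_right' _ (Finset.dvd_sum fun k _ => dvd_smul_right' _ ?_)
    rw [dvd_sub_comm]
    exact dvd_approx_sub P h τ X n k
  convert h1 using 1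
  have h2 : relax P r • moment (row r) (correction P h τ X (approx P h τ X n)) =
      moment (row r) (fun k => (shiftSymbol h τ X k - 1) * approx P h τ X n k) := by
    rw [correction, moment_ofMoments, if_neg hr, smul_smul, mul_inv_cancel₀ hs, one_smul]
  rw [← h2, ← smul_add]
  congr 1
  simp only [approx, moment, map_sum, map_mul, Algebra.smul_def, mul_sub, Finset.sum_sub_distrib]
  ring

theorem mono1_eq (i : Fin d) : mono1 i = row (.inr (.inl (i, false))) := rfl

theorem mono2_self_eq (i : Fin d) : mono2 i i = row (.inr (.inl (i, true))) := by
  funext k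
  simp [mono2, row, monomial, sq]

theorem mono2_eq {i j : Fin d} (hij : i ≠ j) : ∃ q : Pair d,
    mono2 i j = row (.inr (.inr (q, false, false))) := by
  rcases lt_or_gt_of_ne hij with h | h
  · exact ⟨⟨(i, j), h⟩, rfl⟩
  · exact ⟨⟨(j, i), h⟩, funext fun k => mul_comm _ _⟩

theorem mono3_eq {i j : Fin d} (hij : i ≠ j) : ∃ q : Pair d,
    mono3 i j = row (.inr (.inr (q, false, true))) ∨
    mono3 i j = row (.inr (.inr (q, true, false))) := by
  rcases lt_or_gt_of_ne hij with h | h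
  · exact ⟨⟨(i, j), h⟩, .inl rfl⟩
  · exact ⟨⟨(j, i), h⟩, .inr (funext fun k => mul_comm _ _)⟩

theorem mono4_eq {i j : Fin d} (hij : i ≠ j) : ∃ q : Pair d,
    mono4 i j = row (.inr (.inr (q, true, true))) := by
  rcases lt_or_gt_of_ne hij with h | h
  · exact ⟨⟨(i, j), h⟩, rfl⟩
  · exact ⟨⟨(j, i), h⟩, funext fun k => mul_comm _ _⟩

theorem isExpansion_approx {P : Params} (hP : P.Admissible) (h τ : R) (X : Fin d → R) :
    IsExpansion h τ X P.s1 P.s21 P.s22 (P.w1 + 2 * ((d : ℝ) - 1) * P.w2) P.w2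
      (approx P h τ X 5) := by
  have h1 : P.s1 ≠ 0 := hP.2.1.1.ne'
  have h21 : P.s21 ≠ 0 := hP.2.2.1.1.ne'
  have h22 : P.s22 ≠ 0 := hP.2.2.2.1.ne'
  refine ⟨sum_approx P h τ X 5, fun i => ?_, fun i => ?_, fun i j hij => ?_, fun i j hij => ?_,
    fun i j hij => ?_⟩
  · have := approx_moment P h τ X 5 (r := .inr (.inl (i, false))) (by simp) h1
    rwa [equilibrium_one, map_zero, sub_zero] at this
  · have := approx_moment P h τ X 5 (r := .inr (.inl (i, true))) (by simp) h21
    rwa [equilibrium_sq, ← mono2_self_eq] at this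
  · obtain ⟨q, hq⟩ := mono2_eq hij
    have := approx_moment P h τ X 5 (r := .inr (.inr (q, false, false))) (by simp) h22
    rw [equilibrium_pair] at this
    simpa [hq, relax] using this
  · obtain ⟨q, hq | hq⟩ := mono3_eq hij
    · have := approx_moment P h τ X 5 (r := .inr (.inr (q, false, true))) (by simp) one_ne_zero
      rw [equilibrium_pair] at this
      simpa [hq, relax] using this
    · have := approx_moment P h τ X 5 (r := .inr (.inr (q, true, false))) (by simp) one_ne_zero
      rw [equilibrium_pair] at this
      simpa [hq, relax] using this
  · obtain ⟨q, hq⟩ := mono4_eq hij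
    have := approx_moment P h τ X 5 (r := .inr (.inr (q, true, true))) (by simp) one_ne_zero
    rw [equilibrium_pair] at this
    simpa only [hq, relax, one_smul, Bool.and_self, if_true] using this

end Existence

/-! ### The conditions on the parameters -/

/-- The conditions on the parameters in the form in which they enter the expansion. -/
theorem balance_of_conditions {d : ℕ} (hd : 1 ≤ d) {ε : ℝ} {P : Params} (hP : P.Admissible)
    (hC : Conditions d ε P) {W : ℝ} (hW : W = P.w1 + 2 * ((d : ℝ) - 1) * P.w2) :
    ε = 2 * W / P.s1 - W ∧
    (2 * W - 2 * W / P.s1 - 2 * W / P.s21) * ε - W / P.s1 + W / 3 -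
      (W - 2 * W / P.s1) / P.s21 = 0 ∧
    -ε ^ 2 / 2 - W / (3 * P.s1) + W / 12 - W * ε / P.s21 - (W - 2 * W / P.s1) / (2 * P.s21) = 0 ∧
    (1 < d → (2 * W - 2 * W / P.s1 - 2 * W / P.s21) * ε + 4 * P.w2 / P.s22 - 4 * P.w2 +
      2 * P.w2 / P.s21 = 0 ∧
      -ε ^ 2 / 2 - W * ε / P.s21 + P.w2 / P.s21 + 2 * P.w2 / P.s22 - 3 / 2 * P.w2 = 0) := by
  have h1 : P.s1 ≠ 0 := hP.2.1.1.ne'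
  have h21 : P.s21 ≠ 0 := hP.2.2.1.1.ne'
  have h22 : P.s22 ≠ 0 := hP.2.2.2.1.ne'
  have key : ε = 2 * W / P.s1 - W ∧
      6 * (P.s21 * (P.s1 - 1) + P.s1 ^ 2 + P.s21 - 2 * P.s1) - P.s21 * P.s1 ^ 2
      + 6 * W * (2 * P.s1 * (2 - P.s1) + P.s21 * (4 + P.s1 ^ 2 - 6 * P.s1)) = 0 ∧
      3 * P.s1 * (P.s21 + P.s1 - 2) - P.s1 ^ 2 * P.s21
      + 6 * W * (2 - P.s1) * (P.s1 + P.s21 * (1 - P.s1)) = 0 := by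
    rcases hd.eq_or_lt with hd1 | hd1
    · obtain ⟨e1, e2, e3⟩ := hC.1 hd1.symm
      have hWw : W = P.w1 := by rw [hW, ← hd1]; simp
      rw [R1] at e2
      rw [Con1] at e3
      rw [hWw]
      refine ⟨?_, e2, e3⟩
      rw [e1]
      ring
    · obtain ⟨e1, e2, -, e3, -⟩ := hC.2 hd1
      rw [Rd1, ← hW] at e2
      rw [Cond1, ← hW] at e3
      refine ⟨?_, e2, e3⟩
      rw [e1, hW]
      ring
  obtain ⟨hε, hR, hK⟩ := key
  have hA : (2 * W - 2 * W / P.s1 - 2 * W / P.s21) * ε - W / P.s1 + W / 3 -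
      (W - 2 * W / P.s1) / P.s21 = 0 := by
    rw [hε]
    field_simp
    linear_combination -W * hK
  refine ⟨hε, hA, ?_, fun hd1 => ⟨?_, ?_⟩⟩
  · rw [hε]
    field_simp
    refine mul_left_cancel₀ h1 ?_
    linear_combination W * (12 - 6 * P.s1) * hR - 24 * W * hK
  · obtain ⟨-, -, -, -, e3⟩ := hC.2 hd1
    have e3' : -(P.s22 * W ^ 2) * (P.s1 - 2) * (P.s1 + P.s21 - P.s1 * P.s21)
      - P.s1 ^ 2 * P.w2 * (2 * P.s21 + P.s22 - 2 * P.s21 * P.s22) = 0 := by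
      rw [← e3, Cond2, hW]; ring
    rw [hε]
    field_simp
    linear_combination -2 * e3'
  · obtain ⟨-, -, e2, -, e3⟩ := hC.2 hd1
    have hW2 : P.w1 ^ 2 + 4 * ((d : ℝ) - 1) * P.w2 * (P.w1 + ((d : ℝ) - 1) * P.w2) = W ^ 2 := by
      rw [hW]; ring
    have e3' : -(P.s22 * W ^ 2) * (P.s1 - 2) * (P.s1 + P.s21 - P.s1 * P.s21)
      - P.s1 ^ 2 * P.w2 * (2 * P.s21 + P.s22 - 2 * P.s21 * P.s22) = 0 := by
      rw [← e3, Cond2, hW]; ring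
    rw [Rd2, hW2, ← hW] at e2
    rw [hε]
    field_simp
    refine mul_left_cancel₀ h1 ?_
    linear_combination e2 - 4 * e3'

/-! ### Differential operators with constant coefficients -/

section Operators

open MvPolynomial

variable {d : ℕ}

/-- The direction of differentiation for time (`none`) and for the space coordinates. -/
def coordDir : Option (Fin d) → SpaceTime d
  | none => (0, 1)
  | some i => (Pi.single i 1, 0)

/-- The partial derivative with respect to a coordinate of space-time. -/
def pd (v : Option (Fin d)) (g : SpaceTime d → ℝ) (p : SpaceTime d) : ℝ :=
  fderiv ℝ g p (coordDir v)

/-- Iterated partial derivatives. -/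
def wordDeriv (l : List (Option (Fin d))) (g : SpaceTime d → ℝ) : SpaceTime d → ℝ :=
  l.foldr pd g

/-- The differential operator with symbol `q`, applied to `g`. The partial derivatives of a monomial
are taken in an arbitrary order, which does not matter where `g` is smooth. -/
def diffOp (g : SpaceTime d → ℝ) :
    MvPolynomial (Option (Fin d)) ℝ →ₗ[ℝ] (SpaceTime d → ℝ) :=
  (basisMonomials (Option (Fin d)) ℝ).constr ℝ fun α => wordDeriv (Finsupp.toMultiset α).toList g

variable {U : Set (SpaceTime d)} {g g' : SpaceTime d → ℝ}

theorem contDiffOn_pd (hU : IsOpen U) (hg : ContDiffOn ℝ ∞ g U) (v : Option (Fin d)) :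
    ContDiffOn ℝ ∞ (pd v g) U :=
  (hg.fderiv_of_isOpen hU (by simp)).clm_apply contDiffOn_const

theorem pd_congr (hU : IsOpen U) (h : Set.EqOn g g' U) (v : Option (Fin d)) :
    Set.EqOn (pd v g) (pd v g') U := fun p hp => by
  rw [pd, pd, (h.eventuallyEq_of_mem (hU.mem_nhds hp)).fderiv_eq]

theorem pd_pd_comm (hU : IsOpen U) (hg : ContDiffOn ℝ ∞ g U) (v w : Option (Fin d)) :
    Set.EqOn (pd v (pd w g)) (pd w (pd v g)) U := fun p hp => by
  have hgp : ContDiffAt ℝ ∞ g p := hg.contDiffAt (hU.mem_nhds hp)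
  have hd : DifferentiableAt ℝ (fderiv ℝ g) p :=
    (hgp.fderiv_right (m := 1) (by norm_cast)).differentiableAt (by simp)
  have h1 (v w : Option (Fin d)) : pd v (pd w g) p =
      fderiv ℝ (fderiv ℝ g) p (coordDir v) (coordDir w) := by
    have : pd w g = fun p => fderiv ℝ g p (coordDir w) := rfl
    rw [pd, this, fderiv_clm_apply hd (differentiableAt_const _)]
    simp
  rw [h1, h1]
  exact (hgp.isSymmSndFDerivAt (by
    simp only [minSmoothness_of_isRCLikeNormedField]
    exact WithTop.coe_le_coe.2 le_top)).eq _ _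

theorem contDiffOn_wordDeriv (hU : IsOpen U) (hg : ContDiffOn ℝ ∞ g U)
    (l : List (Option (Fin d))) : ContDiffOn ℝ ∞ (wordDeriv l g) U := by
  induction l with
  | nil => exact hg
  | cons v l ih => exact contDiffOn_pd hU ih v

theorem wordDeriv_congr (hU : IsOpen U) (h : Set.EqOn g g' U) (l : List (Option (Fin d))) :
    Set.EqOn (wordDeriv l g) (wordDeriv l g') U := by
  induction l with
  | nil => exact h
  | cons v l ih => exact pd_congr hU ih v

theorem wordDeriv_perm (hU : IsOpen U) (hg : ContDiffOn ℝ ∞ g U) {l l' : List (Option (Fin d))}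
    (hl : l.Perm l') : Set.EqOn (wordDeriv l g) (wordDeriv l' g) U := by
  induction hl with
  | nil => exact fun _ _ => rfl
  | cons v _ ih => exact pd_congr hU ih v
  | swap v w l => exact pd_pd_comm hU (contDiffOn_wordDeriv hU hg l) w v
  | trans _ _ ih ih' => exact ih.trans ih'

theorem diffOp_monomial (g : SpaceTime d → ℝ) (α : Option (Fin d) →₀ ℕ) (c : ℝ) :
    diffOp g (MvPolynomial.monomial α c) = c • wordDeriv (Finsupp.toMultiset α).toList g := by
  have h1 : MvPolynomial.monomial α c = c • basisMonomials (Option (Fin d)) ℝ α := by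
    rw [coe_basisMonomials, smul_monomial, smul_eq_mul, mul_one]
  rw [h1, map_smul, diffOp, Module.Basis.constr_basis]

theorem diffOp_one (g : SpaceTime d → ℝ) : diffOp g 1 = g := by
  have := diffOp_monomial g 0 1
  simpa [wordDeriv] using this

theorem diffOp_X (g : SpaceTime d → ℝ) (v : Option (Fin d)) : diffOp g (X v) = pd v g := by
  have := diffOp_monomial g (Finsupp.single v 1) 1
  simpa [wordDeriv, MvPolynomial.X] using this

theorem diffOp_C_mul (g : SpaceTime d → ℝ) (c : ℝ) (q : MvPolynomial (Option (Fin d)) ℝ) :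
    diffOp g (C c * q) = c • diffOp g q := by
  rw [← smul_eq_C_mul, map_smul]

theorem contDiffOn_diffOp (hU : IsOpen U) (hg : ContDiffOn ℝ ∞ g U)
    (q : MvPolynomial (Option (Fin d)) ℝ) : ContDiffOn ℝ ∞ (diffOp g q) U := by
  induction q using MvPolynomial.induction_on' with
  | monomial α c =>
    rw [diffOp_monomial]
    exact contDiffOn_const.smul (contDiffOn_wordDeriv hU hg _)
  | add q q' h h' =>
    rw [map_add]
    exact h.add h'

theorem diffOp_congr (hU : IsOpen U) (h : Set.EqOn g g' U)
    (q : MvPolynomial (Option (Fin d)) ℝ) : Set.EqOn (diffOp g q) (diffOp g' q) U := by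
  induction q using MvPolynomial.induction_on' with
  | monomial α c =>
    intro p hp
    simp only [diffOp_monomial, Pi.smul_apply, wordDeriv_congr hU h _ hp]
  | add q q' h h' =>
    intro p hp
    simp only [map_add, Pi.add_apply, h hp, h' hp]

theorem differentiableAt_of_contDiffOn (hU : IsOpen U) (hg : ContDiffOn ℝ ∞ g U)
    {p : SpaceTime d} (hp : p ∈ U) : DifferentiableAt ℝ g p :=
  (hg.contDiffAt (hU.mem_nhds hp)).differentiableAt (by simp)

theorem pd_add (hU : IsOpen U) (hg : ContDiffOn ℝ ∞ g U) (hg' : ContDiffOn ℝ ∞ g' U)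
    (v : Option (Fin d)) : Set.EqOn (pd v (g + g')) (pd v g + pd v g') U := fun p hp => by
  rw [pd, fderiv_add (differentiableAt_of_contDiffOn hU hg hp)
    (differentiableAt_of_contDiffOn hU hg' hp)]
  rfl

theorem pd_smul (c : ℝ) (g : SpaceTime d → ℝ) (v : Option (Fin d)) :
    pd v (c • g) = c • pd v g := by
  funext p
  simp only [pd, Pi.smul_apply]
  rw [fderiv_const_smul_field]
  rfl

theorem diffOp_X_mul (hU : IsOpen U) (hg : ContDiffOn ℝ ∞ g U) (v : Option (Fin d))
    (q : MvPolynomial (Option (Fin d)) ℝ) :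
    Set.EqOn (diffOp g (X v * q)) (pd v (diffOp g q)) U := by
  induction q using MvPolynomial.induction_on' with
  | monomial α c =>
    have h1 : X v * MvPolynomial.monomial α c =
        MvPolynomial.monomial (Finsupp.single v 1 + α) c := by
      rw [MvPolynomial.X, monomial_mul, one_mul]
    rw [h1, diffOp_monomial, diffOp_monomial, pd_smul]
    intro p hp
    have h2 : (Finsupp.toMultiset (Finsupp.single v 1 + α)).toList.Perm
        (v :: (Finsupp.toMultiset α).toList) := by
      rw [← Multiset.coe_eq_coe, ← Multiset.cons_coe, Multiset.coe_toList, Multiset.coe_toList]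
      simp
    simp only [Pi.smul_apply, wordDeriv_perm hU hg h2 hp]
    rfl
  | add q q' h h' =>
    rw [mul_add, map_add, map_add]
    intro p hp
    rw [pd_add hU (contDiffOn_diffOp hU hg q) (contDiffOn_diffOp hU hg q') v hp]
    simp only [Pi.add_apply, h hp, h' hp]

/-- Composition of differential operators is multiplication of their symbols. -/
theorem diffOp_mul (hU : IsOpen U) (hg : ContDiffOn ℝ ∞ g U)
    (q q' : MvPolynomial (Option (Fin d)) ℝ) :
    Set.EqOn (diffOp g (q * q')) (diffOp (diffOp g q') q) U := by
  induction q using MvPolynomial.induction_on with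
  | C c =>
    intro p _
    have h1 := diffOp_C_mul (diffOp g q') c 1
    rw [mul_one, diffOp_one] at h1
    rw [diffOp_C_mul, h1]
  | add q₁ q₂ h₁ h₂ =>
    intro p hp
    simp only [add_mul, map_add, Pi.add_apply, h₁ hp, h₂ hp]
  | mul_X q v h =>
    have h1 : q * X v * q' = X v * (q * q') := by ring
    rw [h1, mul_comm q (X v)]
    intro p hp
    rw [diffOp_X_mul hU hg v _ hp, pd_congr hU h v hp,
      diffOp_X_mul hU (contDiffOn_diffOp hU hg q') v _ hp]

theorem diffOp_add (hU : IsOpen U) (hg : ContDiffOn ℝ ∞ g U) (hg' : ContDiffOn ℝ ∞ g' U)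
    (q : MvPolynomial (Option (Fin d)) ℝ) :
    Set.EqOn (diffOp (g + g') q) (diffOp g q + diffOp g' q) U := by
  have hw (l : List (Option (Fin d))) :
      Set.EqOn (wordDeriv l (g + g')) (wordDeriv l g + wordDeriv l g') U := by
    induction l with
    | nil => exact fun _ _ => rfl
    | cons v l ih =>
      exact (pd_congr hU ih v).trans
        (pd_add hU (contDiffOn_wordDeriv hU hg l) (contDiffOn_wordDeriv hU hg' l) v)
  induction q using MvPolynomial.induction_on' with
  | monomial α c =>
    intro p hp
    simp only [diffOp_monomial, Pi.smul_apply, Pi.add_apply, hw _ hp, smul_add]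
  | add q q' h h' =>
    intro p hp
    simp only [map_add, Pi.add_apply, h hp, h' hp]
    ring

theorem diffOp_smul (c : ℝ) (g : SpaceTime d → ℝ) (q : MvPolynomial (Option (Fin d)) ℝ) :
    diffOp (c • g) q = c • diffOp g q := by
  have hw (l : List (Option (Fin d))) : wordDeriv l (c • g) = c • wordDeriv l g := by
    induction l with
    | nil => rfl
    | cons v l ih =>
      change pd v (wordDeriv l (c • g)) = c • pd v (wordDeriv l g)
      rw [ih, pd_smul]
  induction q using MvPolynomial.induction_on' with
  | monomial α a =>
    rw [diffOp_monomial, diffOp_monomial, hw, smul_comm]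
  | add q q' h h' => rw [map_add, map_add, h, h', smul_add]

theorem diffOp_sum_smul (hU : IsOpen U) {ι : Type*} (s : Finset ι) (c : ι → ℝ)
    {f : ι → SpaceTime d → ℝ} (hf : ∀ i, ContDiffOn ℝ ∞ (f i) U)
    (q : MvPolynomial (Option (Fin d)) ℝ) :
    Set.EqOn (diffOp (fun p => ∑ i ∈ s, c i * f i p) q)
      (fun p => ∑ i ∈ s, c i * diffOp (f i) q p) U := by
  classical
  induction s using Finset.induction_on with
  | empty =>
    intro p _
    have h1 := diffOp_smul 0 (0 : SpaceTime d → ℝ) q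
    rw [zero_smul, zero_smul] at h1
    simp only [Finset.sum_empty]
    exact congrFun h1 p
  | insert i s hi ih =>
    intro p hp
    simp only [Finset.sum_insert hi]
    have h1 : (fun p => c i * f i p + ∑ i ∈ s, c i * f i p) =
        c i • f i + fun p => ∑ i ∈ s, c i * f i p := rfl
    rw [h1, diffOp_add hU (g := c i • f i) ((hf i).const_smul (c i))
      (ContDiffOn.sum fun i _ => contDiffOn_const.mul (hf i)) q hp, diffOp_smul]
    simp only [Pi.add_apply, ih hp]
    rfl

theorem pd_translate (a : SpaceTime d) (g : SpaceTime d → ℝ) (v : Option (Fin d)) :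
    pd v (fun p => g (p + a)) = fun p => pd v g (p + a) := by
  funext p
  rw [pd, fderiv_comp_add_right, pd]

theorem diffOp_translate (a : SpaceTime d) (g : SpaceTime d → ℝ)
    (q : MvPolynomial (Option (Fin d)) ℝ) :
    diffOp (fun p => g (p + a)) q = fun p => diffOp g q (p + a) := by
  have hw (l : List (Option (Fin d))) :
      wordDeriv l (fun p => g (p + a)) = fun p => wordDeriv l g (p + a) := by
    induction l with
    | nil => rfl
    | cons v l ih =>
      change pd v (wordDeriv l fun p => g (p + a)) = fun p => pd v (wordDeriv l g) (p + a)
      rw [ih, pd_translate]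
  induction q using MvPolynomial.induction_on' with
  | monomial α c => rw [diffOp_monomial, diffOp_monomial, hw]; rfl
  | add q q' h h' => rw [map_add, map_add, h, h']; rfl

/-- Derivatives in a fixed direction are given by linear symbols. -/
theorem fderiv_eq_diffOp (g : SpaceTime d → ℝ) (p : SpaceTime d) (a : Fin d → ℝ) (b : ℝ) :
    fderiv ℝ g p (a, b) = diffOp g (∑ i, C (a i) * X (some i) + C b * X none) p := by
  have h1 : ((a, b) : SpaceTime d) =
      ∑ i, a i • coordDir (some i) + b • coordDir none := by
    refine Prod.ext ?_ ?_
    · simp only [coordDir, Prod.smul_mk, Prod.fst_add, Prod.fst_sum, smul_zero, add_zero]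
      ext j
      simp [Finset.sum_apply, Pi.single_apply]
    · simp [coordDir, Prod.snd_sum]
  rw [h1]
  simp only [map_add, map_sum, map_smul, diffOp_C_mul, diffOp_X, Pi.add_apply, Finset.sum_apply,
    Pi.smul_apply]
  rfl

theorem norm_iteratedFDeriv_wordDeriv_le (hU : IsOpen U) (hg : ContDiffOn ℝ ∞ g U)
    (l : List (Option (Fin d))) (n : ℕ) {p : SpaceTime d} (hp : p ∈ U) :
    ‖iteratedFDeriv ℝ n (wordDeriv l g) p‖ ≤ ‖iteratedFDeriv ℝ (n + l.length) g p‖ := by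
  induction l generalizing n with
  | nil => exact le_rfl
  | cons v l ih =>
    have h1 : ContDiffAt ℝ ∞ (wordDeriv l g) p :=
      (contDiffOn_wordDeriv hU hg l).contDiffAt (hU.mem_nhds hp)
    have h2 := norm_iteratedFDeriv_clm_apply_const (𝕜 := ℝ) (n := n) (N := ∞)
      (f := fderiv ℝ (wordDeriv l g)) (c := (coordDir v : SpaceTime d)) (x := p)
      (h1.fderiv_right (by simp)) (by exact_mod_cast le_top)
    have h3 : ‖(coordDir v : SpaceTime d)‖ ≤ 1 := by
      cases v with
      | none => simp [coordDir, Prod.norm_def]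
      | some i =>
        rw [coordDir, Prod.norm_def, Pi.norm_single]
        simp
    rw [norm_iteratedFDeriv_fderiv] at h2
    refine (h2.trans ?_).trans ((ih (n + 1)).trans (le_of_eq ?_))
    · exact mul_le_of_le_one_left (norm_nonneg _) h3
    · rw [List.length_cons, add_right_comm, add_assoc]

end Operators

/-! ### Asymptotic bounds -/

section BigO

variable {d : ℕ} {U : Set (SpaceTime d)} {r s : ℕ} {g g' : ℝ → SpaceTime d → ℝ}

theorem LocBigO.congr (hg : LocBigO U r g) (h : ∀ K : Set (SpaceTime d), K ⊆ U → IsCompact K →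
    ∃ h₀ : ℝ, 0 < h₀ ∧ ∀ h, 0 < h → h < h₀ → ∀ p ∈ K, g' h p = g h p) : LocBigO U r g' := by
  intro K hK hKc
  obtain ⟨C, h₁, h₁pos, H⟩ := hg K hK hKc
  obtain ⟨h₂, h₂pos, H'⟩ := h K hK hKc
  refine ⟨C, min h₁ h₂, lt_min h₁pos h₂pos, fun h hh hlt p hp => ?_⟩
  rw [H' h hh (hlt.trans_le (min_le_right _ _)) p hp]
  exact H h hh (hlt.trans_le (min_le_left _ _)) p hp

theorem LocBigO.congr_of_lt {h₀ : ℝ} (hg : LocBigO U r g) (hh₀ : 0 < h₀)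
    (h : ∀ h, 0 < h → h < h₀ → ∀ p ∈ U, g' h p = g h p) : LocBigO U r g' :=
  hg.congr fun _ hK _ => ⟨h₀, hh₀, fun h' hh hlt p hp => h h' hh hlt p (hK hp)⟩

theorem LocBigO.zero : LocBigO U r (fun _ _ => 0) := fun _ _ _ =>
  ⟨0, 1, one_pos, fun _ _ _ _ _ => by simp⟩

theorem LocBigO.add (hg : LocBigO U r g) (hg' : LocBigO U r g') :
    LocBigO U r (fun h p => g h p + g' h p) := by
  intro K hK hKc
  obtain ⟨C, h₁, h₁pos, H⟩ := hg K hK hKc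
  obtain ⟨C', h₂, h₂pos, H'⟩ := hg' K hK hKc
  refine ⟨C + C', min h₁ h₂, lt_min h₁pos h₂pos, fun h hh hlt p hp => ?_⟩
  rw [add_mul]
  exact (abs_add_le _ _).trans (add_le_add (H h hh (hlt.trans_le (min_le_left _ _)) p hp)
    (H' h hh (hlt.trans_le (min_le_right _ _)) p hp))

theorem LocBigO.mul (hg : LocBigO U r g) (hg' : LocBigO U s g') :
    LocBigO U (r + s) (fun h p => g h p * g' h p) := by
  intro K hK hKc
  obtain ⟨C, h₁, h₁pos, H⟩ := hg K hK hKc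
  obtain ⟨C', h₂, h₂pos, H'⟩ := hg' K hK hKc
  refine ⟨C * C', min h₁ h₂, lt_min h₁pos h₂pos, fun h hh hlt p hp => ?_⟩
  have h1 := H h hh (hlt.trans_le (min_le_left _ _)) p hp
  rw [abs_mul, pow_add, mul_mul_mul_comm]
  exact mul_le_mul h1 (H' h hh (hlt.trans_le (min_le_right _ _)) p hp) (abs_nonneg _)
    ((abs_nonneg _).trans h1)

theorem LocBigO.pow (n : ℕ) : LocBigO U n (fun h _ => h ^ n) := fun _ _ _ =>
  ⟨1, 1, one_pos, fun h hh _ _ _ => by rw [one_mul, abs_of_pos (pow_pos hh n)]⟩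

theorem LocBigO.const (c : ℝ) : LocBigO U 0 (fun _ _ => c) := fun _ _ _ =>
  ⟨|c|, 1, one_pos, fun _ _ _ _ _ => by simp⟩

theorem LocBigO.const_mul (c : ℝ) (hg : LocBigO U r g) : LocBigO U r (fun h p => c * g h p) := by
  simpa using (LocBigO.const c).mul hg

theorem LocBigO.pow_mul (n : ℕ) (hg : LocBigO U r g) :
    LocBigO U (n + r) (fun h p => h ^ n * g h p) := (LocBigO.pow n).mul hg

theorem LocBigO.neg (hg : LocBigO U r g) : LocBigO U r (fun h p => -g h p) := by
  simpa using hg.const_mul (-1)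

theorem LocBigO.sub (hg : LocBigO U r g) (hg' : LocBigO U r g') :
    LocBigO U r (fun h p => g h p - g' h p) := by
  simpa [sub_eq_add_neg] using hg.add hg'.neg

theorem LocBigO.sum {ι : Type*} (t : Finset ι) {f : ι → ℝ → SpaceTime d → ℝ}
    (hf : ∀ i ∈ t, LocBigO U r (f i)) : LocBigO U r (fun h p => ∑ i ∈ t, f i h p) := by
  classical
  induction t using Finset.induction_on with
  | empty => simpa using LocBigO.zero
  | insert i t hi ih =>
    simp only [Finset.sum_insert hi]
    exact (hf i (Finset.mem_insert_self _ _)).add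
      (ih fun j hj => hf j (Finset.mem_insert_of_mem hj))

theorem LocBigO.mono (hrs : r ≤ s) (hg : LocBigO U s g) : LocBigO U r g := by
  intro K hK hKc
  obtain ⟨C, h₁, h₁pos, H⟩ := hg K hK hKc
  refine ⟨|C|, min h₁ 1, lt_min h₁pos one_pos, fun h hh hlt p hp => ?_⟩
  refine (H h hh (hlt.trans_le (min_le_left _ _)) p hp).trans ?_
  exact mul_le_mul (le_abs_self C)
    (pow_le_pow_of_le_one hh.le (hlt.trans_le (min_le_right _ _)).le hrs) (by positivity)
    (abs_nonneg C)

theorem LocBigO.of_pow_mul (n : ℕ) (hg : LocBigO U (n + r) (fun h p => h ^ n * g h p)) :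
    LocBigO U r g := by
  intro K hK hKc
  obtain ⟨C, h₁, h₁pos, H⟩ := hg K hK hKc
  refine ⟨C, h₁, h₁pos, fun h hh hlt p hp => ?_⟩
  have h1 := H h hh hlt p hp
  have h2 : 0 < h ^ n := pow_pos hh n
  rw [abs_mul, abs_of_pos h2, pow_add, mul_left_comm] at h1
  exact le_of_mul_le_mul_left h1 h2

end BigO

/-! ### Families of functions and symbols depending on the lattice spacing -/

section Jets

variable {d : ℕ}

/-- Polynomials in the lattice spacing (`Polynomial.X`) with coefficients in the symbols of
differential operators with constant coefficients. -/
abbrev Symb (d : ℕ) : Type := Polynomial (MvPolynomial (Option (Fin d)) ℝ)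

/-- The symbol of `∂ᵢ`. -/
def symX (i : Fin d) : Symb d := Polynomial.C (MvPolynomial.X (some i))

/-- The symbol of `η ∂ₜ`. -/
def symT (η : ℝ) : Symb d := η • Polynomial.C (MvPolynomial.X none)

/-- The operator with symbol `q` applied to a family of functions, where the indeterminate of `q`
takes the value of the lattice spacing. -/
def jet (f : ℝ → SpaceTime d → ℝ) (q : Symb d) : ℝ → SpaceTime d → ℝ :=
  fun h => diffOp (f h) (q.eval (MvPolynomial.C h))

/-- A family of smooth functions all of whose derivatives are locally bounded, uniformly in the
lattice spacing; the derivatives are expressed by symbols. -/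
structure Reg (U : Set (SpaceTime d)) (h₀ : ℝ) (f : ℝ → SpaceTime d → ℝ) : Prop where
  pos : 0 < h₀
  smooth : ∀ h, 0 < h → h < h₀ → ContDiffOn ℝ ∞ (f h) U
  bounded : ∀ q, LocBigO U 0 (fun h => diffOp (f h) q)

variable {U : Set (SpaceTime d)} {h₀ : ℝ} {f : ℝ → SpaceTime d → ℝ}

theorem jet_one (h : ℝ) : jet f 1 h = f h := by
  rw [jet, Polynomial.eval_one, diffOp_one]

theorem jet_add (q q' : Symb d) (h : ℝ) (p : SpaceTime d) :
    jet f (q + q') h p = jet f q h p + jet f q' h p := by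
  rw [jet, Polynomial.eval_add, map_add]; rfl

theorem jet_sub (q q' : Symb d) (h : ℝ) (p : SpaceTime d) :
    jet f (q - q') h p = jet f q h p - jet f q' h p := by
  rw [jet, Polynomial.eval_sub, map_sub]; rfl

theorem jet_smul (c : ℝ) (q : Symb d) (h : ℝ) (p : SpaceTime d) :
    jet f (c • q) h p = c * jet f q h p := by
  rw [jet, Polynomial.eval_smul, map_smul]; rfl

theorem jet_sum {ι : Type*} (t : Finset ι) (q : ι → Symb d) (h : ℝ) (p : SpaceTime d) :
    jet f (∑ i ∈ t, q i) h p = ∑ i ∈ t, jet f (q i) h p := by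
  rw [jet, Polynomial.eval_finsetSum, map_sum, Finset.sum_apply]; rfl

theorem jet_X_pow_mul (n : ℕ) (q : Symb d) (h : ℝ) (p : SpaceTime d) :
    jet f (Polynomial.X ^ n * q) h p = h ^ n * jet f q h p := by
  rw [jet, Polynomial.eval_mul, Polynomial.eval_pow, Polynomial.eval_X, ← map_pow, diffOp_C_mul]
  rfl

theorem jet_mul (hU : IsOpen U) {h : ℝ} (hf : ContDiffOn ℝ ∞ (f h) U) (q q' : Symb d)
    {p : SpaceTime d} (hp : p ∈ U) : jet f (q * q') h p = jet (jet f q') q h p := by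
  rw [jet, Polynomial.eval_mul, diffOp_mul hU hf _ _ hp]
  rfl

/-- Bounds for constant symbols extend to symbols that are polynomials in the lattice spacing. -/
theorem locBigO_jet {n : ℕ} (hf : ∀ q, LocBigO U n (fun h => diffOp (f h) q)) (q : Symb d) :
    LocBigO U n (jet f q) := by
  have h1 : jet f q = fun h p => ∑ m ∈ Finset.range (q.natDegree + 1),
      h ^ m * diffOp (f h) (q.coeff m) p := by
    funext h p
    rw [jet, Polynomial.eval_eq_sum_range, map_sum, Finset.sum_apply]
    refine Finset.sum_congr rfl fun m _ => ?_
    rw [← map_pow, mul_comm, diffOp_C_mul]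
    rfl
  rw [h1]
  exact LocBigO.sum _ fun m _ => ((hf _).pow_mul m).mono (by omega)

theorem Reg.locBigO (hf : Reg U h₀ f) (q : Symb d) : LocBigO U 0 (jet f q) :=
  locBigO_jet hf.bounded q

theorem Reg.locBigO_of_dvd (hf : Reg U h₀ f) {n : ℕ} {q : Symb d} (hq : Polynomial.X ^ n ∣ q) :
    LocBigO U n (jet f q) := by
  obtain ⟨q, rfl⟩ := hq
  have h1 : jet f (Polynomial.X ^ n * q) = fun h p => h ^ n * jet f q h p := by
    funext h p
    exact jet_X_pow_mul n q h p
  rw [h1]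
  exact (hf.locBigO q).pow_mul n

theorem Reg.jet (hU : IsOpen U) (hf : Reg U h₀ f) (q : Symb d) : Reg U h₀ (jet f q) := by
  refine ⟨hf.pos, fun h hh hlt => contDiffOn_diffOp hU (hf.smooth h hh hlt) _, fun q' => ?_⟩
  refine (hf.locBigO (Polynomial.C q' * q)).congr_of_lt hf.pos fun h hh hlt p hp => ?_
  rw [jet_mul hU (hf.smooth h hh hlt) _ _ hp, MRTLB.jet.eq_def (MRTLB.jet f q), Polynomial.eval_C]

theorem Reg.sum {ι : Type*} [Fintype ι] (hU : IsOpen U) (hh₀ : 0 < h₀)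
    {f : ι → ℝ → SpaceTime d → ℝ} (hf : ∀ i, Reg U h₀ (f i)) (c : ι → ℝ) :
    Reg U h₀ (fun h p => ∑ i, c i * f i h p) := by
  refine ⟨hh₀, fun h hh hlt => ContDiffOn.sum fun i _ =>
    contDiffOn_const.mul ((hf i).smooth h hh hlt), fun q => ?_⟩
  refine (LocBigO.sum Finset.univ fun i _ => ((hf i).bounded q).const_mul (c i)).congr_of_lt hh₀
    fun h hh hlt p hp => ?_
  exact diffOp_sum_smul hU Finset.univ c (fun i => (hf i).smooth h hh hlt) q hp

theorem jet_sum_mul {ι : Type*} [Fintype ι] (hU : IsOpen U)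
    {f : ι → ℝ → SpaceTime d → ℝ} {h : ℝ} (hf : ∀ i, ContDiffOn ℝ ∞ (f i h) U) (c : ι → ℝ)
    (q : Symb d) {p : SpaceTime d} (hp : p ∈ U) :
    jet (fun h p => ∑ i, c i * f i h p) q h p = ∑ i, c i * jet (f i) q h p :=
  diffOp_sum_smul hU Finset.univ c hf _ hp

theorem reg_of_regularFamily (hU : IsOpen U) {f : ℝ → Slot d → SpaceTime d → ℝ}
    (hf : RegularFamily U f) : ∃ h₀ : ℝ, 0 < h₀ ∧ ∀ k, Reg U h₀ (fun h => f h k) := by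
  obtain ⟨h₀, hh₀, hs, hb⟩ := hf
  refine ⟨h₀, hh₀, fun k => ⟨hh₀, fun h hh hlt => hs h hh hlt k, fun q => ?_⟩⟩
  induction q using MvPolynomial.induction_on' with
  | monomial α c =>
    intro K hK hKc
    obtain ⟨C, hC⟩ := hb k (Finsupp.toMultiset α).toList.length K hK hKc
    refine ⟨|c| * C, h₀, hh₀, fun h hh hlt p hp => ?_⟩
    change |diffOp (f h k) (MvPolynomial.monomial α c) p| ≤ _
    rw [diffOp_monomial, Pi.smul_apply, smul_eq_mul, abs_mul, pow_zero, mul_one]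
    refine mul_le_mul_of_nonneg_left (le_trans ?_ (hC h hh hlt p hp)) (abs_nonneg c)
    have h1 := norm_iteratedFDeriv_wordDeriv_le hU (hs h hh hlt k) (Finsupp.toMultiset α).toList 0
      (hK hp)
    rwa [norm_iteratedFDeriv_zero, Real.norm_eq_abs, zero_add] at h1
  | add q q' h h' =>
    simp only [map_add]
    exact h.add h'

/-! ### Taylor expansion along the lattice velocities -/

/-- Taylor's formula on `[0, 1]` for a chain of successive derivatives. -/
theorem taylor_bound {C : ℝ} (n : ℕ) (φ : ℕ → ℝ → ℝ)
    (hφ : ∀ j < n, ∀ s ∈ Set.Icc (0 : ℝ) 1, HasDerivAt (φ j) (φ (j + 1) s) s)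
    (hC : ∀ s ∈ Set.Icc (0 : ℝ) 1, |φ n s| ≤ C) :
    ∀ s ∈ Set.Icc (0 : ℝ) 1,
      |φ 0 s - ∑ j ∈ Finset.range n, s ^ j / (j.factorial : ℝ) * φ j 0| ≤ C := by
  induction n generalizing φ with
  | zero => simpa using hC
  | succ n ih =>
    have hC0 : 0 ≤ C := (abs_nonneg _).trans (hC 0 (by simp))
    have h1 := ih (fun j => φ (j + 1)) (fun j hj => hφ (j + 1) (by omega)) hC
    -- the error for `φ 0` is an antiderivative of the error for `φ 1`
    have h2 : ∀ s ∈ Set.Icc (0 : ℝ) 1, HasDerivWithinAt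
        (fun s => φ 0 s - ∑ j ∈ Finset.range (n + 1), s ^ j / (j.factorial : ℝ) * φ j 0)
        (φ 1 s - ∑ j ∈ Finset.range n, s ^ j / (j.factorial : ℝ) * φ (j + 1) 0)
        (Set.Icc 0 1) s := by
      intro s hs
      refine ((hφ 0 (by omega) s hs).sub ?_).hasDerivWithinAt
      simp only [Finset.sum_range_succ' _ n]
      simp only [pow_zero]
      refine HasDerivAt.add_const _ (HasDerivAt.fun_sum fun j _ => ?_)
      refine HasDerivAt.mul_const ?_ _
      refine ((hasDerivAt_pow (j + 1) s).div_const _).congr_deriv ?_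
      rw [Nat.factorial_succ, Nat.add_sub_cancel]
      have : (j.factorial : ℝ) ≠ 0 := by positivity
      push_cast
      field_simp
    intro s hs
    have h3 := (convex_Icc (0 : ℝ) 1).norm_image_sub_le_of_norm_hasDerivWithin_le h2 h1
      (Set.left_mem_Icc.2 zero_le_one) hs
    have h4 : φ 0 0 - ∑ j ∈ Finset.range (n + 1), (0 : ℝ) ^ j / (j.factorial : ℝ) * φ j 0 = 0 := by
      simp [Finset.sum_range_succ']
    rw [h4, sub_zero, Real.norm_eq_abs, Real.norm_eq_abs, sub_zero] at h3
    exact h3.trans (mul_le_of_le_one_right hC0 (by rw [abs_of_nonneg hs.1]; exact hs.2))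

end Jets

section Taylor

variable {d : ℕ} {U : Set (SpaceTime d)} {h₀ : ℝ} {f : ℝ → SpaceTime d → ℝ}

theorem stream_eq {η h : ℝ} (hη : 0 < η) (hh : 0 < h) (k : Slot d) (p : SpaceTime d) :
    stream η h k p = p + (h • dir k, η * h ^ 2) := by
  have h1 : timeStep η h * latticeSpeed η h = h := by
    rw [latticeSpeed, timeStep]
    field_simp
  refine Prod.ext ?_ rfl
  change p.1 + timeStep η h • vel (latticeSpeed η h) k = p.1 + h • dir k
  rw [vel, smul_smul, h1]

/-- The symbol of the derivative along the displacement of the `k`-th discrete velocity. -/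
def shiftDir (η : ℝ) (k : Slot d) : Symb d :=
  Polynomial.X * ((∑ i, dir k i • symX i) + Polynomial.X * symT η)

theorem fderiv_eq_jet {η h : ℝ} (k : Slot d) (p : SpaceTime d) :
    fderiv ℝ (f h) p (h • dir k, η * h ^ 2) = jet f (shiftDir η k) h p := by
  rw [fderiv_eq_diffOp, jet]
  have h1 (i : Fin d) : (dir k i • symX i : Symb d).eval (MvPolynomial.C h) =
      dir k i • MvPolynomial.X (some i) := by
    rw [Polynomial.eval_smul, symX, Polynomial.eval_C]
  have h2 : (symT η : Symb d).eval (MvPolynomial.C h) = η • MvPolynomial.X none := by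
    rw [symT, Polynomial.eval_smul, Polynomial.eval_C]
  have h3 : (shiftDir η k).eval (MvPolynomial.C h) =
      ∑ i, MvPolynomial.C ((h • dir k) i) * MvPolynomial.X (some i) +
        MvPolynomial.C (η * h ^ 2) * MvPolynomial.X none := by
    rw [shiftDir, Polynomial.eval_mul, Polynomial.eval_add, Polynomial.eval_mul,
      Polynomial.eval_X, Polynomial.eval_finsetSum, h2, mul_add, Finset.mul_sum]
    congr 1
    · refine Finset.sum_congr rfl fun i _ => ?_
      rw [h1, MvPolynomial.smul_eq_C_mul, ← mul_assoc, ← map_mul]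
      rfl
    · rw [MvPolynomial.smul_eq_C_mul, ← mul_assoc, ← mul_assoc, ← map_mul, ← map_mul]
      congr 2
      ring
  rw [h3]

/-- Streaming is given by the truncated exponential symbol up to sixth order. -/
theorem taylor_stream (hU : IsOpen U) {η : ℝ} (hη : 0 < η) (hf : Reg U h₀ f) (k : Slot d) :
    LocBigO U 6 (fun h p =>
      f h (stream η h k p) - jet f (shiftSymbol Polynomial.X (symT η) symX k) h p) := by
  intro K hK hKc
  obtain ⟨δ, hδ, hδU⟩ := hKc.exists_cthickening_subset_open hU hK
  have hdvd : Polynomial.X ^ 6 ∣ shiftDir η k ^ 6 := pow_dvd_pow_of_dvd (Dvd.intro _ rfl) 6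
  obtain ⟨C, h₁, h₁pos, H⟩ := hf.locBigO_of_dvd hdvd _ hδU hKc.cthickening
  have hb : 0 < ‖dir k‖ + η := by positivity
  refine ⟨C, min (min h₀ h₁) (min 1 (δ / (‖dir k‖ + η))),
    lt_min (lt_min hf.pos h₁pos) (lt_min one_pos (div_pos hδ hb)), fun h hh hlt p hp => ?_⟩
  simp only [lt_min_iff] at hlt
  obtain ⟨⟨hlt0, hlt1⟩, hlt2, hlt3⟩ := hlt
  have hv : ‖((h • dir k, η * h ^ 2) : SpaceTime d)‖ ≤ δ := by
    rw [lt_div_iff₀ hb] at hlt3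
    refine le_trans ?_ hlt3.le
    have h2 : η * h ^ 2 ≤ h * η := by nlinarith [mul_pos hη hh]
    have h3 : 0 ≤ h * ‖dir k‖ := by positivity
    have h4 : 0 ≤ h * η := by positivity
    rw [Prod.norm_mk, norm_smul, Real.norm_of_nonneg hh.le, Real.norm_of_nonneg (by positivity)]
    exact max_le (by linarith) (by linarith)
  have hmem (s : ℝ) (hs : s ∈ Set.Icc (0 : ℝ) 1) :
      p + s • ((h • dir k, η * h ^ 2) : SpaceTime d) ∈ Metric.cthickening δ K := by
    refine Metric.mem_cthickening_of_dist_le _ p δ K hp ?_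
    rw [dist_eq_norm, add_sub_cancel_left, norm_smul, Real.norm_of_nonneg hs.1]
    exact (mul_le_of_le_one_left (norm_nonneg _) hs.2).trans hv
  have hT := taylor_bound (C := C * h ^ 6) 6
    (fun j s => jet f (shiftDir η k ^ j) h (p + s • ((h • dir k, η * h ^ 2) : SpaceTime d)))
    (fun j _ s hs => by
      have hpU := hδU (hmem s hs)
      have hsm := contDiffOn_diffOp hU (hf.smooth h hh hlt0)
        ((shiftDir η k ^ j).eval (MvPolynomial.C h))
      have h5 := (differentiableAt_of_contDiffOn hU hsm hpU).hasFDerivAt.comp_hasDerivAt s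
        (((hasDerivAt_id s).smul_const ((h • dir k, η * h ^ 2) : SpaceTime d)).const_add p)
      refine h5.congr_deriv ?_
      rw [one_smul, pow_succ' (shiftDir η k), jet_mul hU (hf.smooth h hh hlt0) _ _ hpU]
      exact fderiv_eq_jet (f := jet f (shiftDir η k ^ j)) k _)
    (fun s hs => H h hh hlt1 _ (hmem s hs)) 1 (by simp)
  simp only [one_smul, zero_smul, add_zero, pow_zero, jet_one, one_pow] at hT
  change |f h (stream η h k p) - _| ≤ _
  rw [stream_eq hη hh]
  convert hT using 3
  change jet f (texp (shiftDir η k)) h p = _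
  rw [texp, jet_sum]
  exact Finset.sum_congr rfl fun j _ => jet_smul _ _ _ _

end Taylor

/-! ### Consequences of the scheme for all derivatives -/

section Scheme

variable {d : ℕ} {U : Set (SpaceTime d)} {h₀ η : ℝ} {P : Params}
  {f : ℝ → Slot d → SpaceTime d → ℝ}

/-- The coefficients of the right hand side of the evolution equation. -/
def update (P : Params) (k l : Slot d) : ℝ :=
  (if k = l then 1 else 0) - (collision d P 1 k l - ∑ m, collision d P 1 k m * weight P m)

theorem sum_update_mul (k : Slot d) (x : Slot d → ℝ) : ∑ l, update P k l * x l =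
    x k - ∑ l, collision d P 1 k l * (x l - weight P l * ∑ m, x m) := by
  simp only [update, sub_mul, mul_sub, ite_mul, one_mul, zero_mul, Finset.sum_sub_distrib,
    Finset.sum_ite_eq, Finset.mem_univ, if_true, Finset.sum_mul]
  congr 2
  simp only [Finset.mul_sum, mul_assoc]
  rw [Finset.sum_comm]

theorem latticeSpeed_ne_zero {h : ℝ} (hη : 0 < η) (hh : 0 < h) : latticeSpeed η h ≠ 0 := by
  rw [latticeSpeed, timeStep]
  positivity

theorem lbDefect_eq {h : ℝ} (hη : 0 < η) (hh : 0 < h) (g : Slot d → SpaceTime d → ℝ) (k : Slot d)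
    (p : SpaceTime d) :
    lbDefect P η h g k p = g k (stream η h k p) - ∑ l, update P k l * g l p := by
  rw [sum_update_mul, lbDefect, collision_eq P (latticeSpeed_ne_zero hη hh)]
  rfl

/-- The points of a compact set are moved within `U` if the lattice spacing is small. -/
theorem exists_stream_mem (hU : IsOpen U) (hη : 0 < η) {K : Set (SpaceTime d)} (hK : K ⊆ U)
    (hKc : IsCompact K) :
    ∃ h₁ : ℝ, 0 < h₁ ∧ ∀ h, 0 < h → h < h₁ → ∀ p ∈ K, ∀ k, stream η h k p ∈ U := by
  obtain ⟨δ, hδ, hδU⟩ := hKc.exists_cthickening_subset_open hU hK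
  have h1 (k : Slot d) : Filter.Tendsto (fun h : ℝ => ((h • dir k, η * h ^ 2) : SpaceTime d))
      (nhds 0) (nhds 0) := by
    have : Continuous fun h : ℝ => ((h • dir k, η * h ^ 2) : SpaceTime d) := by fun_prop
    convert this.tendsto 0 using 2
    simp
    rfl
  have h2 : ∀ᶠ h in nhds (0 : ℝ), ∀ k : Slot d,
      ((h • dir k, η * h ^ 2) : SpaceTime d) ∈ Metric.ball 0 δ :=
    Filter.eventually_all.2 fun k => h1 k (Metric.ball_mem_nhds _ hδ)
  obtain ⟨h₁, h₁pos, H⟩ := Metric.eventually_nhds_iff.1 h2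
  refine ⟨h₁, h₁pos, fun h hh hlt p hp k => hδU ?_⟩
  refine Metric.mem_cthickening_of_dist_le _ p δ K hp ?_
  rw [stream_eq hη hh, dist_eq_norm, add_sub_cancel_left]
  have h3 := H (y := h) (by rwa [Real.dist_0_eq_abs, abs_of_pos hh]) k
  rw [mem_ball_zero_iff] at h3
  exact h3.le

/-- The evolution equation holds for all derivatives of a smooth solution. -/
theorem diffOp_stream (hU : IsOpen U) (hη : 0 < η) {h : ℝ} (hh : 0 < h)
    {g : Slot d → SpaceTime d → ℝ} (hg : ∀ k, ContDiffOn ℝ ∞ (g k) U)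
    (hs : ∀ p ∈ U, (∀ k, stream η h k p ∈ U) → ∀ k, lbDefect P η h g k p = 0)
    (q : MvPolynomial (Option (Fin d)) ℝ) {p : SpaceTime d} (hp : p ∈ U)
    (hpU : ∀ k, stream η h k p ∈ U) (k : Slot d) :
    diffOp (g k) q (stream η h k p) = ∑ l, update P k l * diffOp (g l) q p := by
  -- the scheme holds on a neighbourhood of `p` and can be differentiated there
  set V : Set (SpaceTime d) := U ∩ ⋂ k, {p | stream η h k p ∈ U}
  have hV : IsOpen V := by
    refine hU.inter (isOpen_iInter_of_finite fun k => ?_)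
    refine hU.preimage ?_
    simp only [funext (stream_eq hη hh k)]
    fun_prop
  have hpV : p ∈ V := ⟨hp, Set.mem_iInter.2 hpU⟩
  have h1 : Set.EqOn (fun p => g k (p + (h • dir k, η * h ^ 2)))
      (fun p => ∑ l, update P k l * g l p) V := fun p hp => by
    have h2 := hs p hp.1 (fun k => Set.mem_iInter.1 hp.2 k) k
    rw [lbDefect_eq hη hh, sub_eq_zero, stream_eq hη hh] at h2
    exact h2
  have h3 := diffOp_congr hV h1 q hpV
  rw [diffOp_translate, diffOp_sum_smul hU _ _ hg q hp] at h3
  rw [stream_eq hη hh]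
  exact h3

/-- The scheme, differentiated and expanded in powers of the lattice spacing. -/
theorem scheme_jet (hU : IsOpen U) (hη : 0 < η) (hf : ∀ k, Reg U h₀ (fun h => f h k))
    (hs : SolvesScheme U P η f) (k : Slot d) (q : Symb d) :
    LocBigO U 6 (fun h p =>
      jet (fun h => f h k) (q * (shiftSymbol Polynomial.X (symT η) symX k - 1)) h p +
        ∑ l, collision d P 1 k l * (jet (fun h => f h l) q h p -
          weight P l * ∑ m, jet (fun h => f h m) q h p)) := by
  obtain ⟨h₁, h₁pos, H⟩ := hs
  refine (taylor_stream hU hη ((hf k).jet hU q) k).neg.congr fun K hK hKc => ?_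
  obtain ⟨h₂, h₂pos, H₂⟩ := exists_stream_mem hU hη hK hKc
  refine ⟨min h₀ (min h₁ h₂), lt_min (hf k).pos (lt_min h₁pos h₂pos), fun h hh hlt p hp => ?_⟩
  simp only [lt_min_iff] at hlt
  have h3 := diffOp_stream hU hη hh (fun k => (hf k).smooth h hh hlt.1) (H h hh hlt.2.1)
    (q.eval (MvPolynomial.C h)) (hK hp) (H₂ h hh hlt.2.2 p hp) k
  rw [sum_update_mul] at h3
  change jet (fun h => f h k) q h _ = jet (fun h => f h k) q h p - _ at h3
  rw [h3, ← jet_mul hU ((hf k).smooth h hh hlt.1) _ _ (hK hp), mul_sub, mul_one, jet_sub,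
    mul_comm q]
  change _ + ∑ l, collision d P 1 k l * (jet (fun h => f h l) q h p -
          weight P l * ∑ m, jet (fun h => f h m) q h p) = _
  change _ = -(_ - ∑ l, collision d P 1 k l * (jet (fun h => f h l) q h p -
          weight P l * ∑ m, jet (fun h => f h m) q h p) - _)
  ring

end Scheme

/-! ### Reduction to the conserved moment -/

section Reduction

variable {d : ℕ} {U : Set (SpaceTime d)} {h₀ η ε W : ℝ} {P : Params}

/-- The symbols expressing the distribution functions through the conserved moment. Five iterations
solve the moment equations up to sixth order. -/
def popSymbol (P : Params) (η : ℝ) : Slot d → Symb d :=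
  approx P Polynomial.X (symT η) symX 5

/-- The symbol of one time step of the `k`-th distribution function. -/
def incr (η : ℝ) (k : Slot d) : Symb d := shiftSymbol Polynomial.X (symT η) symX k - 1

/-- The symbol of `η (∂ₜ - υ ∇²)`, where `ε = υ η`. -/
def heatSymbol (η ε : ℝ) : Symb d := symT η - ε • ∑ j, symX j ^ 2

theorem exists_incr_eq (η : ℝ) (k : Slot d) : ∃ q : Symb d, incr η k = Polynomial.X * q :=
  dvd_shiftSymbol_sub_one _ _ _ k

theorem sum_popSymbol : ∑ k : Slot d, popSymbol P η k = 1 := sum_approx _ _ _ _ _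

/-- The conditions for `d > 1` only concern terms with two different coordinates. -/
theorem balance_smul_eq_zero (hd : 1 ≤ d) {a b : ℝ} (h : 1 < d → a = 0 ∧ b = 0) (i : Fin d) :
    a • ∑ j ∈ Finset.univ.erase i, (symX j : Symb d) ^ 2 = 0 ∧
      b • ∑ j ∈ Finset.univ.erase i, (symX j : Symb d) ^ 2 = 0 := by
  rcases hd.eq_or_lt with rfl | h1
  · have : (Finset.univ : Finset (Fin 1)).erase i = ∅ := by
      rw [Subsingleton.elim i 0]; rfl
    rw [this, Finset.sum_empty, smul_zero, smul_zero]
    exact ⟨rfl, rfl⟩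
  · obtain ⟨rfl, rfl⟩ := h h1
    simp

/-- The evolution of the conserved moment in terms of the symbol of the diffusion equation. -/
theorem popSymbol_mass (hd : 1 ≤ d) (hP : P.Admissible) (hC : Conditions d ε P) :
    ∃ Q : Symb d, Polynomial.X ^ 6 ∣ ∑ k, incr η k * popSymbol P η k -
      Polynomial.X ^ 2 * ((1 + Polynomial.X ^ 2 * Q) * heatSymbol η ε) := by
  obtain ⟨h1, hA, hA2, hB⟩ := balance_of_conditions hd hP hC rfl
  unfold incr popSymbol heatSymbol
  have h2 := isExpansion_approx hP (R := Symb d) Polynomial.X (symT η) symX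
  exact h2.mass_balanced hP.2.1.1.ne' hP.2.2.1.1.ne' hP.2.2.2.1.ne' h1
    hA (fun i => (balance_smul_eq_zero hd hB i).1) hA2 (fun i => (balance_smul_eq_zero hd hB i).2)

/-- The first moments in terms of the gradient and of the symbol of the diffusion equation. -/
theorem popSymbol_flux (hd : 1 ≤ d) (hP : P.Admissible) (hC : Conditions d ε P)
    (hW : W = P.w1 + 2 * ((d : ℝ) - 1) * P.w2) (i : Fin d) :
    ∃ Q : Symb d, Polynomial.X ^ 5 ∣ ∑ k, dir k i • popSymbol P η k +
      (2 * W / P.s1) • (Polynomial.X * symX i) + Polynomial.X ^ 3 * (Q * heatSymbol η ε) := by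
  subst hW
  obtain ⟨h1, hA, hA2, hB⟩ := balance_of_conditions hd hP hC rfl
  have h2 := (isExpansion_approx hP Polynomial.X (symT η) (symX (d := d))).one_balanced
    hP.2.1.1.ne' hP.2.2.1.1.ne' hP.2.2.2.1.ne' i hA (balance_smul_eq_zero hd hB i).1
  refine ⟨((2 * (P.w1 + 2 * ((d : ℝ) - 1) * P.w2) - 2 * (P.w1 + 2 * ((d : ℝ) - 1) * P.w2) / P.s1 -
    2 * (P.w1 + 2 * ((d : ℝ) - 1) * P.w2) / P.s21) / P.s1) • symX i, ?_⟩
  simp only [moment, mono1] at h2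
  rw [mul_smul_comm] at h2
  rw [smul_mul_assoc]
  unfold popSymbol heatSymbol
  convert h2 using 3

theorem popSymbol_moment {r : Slot d} (hr : r ≠ .inl ()) (hs : relax P r ≠ 0) :
    Polynomial.X ^ 6 ∣ ∑ k, row r k • (incr η k * popSymbol P η k) +
      relax P r • (∑ k, row r k • popSymbol P η k -
        algebraMap ℝ (Symb d) (∑ k, row r k * weight P k)) := by
  unfold incr popSymbol
  have h1 := approx_moment P (R := Symb d) Polynomial.X (symT η) symX 5 hr hs
  simp only [moment] at h1
  exact h1

theorem relax_ne_zero (hP : P.Admissible) (r : Slot d) : relax P r ≠ 0 := by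
  obtain ⟨h0, h1, h21, h22⟩ := hP
  rcases r with _ | ⟨i, _ | _⟩ | ⟨q, _ | _, _ | _⟩ <;>
    first | exact h0.1.ne' | exact h1.1.ne' | exact h21.1.ne' | exact h22.1.ne' | exact one_ne_zero

variable {f : ℝ → Slot d → SpaceTime d → ℝ}

theorem reg_density (hU : IsOpen U) (hh₀ : 0 < h₀) (hf : ∀ k, Reg U h₀ (fun h => f h k)) :
    Reg U h₀ (fun h => density (f h)) := by
  have := Reg.sum hU hh₀ hf 1
  simp only [Pi.one_apply, one_mul] at this
  exact this

theorem jet_density (hU : IsOpen U) {h : ℝ} (hf : ∀ k, ContDiffOn ℝ ∞ (f h k) U) (q : Symb d)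
    {p : SpaceTime d} (hp : p ∈ U) :
    jet (fun h => density (f h)) q h p = ∑ k, jet (fun h => f h k) q h p := by
  have := jet_sum_mul (f := fun k h => f h k) hU hf 1 q hp
  simp only [Pi.one_apply, one_mul] at this
  exact this

/-- The moments of the differentiated and expanded scheme. -/
theorem scheme_jet_moment (hU : IsOpen U) (hη : 0 < η) (hh₀ : 0 < h₀)
    (hf : ∀ k, Reg U h₀ (fun h => f h k))
    (hs : SolvesScheme U P η f) (r : Slot d) (q : Symb d) :
    LocBigO U 6 (fun h p => ∑ k, row r k * jet (fun h => f h k) (q * incr η k) h p +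
      relax P r * ∑ k, row r k * (jet (fun h => f h k) q h p -
        weight P k * jet (fun h => density (f h)) q h p)) := by
  refine (LocBigO.sum Finset.univ fun k _ =>
    (scheme_jet hU hη hf hs k q).const_mul (row r k)).congr_of_lt hh₀ fun h hh hlt p hp => ?_
  have h1 := moment_collision P r (fun k => jet (fun h => f h k) q h p -
        weight P k * jet (fun h => density (f h)) q h p)
  simp only [moment, smul_eq_mul] at h1
  rw [← h1, ← Finset.sum_add_distrib]
  refine Finset.sum_congr rfl fun k _ => ?_
  rw [jet_density hU (fun k => (hf k).smooth h hh hlt) q hp, mul_add]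
  rfl

/-- The distribution functions of a solution of the scheme are slaved to the conserved moment. -/
theorem jet_eq_popSymbol (hU : IsOpen U) (hη : 0 < η) (hP : P.Admissible) (hh₀ : 0 < h₀)
    (hf : ∀ k, Reg U h₀ (fun h => f h k)) (hs : SolvesScheme U P η f) (k : Slot d) (q : Symb d) :
    LocBigO U 6 (fun h p => jet (fun h => f h k) q h p -
      jet (fun h => density (f h)) (q * popSymbol P η k) h p) := by
  have hθ := reg_density hU hh₀ hf
  set θ : ℝ → SpaceTime d → ℝ := fun h => density (f h) with hθdef
  have key : ∀ n ≤ 6, ∀ k q, LocBigO U n (fun h p => jet (fun h => f h k) q h p -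
      jet θ (q * popSymbol P η k) h p) := by
    intro n
    induction n with
    | zero => exact fun _ k q => ((hf k).locBigO q).sub (hθ.locBigO _)
    | succ n ih =>
      intro hn k q
      have hm : ∀ r, LocBigO U (n + 1) (fun h p => ∑ k, row r k * (jet (fun h => f h k) q h p -
          jet θ (q * popSymbol P η k) h p)) := by
        intro r
        by_cases hr : r = .inl ()
        · refine LocBigO.zero.congr_of_lt hh₀ fun h hh hlt p hp => ?_
          subst hr
          simp only [row, monomial, one_mul, Finset.sum_sub_distrib]
          rw [← jet_density hU (fun k => (hf k).smooth h hh hlt) q hp, ← jet_sum, ← Finset.mul_sum,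
            sum_popSymbol, mul_one, sub_self]
        · have hr0 := relax_ne_zero hP r
          -- the streaming contributions gain one order
          have h1 : ∀ k, LocBigO U (n + 1) (fun h p => jet (fun h => f h k) (q * incr η k) h p -
              jet θ (q * incr η k * popSymbol P η k) h p) := by
            intro k
            obtain ⟨q', hq'⟩ := exists_incr_eq η k
            have h2 := (ih (by omega) k (q * q')).pow_mul 1
            rw [add_comm 1 n] at h2
            refine h2.congr_of_lt hh₀ fun h _ _ p _ => ?_
            have h3 : q * incr η k = Polynomial.X ^ 1 * (q * q') := by rw [hq']; ring
            rw [h3, mul_assoc (Polynomial.X ^ 1), jet_X_pow_mul, jet_X_pow_mul]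
            ring
          have h4 := hθ.locBigO_of_dvd ((popSymbol_moment (η := η) hr hr0).mul_left q)
          have h5 := (scheme_jet_moment hU hη hh₀ hf hs r q).sub h4
          refine (((h5.mono hn).sub (LocBigO.sum Finset.univ fun k _ =>
            (h1 k).const_mul (row r k))).const_mul (relax P r)⁻¹).congr_of_lt hh₀
            fun h hh hlt p hp => ?_
          rw [eq_inv_mul_iff_mul_eq₀ hr0]
          simp only [mul_add, mul_sub, mul_smul_comm, Finset.mul_sum, jet_add, jet_sum, jet_smul,
            jet_sub, Finset.sum_sub_distrib, Algebra.algebraMap_eq_smul_one, mul_one,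
            Finset.sum_mul, mul_assoc]
          ring
      have h6 := LocBigO.sum Finset.univ fun r _ => (hm r).const_mul ((momentMatrix d 1)⁻¹ k r)
      refine h6.congr_of_lt hh₀ fun h hh hlt p hp => ?_
      have h7 := congrFun (ofMoments_moment (fun k => jet (fun h => f h k) q h p -
          jet θ (q * popSymbol P η k) h p)) k
      simp only [ofMoments, moment, smul_eq_mul] at h7
      exact h7.symm
  exact key 6 le_rfl k q

/-- The conserved moment of a solution of the scheme solves the diffusion equation up to fourth
order, together with its derivatives. -/
theorem jet_heatSymbol (hd : 1 ≤ d) (hU : IsOpen U) (hη : 0 < η) (hP : P.Admissible)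
    (hC : Conditions d ε P) (hh₀ : 0 < h₀)
    (hf : ∀ k, Reg U h₀ (fun h => f h k)) (hs : SolvesScheme U P η f) (q : Symb d) :
    LocBigO U 4 (jet (fun h => density (f h)) (q * heatSymbol η ε)) := by
  have hθ := reg_density hU hh₀ hf
  obtain ⟨Q, hQ⟩ := popSymbol_mass (η := η) hd hP hC
  have h1 (q : Symb d) : LocBigO U 6
      (fun h p => ∑ k, jet (fun h => f h k) (q * incr η k) h p) := by
    refine (scheme_jet_moment hU hη hh₀ hf hs (.inl ()) q).congr_of_lt hh₀ fun h hh hlt p hp => ?_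
    simp only [row, monomial, one_mul, Finset.sum_sub_distrib, ← Finset.sum_mul, equilibrium_zero,
      jet_density hU (fun k => (hf k).smooth h hh hlt) q hp, sub_self, mul_zero, add_zero]
  have h2 (q : Symb d) : LocBigO U 4 (jet (fun h => density (f h))
      (q * ((1 + Polynomial.X ^ 2 * Q) * heatSymbol η ε))) := by
    refine LocBigO.of_pow_mul 2 ?_
    refine (((h1 q).sub (LocBigO.sum Finset.univ fun k _ =>
      jet_eq_popSymbol hU hη hP hh₀ hf hs k (q * incr η k))).sub
      (hθ.locBigO_of_dvd (hQ.mul_left q))).congr_of_lt hh₀ fun h _ _ p _ => ?_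
    rw [← jet_X_pow_mul, mul_sub, jet_sub, Finset.mul_sum, jet_sum, Finset.sum_sub_distrib,
      mul_left_comm q (Polynomial.X ^ 2)]
    simp only [mul_assoc]
    ring
  -- as `y = (1 + X² Q) y - X² Q y`, a bound of order `n` improves to order `n + 2`
  have h3 {n : ℕ} (hn : n ≤ 2) (ih : ∀ q, LocBigO U n (jet (fun h => density (f h))
      (q * heatSymbol η ε))) (q : Symb d) : LocBigO U (2 + n) (jet (fun h => density (f h))
      (q * heatSymbol η ε)) := by
    refine (((h2 q).mono (by omega)).sub ((ih (q * Q)).pow_mul 2)).congr_of_lt hh₀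
      fun h _ _ p _ => ?_
    rw [← jet_X_pow_mul, ← jet_sub]
    congr 1
    ring
  exact h3 le_rfl (h3 (by omega) fun q => hθ.locBigO _) q

theorem jet_flux_popSymbol (hd : 1 ≤ d) (hP : P.Admissible)
    (hC : Conditions d ε P) (hW : W = P.w1 + 2 * ((d : ℝ) - 1) * P.w2)
    {θ : ℝ → SpaceTime d → ℝ} (hθ : Reg U h₀ θ)
    (hheat : ∀ q, LocBigO U 4 (jet θ (q * heatSymbol η ε))) (i : Fin d) (q : Symb d) :
    LocBigO U 5 (fun h p => ∑ k, dir k i * jet θ (q * popSymbol P η k) h p +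
      2 * W / P.s1 * (h * jet θ (q * symX i) h p)) := by
  obtain ⟨Q, hQ⟩ := popSymbol_flux (η := η) hd hP hC hW i
  refine ((hθ.locBigO_of_dvd (hQ.mul_left q)).sub
    (((hheat (q * Q)).pow_mul 3).mono (by omega))).congr_of_lt hθ.pos fun h _ _ p _ => ?_
  rw [← jet_X_pow_mul, ← jet_sub]
  have h1 : q * (∑ k, dir k i • popSymbol P η k + (2 * W / P.s1) • (Polynomial.X * symX i) +
      Polynomial.X ^ 3 * (Q * heatSymbol η ε)) -
      Polynomial.X ^ 3 * (q * Q * heatSymbol η ε) =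
      ∑ k, dir k i • (q * popSymbol P η k) +
      (2 * W / P.s1) • (Polynomial.X ^ 1 * (q * symX i)) := by
    simp only [mul_add, Finset.mul_sum, mul_smul_comm]
    rw [pow_one, mul_left_comm Polynomial.X q]
    ring
  rw [h1, jet_add, jet_sum, jet_smul, jet_X_pow_mul, pow_one]
  simp only [jet_smul]

end Reduction

/-! ### Quotients by a solution of the diffusion equation -/

section Quotient

variable {d : ℕ} {U : Set (SpaceTime d)} {υ : ℝ} {θ : SpaceTime d → ℝ}

theorem pd_mul (hU : IsOpen U) {φ : SpaceTime d → ℝ} (hφ : ContDiffOn ℝ ∞ φ U)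
    (hθ : ContDiffOn ℝ ∞ θ U) (v : Option (Fin d)) :
    Set.EqOn (pd v (fun p => φ p * θ p)) (fun p => pd v φ p * θ p + φ p * pd v θ p) U :=
  fun p hp => by
  rw [pd, ((differentiableAt_of_contDiffOn hU hφ hp).hasFDerivAt.fun_mul
    (differentiableAt_of_contDiffOn hU hθ hp).hasFDerivAt).fderiv]
  simp only [pd, smul_apply, add_apply, smul_eq_mul]
  ring

/-- The product rule for `φ = (φ / θ) * θ`. -/
theorem pd_div_mul (hU : IsOpen U) {φ : SpaceTime d → ℝ} (hφ : ContDiffOn ℝ ∞ φ U)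
    (hθ : ContDiffOn ℝ ∞ θ U) (h0 : ∀ p ∈ U, θ p ≠ 0) (v : Option (Fin d)) :
    Set.EqOn (pd v φ) (fun p => pd v (fun p => φ p / θ p) p * θ p + φ p / θ p * pd v θ p) U := by
  have h1 : Set.EqOn φ (fun p => φ p / θ p * θ p) U := fun p hp =>
    (div_mul_cancel₀ _ (h0 p hp)).symm
  exact (pd_congr hU h1 v).trans (pd_mul hU (hφ.div hθ h0) hθ v)

theorem pd_div (hU : IsOpen U) {φ : SpaceTime d → ℝ} (hφ : ContDiffOn ℝ ∞ φ U)
    (hθ : ContDiffOn ℝ ∞ θ U) (v : Option (Fin d)) {p : SpaceTime d} (hp : p ∈ U) (h0 : θ p ≠ 0) :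
    pd v (fun p => φ p / θ p) p = (pd v φ p * θ p - φ p * pd v θ p) / θ p ^ 2 := by
  have hV := hθ.continuousOn.isOpen_inter_preimage hU (isOpen_ne (x := (0 : ℝ)))
  have h1 := pd_div_mul hV (hφ.mono Set.inter_subset_left) (hθ.mono Set.inter_subset_left)
    (fun _ hx => hx.2) v ⟨hp, h0⟩
  simp only at h1
  rw [h1]
  field_simp
  ring

theorem pd_pd_div (hU : IsOpen U) {φ : SpaceTime d → ℝ} (hφ : ContDiffOn ℝ ∞ φ U)
    (hθ : ContDiffOn ℝ ∞ θ U) (v : Option (Fin d)) {p : SpaceTime d} (hp : p ∈ U) (h0 : θ p ≠ 0) :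
    pd v (pd v (fun p => φ p / θ p)) p = pd v (pd v φ) p / θ p
      - 2 * (pd v φ p * pd v θ p) / θ p ^ 2 - φ p * pd v (pd v θ) p / θ p ^ 2
      + 2 * (φ p * pd v θ p ^ 2) / θ p ^ 3 := by
  have hV := hθ.continuousOn.isOpen_inter_preimage hU (isOpen_ne (x := (0 : ℝ)))
  have hpV : p ∈ U ∩ θ ⁻¹' {y | y ≠ 0} := ⟨hp, h0⟩
  have hφ' := hφ.mono (Set.inter_subset_left (t := θ ⁻¹' {y | y ≠ 0}))
  have hθ' := hθ.mono (Set.inter_subset_left (t := θ ⁻¹' {y | y ≠ 0}))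
  have hu : ContDiffOn ℝ ∞ (fun p => φ p / θ p) (U ∩ θ ⁻¹' {y | y ≠ 0}) :=
    hφ'.div hθ' (fun _ hx => hx.2)
  -- differentiate `φ = (φ / θ) * θ` twice
  have h1 := pd_congr hV (pd_div_mul hV hφ' hθ' (fun _ hx => hx.2) v) v hpV
  have h2 : pd v (fun p => pd v (fun p => φ p / θ p) p * θ p + φ p / θ p * pd v θ p) p =
      pd v (fun p => pd v (fun p => φ p / θ p) p * θ p) p +
        pd v (fun p => φ p / θ p * pd v θ p) p :=
    pd_add hV ((contDiffOn_pd hV hu v).mul hθ') (hu.mul (contDiffOn_pd hV hθ' v)) v hpV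
  rw [h2, pd_mul hV (contDiffOn_pd hV hu v) hθ' v hpV,
    pd_mul hV hu (contDiffOn_pd hV hθ' v) v hpV] at h1
  simp only [pd_div hU hφ hθ v hp h0] at h1
  rw [h1]
  field_simp
  ring

/-- The error in Burgers' equation of a quotient: it vanishes if `φ` and `θ` solve the diffusion
equation and `φ / θ` is the Cole-Hopf velocity of `θ`. -/
theorem burgersDefect_div (hU : IsOpen U) {φ : Fin d → SpaceTime d → ℝ}
    (hφ : ∀ i, ContDiffOn ℝ ∞ (φ i) U) (hθ : ContDiffOn ℝ ∞ θ U) (i : Fin d)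
    {p : SpaceTime d} (hp : p ∈ U) (h0 : θ p ≠ 0) :
    burgersDefect υ (fun i p => φ i p / θ p) i p =
      diffusionDefect υ (φ i) p * (θ p)⁻¹ -
        φ i p * diffusionDefect υ θ p * ((θ p)⁻¹ * (θ p)⁻¹) +
        ∑ j, (φ j p + 2 * υ * dx j θ p) * (dx j (φ i) p * θ p - φ i p * dx j θ p) *
          ((θ p)⁻¹ * ((θ p)⁻¹ * (θ p)⁻¹)) := by
  have h1 : dt (fun p => φ i p / θ p) p = (dt (φ i) p * θ p - φ i p * dt θ p) / θ p ^ 2 :=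
    pd_div hU (hφ i) hθ none hp h0
  have h2 (j : Fin d) : dx j (fun p => φ i p / θ p) p =
      (dx j (φ i) p * θ p - φ i p * dx j θ p) / θ p ^ 2 := pd_div hU (hφ i) hθ (some j) hp h0
  have h3 (j : Fin d) : dx j (dx j (fun p => φ i p / θ p)) p = dx j (dx j (φ i)) p / θ p
      - 2 * (dx j (φ i) p * dx j θ p) / θ p ^ 2 - φ i p * dx j (dx j θ) p / θ p ^ 2
      + 2 * (φ i p * dx j θ p ^ 2) / θ p ^ 3 := pd_pd_div hU (hφ i) hθ (some j) hp h0
  simp only [burgersDefect, diffusionDefect, lap, h1, h2, h3]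
  have h4 : ∀ x y z : Fin d → ℝ, ∑ j, x j - υ * ∑ j, y j - ∑ j, z j = ∑ j, (x j - υ * y j - z j) :=
    fun x y z => by rw [Finset.mul_sum, ← Finset.sum_sub_distrib, ← Finset.sum_sub_distrib]
  have h5 : ∀ x y : Fin d → ℝ, -υ * (∑ j, x j) * (θ p)⁻¹ +
      φ i p * υ * (∑ j, y j) * ((θ p)⁻¹ * (θ p)⁻¹) =
      ∑ j, (-υ * x j * (θ p)⁻¹ + φ i p * υ * y j * ((θ p)⁻¹ * (θ p)⁻¹)) := fun x y => by
    simp only [Finset.mul_sum, Finset.sum_mul, Finset.sum_add_distrib]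
  have h6 := h4 (fun j => φ j p / θ p * ((dx j (φ i) p * θ p - φ i p * dx j θ p) / θ p ^ 2))
    (fun j => dx j (dx j (φ i)) p / θ p
      - 2 * (dx j (φ i) p * dx j θ p) / θ p ^ 2 - φ i p * dx j (dx j θ) p / θ p ^ 2
      + 2 * (φ i p * dx j θ p ^ 2) / θ p ^ 3)
    (fun j => (φ j p + 2 * υ * dx j θ p) * (dx j (φ i) p * θ p - φ i p * dx j θ p) *
          ((θ p)⁻¹ * ((θ p)⁻¹ * (θ p)⁻¹)))
  have h7 := h5 (fun j => dx j (dx j (φ i)) p) (fun j => dx j (dx j θ) p)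
  have h8 : ∑ j, (φ j p / θ p * ((dx j (φ i) p * θ p - φ i p * dx j θ p) / θ p ^ 2) - υ *
      (dx j (dx j (φ i)) p / θ p
      - 2 * (dx j (φ i) p * dx j θ p) / θ p ^ 2 - φ i p * dx j (dx j θ) p / θ p ^ 2
      + 2 * (φ i p * dx j θ p ^ 2) / θ p ^ 3) -
      (φ j p + 2 * υ * dx j θ p) * (dx j (φ i) p * θ p - φ i p * dx j θ p) *
          ((θ p)⁻¹ * ((θ p)⁻¹ * (θ p)⁻¹))) =
      ∑ j, (-υ * dx j (dx j (φ i)) p * (θ p)⁻¹ +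
        φ i p * υ * dx j (dx j θ) p * ((θ p)⁻¹ * (θ p)⁻¹)) := by
    refine Finset.sum_congr rfl fun j _ => ?_
    field_simp
    ring
  have h9 : (dt (φ i) p * θ p - φ i p * dt θ p) / θ p ^ 2 =
      dt (φ i) p * (θ p)⁻¹ - φ i p * dt θ p * ((θ p)⁻¹ * (θ p)⁻¹) := by
    field_simp
  linear_combination h6 + h8 - h7 + h9

/-- The asymmetry of the gradient of a quotient: it vanishes if `φ / θ` is the Cole-Hopf velocity
of `θ`. -/
theorem symmetryDefect_div (hU : IsOpen U) {φ : Fin d → SpaceTime d → ℝ}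
    (hφ : ∀ i, ContDiffOn ℝ ∞ (φ i) U) (hθ : ContDiffOn ℝ ∞ θ U) (i j : Fin d)
    {p : SpaceTime d} (hp : p ∈ U) (h0 : θ p ≠ 0) :
    symmetryDefect (fun i p => φ i p / θ p) i j p =
      (dx j (φ i) p - dx i (φ j) p) * (θ p)⁻¹ -
        ((φ i p + 2 * υ * dx i θ p) * dx j θ p - (φ j p + 2 * υ * dx j θ p) * dx i θ p) *
          ((θ p)⁻¹ * (θ p)⁻¹) := by
  have h2 (i j : Fin d) : dx j (fun p => φ i p / θ p) p =
      (dx j (φ i) p * θ p - φ i p * dx j θ p) / θ p ^ 2 := pd_div hU (hφ i) hθ (some j) hp h0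
  rw [symmetryDefect, h2, h2]
  field_simp
  ring

/-- The symbol of `∂ₜ - υ ∇²`. -/
def diffusionSymbol (d : ℕ) (υ : ℝ) : MvPolynomial (Option (Fin d)) ℝ :=
  MvPolynomial.X none - υ • ∑ j, MvPolynomial.X (some j) ^ 2

theorem diffusionDefect_eq (hU : IsOpen U) (hθ : ContDiffOn ℝ ∞ θ U) {p : SpaceTime d}
    (hp : p ∈ U) : diffusionDefect υ θ p = diffOp θ (diffusionSymbol d υ) p := by
  have h1 (j : Fin d) : diffOp θ (MvPolynomial.X (some j) ^ 2) p = dx j (dx j θ) p := by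
    rw [sq, diffOp_X_mul hU hθ _ _ hp, diffOp_X]
    rfl
  rw [diffusionSymbol, map_sub, map_smul, map_sum, Pi.sub_apply, Pi.smul_apply, Finset.sum_apply,
    smul_eq_mul, Finset.sum_congr rfl fun j _ => h1 j, diffOp_X]
  rfl

theorem diffOp_X_mul_some (hU : IsOpen U) (hθ : ContDiffOn ℝ ∞ θ U) (i : Fin d)
    (q : MvPolynomial (Option (Fin d)) ℝ) {p : SpaceTime d} (hp : p ∈ U) :
    diffOp (dx i θ) q p = diffOp θ (q * MvPolynomial.X (some i)) p := by
  rw [diffOp_mul hU hθ _ _ hp, diffOp_X]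
  rfl

theorem coleHopf_eq (υ : ℝ) (θ : SpaceTime d → ℝ) :
    coleHopf υ θ = fun i p => (-2 * υ) • dx i θ p / θ p := by
  funext i p
  rw [coleHopf, smul_eq_mul, mul_div_assoc]

theorem contDiffOn_dx (hU : IsOpen U) (hθ : ContDiffOn ℝ ∞ θ U) (i : Fin d) :
    ContDiffOn ℝ ∞ (dx i θ) U := contDiffOn_pd hU hθ (some i)

theorem burgersDefect_coleHopf (hU : IsOpen U) (hθ : ContDiffOn ℝ ∞ θ U) (h0 : ∀ p ∈ U, θ p ≠ 0)
    (hd : ∀ p ∈ U, diffusionDefect υ θ p = 0) (i : Fin d) {p : SpaceTime d} (hp : p ∈ U) :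
    burgersDefect υ (coleHopf υ θ) i p = 0 := by
  have h1 : diffusionDefect υ (fun p => (-2 * υ) • dx i θ p) p = 0 := by
    rw [diffusionDefect_eq hU ((contDiffOn_dx hU hθ i).const_smul _) hp]
    have h2 : Set.EqOn (diffOp θ (diffusionSymbol d υ)) 0 U := fun x hx => by
      rw [← diffusionDefect_eq hU hθ hx, hd x hx]; rfl
    have h3 := diffOp_smul (-2 * υ) (dx i θ) (diffusionSymbol d υ)
    have h4 := pd_congr hU h2 (some i) hp
    rw [← diffOp_X_mul hU hθ _ _ hp] at h4
    have h5 : pd (some i) (0 : SpaceTime d → ℝ) p = 0 := by simp [pd]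
    change diffOp ((-2 * υ) • dx i θ) (diffusionSymbol d υ) p = 0
    rw [h3, Pi.smul_apply, diffOp_X_mul_some hU hθ _ _ hp, mul_comm (diffusionSymbol d υ), h4, h5, smul_zero]
  rw [coleHopf_eq, burgersDefect_div hU (fun i => (contDiffOn_dx hU hθ i).const_smul _) hθ i hp
    (h0 p hp), h1, hd p hp]
  simp

theorem symmetryDefect_coleHopf (hU : IsOpen U) (hθ : ContDiffOn ℝ ∞ θ U) (h0 : ∀ p ∈ U, θ p ≠ 0)
    (i j : Fin d) {p : SpaceTime d} (hp : p ∈ U) :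
    symmetryDefect (coleHopf υ θ) i j p = 0 := by
  have h1 (i j : Fin d) : dx j (fun p => (-2 * υ) • dx i θ p) p = (-2 * υ) * dx j (dx i θ) p :=
    congrFun (pd_smul (-2 * υ) (dx i θ) (some j)) p
  have h2 : dx j (dx i θ) p = dx i (dx j θ) p := pd_pd_comm hU hθ (some j) (some i) hp
  rw [coleHopf_eq, symmetryDefect_div (υ := υ) hU
    (fun i => (contDiffOn_dx hU hθ i).const_smul _) hθ i j hp (h0 p hp), h1, h1, h2]
  simp

end Quotient

/-! ### The velocity and gradient formulas -/

section Accuracy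

variable {d : ℕ} {U : Set (SpaceTime d)} {h₀ υ η W : ℝ} {P : Params}

theorem eval_heatSymbol (h : ℝ) :
    (heatSymbol η (υ * η) : Symb d).eval (MvPolynomial.C h) = η • diffusionSymbol d υ := by
  have h1 : (∑ j, (symX j : Symb d) ^ 2).eval (MvPolynomial.C h) =
      ∑ j, MvPolynomial.X (some j) ^ 2 := by
    rw [Polynomial.eval_finsetSum]
    refine Finset.sum_congr rfl fun j _ => ?_
    rw [symX, Polynomial.eval_pow, Polynomial.eval_C]
  rw [heatSymbol, symT, diffusionSymbol, Polynomial.eval_sub, Polynomial.eval_smul,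
    Polynomial.eval_smul, Polynomial.eval_C, h1, smul_sub, smul_smul, mul_comm υ]

theorem jet_heatSymbol_eq (hU : IsOpen U) {θ : ℝ → SpaceTime d → ℝ} {h : ℝ}
    (hθ : ContDiffOn ℝ ∞ (θ h) U) {p : SpaceTime d} (hp : p ∈ U) :
    jet θ (heatSymbol η (υ * η)) h p = η * diffusionDefect υ (θ h) p := by
  rw [jet, eval_heatSymbol, map_smul, Pi.smul_apply, smul_eq_mul, diffusionDefect_eq hU hθ hp]

theorem jet_symX (θ : ℝ → SpaceTime d → ℝ) (i : Fin d) (h : ℝ) :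
    jet θ (symX i) h = dx i (θ h) := by
  rw [jet, symX, Polynomial.eval_C, diffOp_X]
  rfl

theorem locBigO_diffusionDefect (hU : IsOpen U) (hη : 0 < η) {θ : ℝ → SpaceTime d → ℝ}
    (hh₀ : 0 < h₀) (hθ : ∀ h, 0 < h → h < h₀ → ContDiffOn ℝ ∞ (θ h) U) {n : ℕ}
    (h : LocBigO U n (jet θ (heatSymbol η (υ * η)))) :
    LocBigO U n (fun h => diffusionDefect υ (θ h)) := by
  refine (h.const_mul η⁻¹).congr_of_lt hh₀ fun h hh hlt p hp => ?_
  rw [jet_heatSymbol_eq hU (hθ h hh hlt) hp, inv_mul_cancel_left₀ hη.ne']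

/-- If the numerators agree with `-2 υ ∇ θ` up to fourth order, together with all derivatives, and
`θ` solves the diffusion equation up to fourth order, then the quotients solve Burgers' equations
up to fourth order. -/
theorem locBigO_burgers (hU : IsOpen U) (hη : 0 < η) {θ : ℝ → SpaceTime d → ℝ}
    {φ : Fin d → ℝ → SpaceTime d → ℝ} (hθ : Reg U h₀ θ)
    (hφ : ∀ i h, 0 < h → h < h₀ → ContDiffOn ℝ ∞ (φ i h) U)
    (hheat : ∀ q, LocBigO U 4 (jet θ (q * heatSymbol η (υ * η))))
    (hr : ∀ i q, LocBigO U 4 (fun h p => jet (φ i) q h p + 2 * υ * jet θ (q * symX i) h p))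
    (h0 : ∀ K : Set (SpaceTime d), K ⊆ U → IsCompact K →
      ∃ δ h₀ : ℝ, 0 < δ ∧ 0 < h₀ ∧ ∀ h, 0 < h → h < h₀ → ∀ p ∈ K, δ ≤ |θ h p|) :
    (∀ i, LocBigO U 4 (fun h p => φ i h p / θ h p - coleHopf υ (θ h) i p)) ∧
    (∀ i, LocBigO U 4 (fun h => burgersDefect υ (fun i p => φ i h p / θ h p) i)) ∧
    (∀ i j, LocBigO U 4 (fun h => symmetryDefect (fun i p => φ i h p / θ h p) i j)) := by
  have hinv : LocBigO U 0 (fun h p => (θ h p)⁻¹) := by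
    intro K hK hKc
    obtain ⟨δ, h₁, hδ, hh₁, H⟩ := h0 K hK hKc
    refine ⟨δ⁻¹, h₁, hh₁, fun h hh hlt p hp => ?_⟩
    rw [abs_inv, pow_zero, mul_one]
    exact inv_anti₀ hδ (H h hh hlt p hp)
  have hne : ∀ K : Set (SpaceTime d), K ⊆ U → IsCompact K →
      ∃ h₁ : ℝ, 0 < h₁ ∧ ∀ h, 0 < h → h < h₁ → h < h₀ ∧ ∀ p ∈ K, θ h p ≠ 0 := by
    intro K hK hKc
    obtain ⟨δ, h₁, hδ, hh₁, H⟩ := h0 K hK hKc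
    refine ⟨min h₀ h₁, lt_min hθ.pos hh₁, fun h hh hlt => ?_⟩
    rw [lt_min_iff] at hlt
    exact ⟨hlt.1, fun p hp => abs_pos.1 (hδ.trans_le (H h hh hlt.2 p hp))⟩
  have hφb (i : Fin d) (q : Symb d) : LocBigO U 0 (jet (φ i) q) := by
    refine (((hr i q).mono (Nat.zero_le 4)).sub
      ((hθ.locBigO (q * symX i)).const_mul (2 * υ))).congr_of_lt hθ.pos fun h _ _ p _ => ?_
    ring
  have hφ0 (i : Fin d) : LocBigO U 0 (φ i) :=
    (hφb i 1).congr_of_lt hθ.pos fun h _ _ p _ => by rw [jet_one]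
  have hdφ (i j : Fin d) : LocBigO U 0 (fun h => dx j (φ i h)) :=
    (hφb i (symX j)).congr_of_lt hθ.pos fun h _ _ p _ => by rw [jet_symX]
  have hθ0 : LocBigO U 0 θ :=
    (hθ.locBigO 1).congr_of_lt hθ.pos fun h _ _ p _ => by rw [jet_one]
  have hdθ (j : Fin d) : LocBigO U 0 (fun h => dx j (θ h)) :=
    (hθ.locBigO (symX j)).congr_of_lt hθ.pos fun h _ _ p _ => by rw [jet_symX]
  have hr0 (i : Fin d) : LocBigO U 4 (fun h p => φ i h p + 2 * υ * dx i (θ h) p) :=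
    (hr i 1).congr_of_lt hθ.pos fun h _ _ p _ => by rw [jet_one, one_mul, jet_symX]
  have hρ : LocBigO U 4 (fun h => diffusionDefect υ (θ h)) :=
    locBigO_diffusionDefect hU hη hθ.pos hθ.smooth
      ((hheat 1).congr_of_lt hθ.pos fun h _ _ p _ => by rw [one_mul])
  have hρφ (i : Fin d) : LocBigO U 4 (fun h => diffusionDefect υ (φ i h)) := by
    refine locBigO_diffusionDefect hU hη hθ.pos (hφ i) ?_
    refine ((hr i (heatSymbol η (υ * η))).sub ((hheat (symX i)).const_mul (2 * υ))).congr_of_lt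
      hθ.pos fun h _ _ p _ => ?_
    rw [mul_comm (symX i)]
    ring
  refine ⟨fun i => ?_, fun i => ?_, fun i j => ?_⟩
  · refine ((hr0 i).mul hinv).congr_of_lt hθ.pos fun h _ _ p _ => ?_
    rw [coleHopf]
    ring
  · refine ((((hρφ i).mul hinv).sub (((hφ0 i).mul hρ).mul (hinv.mul hinv))).add
      (LocBigO.sum Finset.univ fun j _ => ((hr0 j).mul
        (((hdφ i j).mul hθ0).sub ((hφ0 i).mul (hdθ j)))).mul
          (hinv.mul (hinv.mul hinv)))).congr fun K hK hKc => ?_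
    obtain ⟨h₁, hh₁, H⟩ := hne K hK hKc
    exact ⟨h₁, hh₁, fun h hh hlt p hp => burgersDefect_div hU
      (fun i => hφ i h hh (H h hh hlt).1) (hθ.smooth h hh (H h hh hlt).1) i (hK hp)
      ((H h hh hlt).2 p hp)⟩
  · have hsym : LocBigO U 4 (fun h p => dx j (φ i h) p - dx i (φ j h) p) := by
      refine ((hr i (symX j)).sub (hr j (symX i))).congr_of_lt hθ.pos fun h _ _ p _ => ?_
      rw [jet_symX, jet_symX, mul_comm (symX j)]
      ring
    refine ((hsym.mul hinv).sub ((((hr0 i).mul (hdθ j)).sub ((hr0 j).mul (hdθ i))).mul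
      (hinv.mul hinv))).congr fun K hK hKc => ?_
    obtain ⟨h₁, hh₁, H⟩ := hne K hK hKc
    exact ⟨h₁, hh₁, fun h hh hlt p hp => symmetryDefect_div hU
      (fun i => hφ i h hh (H h hh hlt).1) (hθ.smooth h hh (H h hh hlt).1) i j (hK hp)
      ((H h hh hlt).2 p hp)⟩

theorem flux_eq (η h : ℝ) (g : Slot d → SpaceTime d → ℝ) (i : Fin d) (p : SpaceTime d) :
    flux P η h g i p = latticeSpeed η h * ∑ k, dir k i * g k p := by
  have h1 := equilibrium_one P i
  rw [← mono1_eq] at h1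
  have h2 : ∑ k, dir k i * (weight P k * density g p) = 0 := by
    simp only [← mul_assoc, ← Finset.sum_mul]
    rw [show ∑ k, dir k i * weight P k = 0 from h1, zero_mul]
  simp only [flux, nonEq, vel, Pi.smul_apply, smul_eq_mul, mul_assoc, ← Finset.mul_sum, mul_sub,
    Finset.sum_sub_distrib]
  rw [h2, mul_zero, sub_zero]

theorem lbGradient_eq {h : ℝ} (hη : 0 < η) (hh : 0 < h)
    (hW : W = P.w1 + 2 * ((d : ℝ) - 1) * P.w2) (hW0 : W ≠ 0)
    (g : Slot d → SpaceTime d → ℝ) (i : Fin d) (p : SpaceTime d) :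
    h ^ 1 * lbGradient P η h g i p = -(P.s1 / (2 * W)) * ∑ k, dir k i * g k p := by
  have h1 : soundSq d P η h = 2 * W * latticeSpeed η h ^ 2 := by
    rw [soundSq, hW]; ring
  rw [lbGradient, flux_eq, h1, latticeSpeed, timeStep]
  field_simp

variable {f : ℝ → Slot d → SpaceTime d → ℝ}

theorem jet_lbVelocity_numerator (hU : IsOpen U) (hη : 0 < η)
    (hf : ∀ k, Reg U h₀ (fun h => f h k)) (i : Fin d) (q : Symb d) {h : ℝ} (hh : 0 < h)
    (hlt : h < h₀) {p : SpaceTime d} (hp : p ∈ U) :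
    h ^ 1 * jet (fun h p => (2 - P.s1) * flux P η h (f h) i p) q h p =
      (2 - P.s1) / η * ∑ k, dir k i * jet (fun h => f h k) q h p := by
  have h1 : (fun p => (2 - P.s1) * flux P η h (f h) i p) =
      fun p => ∑ k, ((2 - P.s1) * latticeSpeed η h * dir k i) * f h k p := by
    funext p
    rw [flux_eq]
    simp only [Finset.mul_sum, mul_assoc]
  rw [jet, h1, diffOp_sum_smul hU _ _ (fun k => (hf k).smooth h hh hlt) _ hp, Finset.mul_sum,
    Finset.mul_sum]
  refine Finset.sum_congr rfl fun k _ => ?_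
  rw [latticeSpeed, timeStep, jet]
  field_simp

end Accuracy

section Formulas

variable {d : ℕ} {U : Set (SpaceTime d)} {h₀ υ η : ℝ} {P : Params}
  {f : ℝ → Slot d → SpaceTime d → ℝ}

/-- The first moments of distribution functions that are slaved to a solution of the diffusion
equation. -/
theorem jet_flux (hd : 1 ≤ d) (hU : IsOpen U) (hP : P.Admissible) (hC : Conditions d (υ * η) P)
    (hh₀ : 0 < h₀) (hf : ∀ k, Reg U h₀ (fun h => f h k))
    (hslave : ∀ k q, LocBigO U 6 (fun h p => jet (fun h => f h k) q h p -
      jet (fun h => density (f h)) (q * popSymbol P η k) h p))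
    (hheat : ∀ q, LocBigO U 4 (jet (fun h => density (f h)) (q * heatSymbol η (υ * η))))
    (i : Fin d) (q : Symb d) :
    LocBigO U 5 (fun h p => ∑ k, dir k i * jet (fun h => f h k) q h p +
      2 * (P.w1 + 2 * ((d : ℝ) - 1) * P.w2) / P.s1 *
        (h * jet (fun h => density (f h)) (q * symX i) h p)) := by
  have h1 := jet_flux_popSymbol hd hP hC rfl (reg_density hU hh₀ hf) hheat i q
  refine (h1.add (LocBigO.sum Finset.univ fun k _ =>
    ((hslave k q).mono (by omega)).const_mul (dir k i))).congr_of_lt hh₀ fun h _ _ p _ => ?_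
  simp only [mul_sub, Finset.sum_sub_distrib]
  ring

/-- The relation between `ε = υ η` and the relaxation parameter `s₁`, which makes the velocity
formula consistent with the Cole-Hopf transformation. -/
theorem two_weight_eq (hd : 1 ≤ d) (hP : P.Admissible) (hC : Conditions d (υ * η) P) :
    (2 - P.s1) * (2 * (P.w1 + 2 * ((d : ℝ) - 1) * P.w2) / P.s1) = 2 * (υ * η) := by
  have h1 := (balance_of_conditions hd hP hC rfl).1
  have h2 : P.s1 ≠ 0 := hP.2.1.1.ne'
  rw [h1]
  field_simp

theorem weight_sum_ne_zero (hd : 1 ≤ d) (hυ : 0 < υ) (hη : 0 < η) (hP : P.Admissible)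
    (hC : Conditions d (υ * η) P) : P.w1 + 2 * ((d : ℝ) - 1) * P.w2 ≠ 0 := by
  intro h
  have h1 := two_weight_eq hd hP hC
  rw [h] at h1
  have : 0 < υ * η := mul_pos hυ hη
  simp at h1
  rcases h1 with h1 | h1 <;> linarith

/-- Accuracy of the gradient formula. -/
theorem locBigO_lbGradient (hd : 1 ≤ d) (hυ : 0 < υ) (hη : 0 < η) (hU : IsOpen U)
    (hP : P.Admissible) (hC : Conditions d (υ * η) P)
    (hh₀ : 0 < h₀) (hf : ∀ k, Reg U h₀ (fun h => f h k))
    (hslave : ∀ k q, LocBigO U 6 (fun h p => jet (fun h => f h k) q h p -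
      jet (fun h => density (f h)) (q * popSymbol P η k) h p))
    (hheat : ∀ q, LocBigO U 4 (jet (fun h => density (f h)) (q * heatSymbol η (υ * η))))
    (i : Fin d) :
    LocBigO U 4 (fun h p => lbGradient P η h (f h) i p - dx i (density (f h)) p) := by
  have h1 := jet_flux hd hU hP hC hh₀ hf hslave hheat i 1
  have hW0 := weight_sum_ne_zero hd hυ hη hP hC
  have hs : P.s1 ≠ 0 := hP.2.1.1.ne'
  refine LocBigO.of_pow_mul 1 ?_
  refine (h1.const_mul (-(P.s1 / (2 * (P.w1 + 2 * ((d : ℝ) - 1) * P.w2))))).congr_of_lt hh₀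
    fun h hh _ p _ => ?_
  rw [mul_sub, lbGradient_eq hη hh rfl hW0, one_mul, jet_symX]
  simp only [jet_one]
  field_simp
  ring

/-- Accuracy of the velocity formula, together with all derivatives of the numerator. -/
theorem jet_lbVelocity_numerator_sub (hd : 1 ≤ d) (hη : 0 < η) (hU : IsOpen U)
    (hP : P.Admissible) (hC : Conditions d (υ * η) P)
    (hh₀ : 0 < h₀) (hf : ∀ k, Reg U h₀ (fun h => f h k))
    (hslave : ∀ k q, LocBigO U 6 (fun h p => jet (fun h => f h k) q h p -
      jet (fun h => density (f h)) (q * popSymbol P η k) h p))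
    (hheat : ∀ q, LocBigO U 4 (jet (fun h => density (f h)) (q * heatSymbol η (υ * η))))
    (i : Fin d) (q : Symb d) :
    LocBigO U 4 (fun h p => jet (fun h p => (2 - P.s1) * flux P η h (f h) i p) q h p +
      2 * υ * jet (fun h => density (f h)) (q * symX i) h p) := by
  refine LocBigO.of_pow_mul 1 ?_
  refine ((jet_flux hd hU hP hC hh₀ hf hslave hheat i q).const_mul ((2 - P.s1) / η)).congr_of_lt
    hh₀ fun h hh hlt p hp => ?_
  rw [mul_add, jet_lbVelocity_numerator hU hη hf i q hh hlt hp]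
  have h1 := two_weight_eq hd hP hC
  have h2 : (2 - P.s1) / η * (2 * (P.w1 + 2 * ((d : ℝ) - 1) * P.w2) / P.s1) = 2 * υ := by
    rw [div_mul_eq_mul_div, h1]
    field_simp
  linear_combination (-h * jet (fun h => density (f h)) (q * symX i) h p) * h2

theorem contDiffOn_flux (hf : ∀ k, Reg U h₀ (fun h => f h k)) (i : Fin d) (h : ℝ) (hh : 0 < h)
    (hlt : h < h₀) : ContDiffOn ℝ ∞ (fun p => (2 - P.s1) * flux P η h (f h) i p) U := by
  simp only [flux_eq]
  exact contDiffOn_const.mul (contDiffOn_const.mul (ContDiffOn.sum fun k _ =>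
    contDiffOn_const.mul ((hf k).smooth h hh hlt)))

theorem lbVelocity_eq (h : ℝ) : lbVelocity P η h (f h) =
    fun i p => (2 - P.s1) * flux P η h (f h) i p / density (f h) p := by
  funext i p
  rw [lbVelocity, mul_div_assoc]

theorem fourthOrderModifiedEquation (hd : 1 ≤ d) (hυ : 0 < υ) (hη : 0 < η) (hP : P.Admissible)
    (hC : Conditions d (υ * η) P) : FourthOrderModifiedEquation d υ η P := by
  intro U f hU hreg hs
  obtain ⟨h₀, hh₀, hf⟩ := reg_of_regularFamily hU hreg
  have hslave := jet_eq_popSymbol hU hη hP hh₀ hf hs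
  have hheat := jet_heatSymbol hd hU hη hP hC hh₀ hf hs
  have hθ := reg_density hU hh₀ hf
  refine ⟨?_, locBigO_lbGradient hd hυ hη hU hP hC hh₀ hf hslave hheat, fun h0 => ?_⟩
  · refine locBigO_diffusionDefect hU hη hh₀ hθ.smooth ?_
    have h1 := hheat 1
    rwa [one_mul] at h1
  · have h1 := locBigO_burgers hU hη (φ := fun i h p => (2 - P.s1) * flux P η h (f h) i p) hθ
      (contDiffOn_flux hf) hheat
      (jet_lbVelocity_numerator_sub hd hη hU hP hC hh₀ hf hslave hheat) h0
    simp only [lbVelocity_eq]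
    exact h1

end Formulas

/-! ### Truncation error at exact solutions -/

section Truncation

variable {d : ℕ} {U : Set (SpaceTime d)} {υ η : ℝ} {P : Params} {θ : SpaceTime d → ℝ}

theorem continuousOn_iteratedFDeriv (hU : IsOpen U) (hθ : ContDiffOn ℝ ∞ θ U) (n : ℕ) :
    ContinuousOn (iteratedFDeriv ℝ n θ) U :=
  (hθ.continuousOn_iteratedFDerivWithin (m := n) (by exact_mod_cast le_top)
    hU.uniqueDiffOn).congr fun _ hp => (iteratedFDerivWithin_of_isOpen n hU hp).symm

/-- The distribution functions slaved to a conserved moment `θ` that does not depend on the lattice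
spacing. -/
def slaved (P : Params) (η : ℝ) (θ : SpaceTime d → ℝ) (h : ℝ) (k : Slot d) : SpaceTime d → ℝ :=
  jet (fun _ => θ) (popSymbol P η k) h

theorem regularFamily_slaved (hU : IsOpen U) (hθ : ContDiffOn ℝ ∞ θ U) :
    RegularFamily U (slaved P η θ) := by
  refine ⟨1, one_pos, fun h _ _ k => contDiffOn_diffOp hU hθ _, fun k n K hK hKc => ?_⟩
  have hsm (m : ℕ) := contDiffOn_diffOp hU hθ ((popSymbol P η k).coeff m)
  choose C hC using fun m => hKc.exists_bound_of_continuousOn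
    ((continuousOn_iteratedFDeriv hU (hsm m) n).mono hK)
  refine ⟨∑ m ∈ Finset.range ((popSymbol P η k).natDegree + 1), C m, fun h hh hlt p hp => ?_⟩
  have h1 : slaved P η θ h k = fun p => ∑ m ∈ Finset.range ((popSymbol P η k).natDegree + 1),
      (h ^ m • diffOp θ ((popSymbol P η k).coeff m)) p := by
    funext p
    rw [slaved, jet, Polynomial.eval_eq_sum_range, map_sum, Finset.sum_apply]
    refine Finset.sum_congr rfl fun m _ => ?_
    rw [← map_pow, mul_comm, diffOp_C_mul]
  have hat (m : ℕ) : ContDiffAt ℝ n (diffOp θ ((popSymbol P η k).coeff m)) p :=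
    ((hsm m).contDiffAt (hU.mem_nhds (hK hp))).of_le (by exact_mod_cast le_top)
  have h2 (m : ℕ) : ContDiffAt ℝ n (h ^ m • diffOp θ ((popSymbol P η k).coeff m)) p :=
    (hat m).const_smul (h ^ m)
  rw [h1, iteratedFDeriv_fun_sum_apply fun m _ => h2 m]
  refine (norm_sum_le _ _).trans (Finset.sum_le_sum fun m _ => ?_)
  rw [iteratedFDeriv_const_smul_apply (hat m), norm_smul, Real.norm_of_nonneg (by positivity)]
  exact (mul_le_of_le_one_left (norm_nonneg _) (pow_le_one₀ hh.le hlt.le)).trans (hC m p hp)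

theorem density_slaved (h : ℝ) : density (slaved P η θ h) = θ := by
  funext p
  simp only [density, slaved]
  rw [← jet_sum, sum_popSymbol, jet_one]

theorem reg_const (hU : IsOpen U) (hθ : ContDiffOn ℝ ∞ θ U) {h₀ : ℝ} (hh₀ : 0 < h₀) :
    Reg U h₀ (fun _ => θ) := by
  refine ⟨hh₀, fun _ _ _ => hθ, fun q K hK hKc => ?_⟩
  obtain ⟨C, hC⟩ := hKc.exists_bound_of_continuousOn
    ((contDiffOn_diffOp hU hθ q).continuousOn.mono hK)
  exact ⟨C, 1, one_pos, fun h _ _ p hp => by simpa using hC p hp⟩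

theorem jet_slaved (hU : IsOpen U) (hθ : ContDiffOn ℝ ∞ θ U) (k : Slot d) (q : Symb d) (h : ℝ)
    {p : SpaceTime d} (hp : p ∈ U) :
    jet (fun h => slaved P η θ h k) q h p = jet (fun _ => θ) (q * popSymbol P η k) h p :=
  (jet_mul (f := fun _ => θ) hU hθ _ _ hp).symm

theorem jet_heatSymbol_of_diffusionDefect (hU : IsOpen U) (hθ : ContDiffOn ℝ ∞ θ U)
    (hheat : ∀ p ∈ U, diffusionDefect υ θ p = 0) (q : Symb d) (h : ℝ)
    {p : SpaceTime d} (hp : p ∈ U) :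
    jet (fun _ => θ) (q * heatSymbol η (υ * η)) h p = 0 := by
  rw [jet_mul (f := fun _ => θ) hU hθ _ _ hp]
  have h1 : Set.EqOn (jet (fun _ => θ) (heatSymbol η (υ * η)) h) ((0 : ℝ) • (0 : SpaceTime d → ℝ))
      U := fun x hx => by
    rw [jet_heatSymbol_eq (θ := fun _ => θ) hU hθ hx, hheat x hx]
    simp
  rw [jet, diffOp_congr hU h1 _ hp, diffOp_smul]
  simp

/-- The defect of the slaved distribution functions, in moment space: modulo `h ^ 6` it is a multiple
of the symbol of the diffusion equation. -/
theorem collision_residual (hd : 1 ≤ d) (hP : P.Admissible) (hC : Conditions d (υ * η) P)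
    (r : Slot d) : ∃ q : Symb d, Polynomial.X ^ 6 ∣ moment (row r) (fun k =>
      incr η k * popSymbol P η k + ∑ l, collision d P 1 k l •
        (popSymbol P η l - algebraMap ℝ (Symb d) (weight P l))) - q * heatSymbol η (υ * η) := by
  have h1 : moment (row r) (fun k => incr η k * popSymbol P η k + ∑ l, collision d P 1 k l •
        (popSymbol P η l - algebraMap ℝ (Symb d) (weight P l))) =
      ∑ k, row r k • (incr η k * popSymbol P η k) +
      relax P r • (∑ k, row r k • popSymbol P η k -
        algebraMap ℝ (Symb d) (∑ k, row r k * weight P k)) := by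
    have h2 := moment_collision P r
      (fun l => popSymbol P η l - algebraMap ℝ (Symb d) (weight P l))
    simp only [moment] at h2 ⊢
    simp only [smul_add, Finset.sum_add_distrib, h2]
    congr 2
    simp only [map_sum, map_mul, Algebra.smul_def, mul_sub, Finset.sum_sub_distrib]
  rw [h1]
  by_cases hr : r = .inl ()
  · subst hr
    obtain ⟨Q, hQ⟩ := popSymbol_mass (η := η) hd hP hC
    refine ⟨Polynomial.X ^ 2 * (1 + Polynomial.X ^ 2 * Q), ?_⟩
    simp only [row, monomial, one_smul, one_mul, sum_popSymbol, equilibrium_zero, map_one, sub_self,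
      smul_zero, add_zero]
    rwa [mul_assoc]
  · refine ⟨0, ?_⟩
    rw [zero_mul, sub_zero]
    exact popSymbol_moment hr (relax_ne_zero hP r)

theorem locBigO_lbDefect_slaved (hd : 1 ≤ d) (hη : 0 < η) (hU : IsOpen U) (hP : P.Admissible)
    (hC : Conditions d (υ * η) P) (hθ : ContDiffOn ℝ ∞ θ U)
    (hheat : ∀ p ∈ U, diffusionDefect υ θ p = 0) (k : Slot d) :
    LocBigO U 6 (fun h => lbDefect P η h (slaved P η θ h) k) := by
  have hreg : Reg U 1 (fun _ => θ) := reg_const hU hθ one_pos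
  set res : Slot d → Symb d := fun k =>
      incr η k * popSymbol P η k + ∑ l, collision d P 1 k l •
        (popSymbol P η l - algebraMap ℝ (Symb d) (weight P l)) with hres
  have h1 (r : Slot d) : LocBigO U 6 (jet (fun _ => θ) (moment (row r) res)) := by
    obtain ⟨q, hq⟩ := collision_residual hd hP hC r
    refine (hreg.locBigO_of_dvd hq).congr_of_lt one_pos fun h _ _ p hp => ?_
    rw [jet_sub, jet_heatSymbol_of_diffusionDefect hU hθ hheat _ _ hp, sub_zero]
  have h2 : LocBigO U 6 (jet (fun _ => θ) (res k)) := by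
    refine (LocBigO.sum Finset.univ fun r _ =>
      (h1 r).const_mul ((momentMatrix d 1)⁻¹ k r)).congr_of_lt one_pos fun h _ _ p _ => ?_
    have h3 := congrFun (ofMoments_moment res) k
    rw [← h3, ofMoments, jet_sum]
    exact Finset.sum_congr rfl fun r _ => jet_smul _ _ _ _
  refine ((taylor_stream hU hη (hreg.jet hU (popSymbol P η k)) k).add h2).congr_of_lt one_pos
    fun h hh _ p hp => ?_
  rw [lbDefect_eq hη hh, sum_update_mul, ← jet_mul (f := fun _ => θ) hU hθ _ _ hp, hres]
  have h4 : ∑ m, slaved P η θ h m p = θ p := congrFun (density_slaved h) p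
  have h5 : shiftSymbol Polynomial.X (symT η) symX k = incr η k + 1 := by
    rw [incr, sub_add_cancel]
  rw [h4, h5]
  simp only [add_mul, one_mul, jet_add, jet_sum, jet_smul, jet_sub,
    Algebra.algebraMap_eq_smul_one, jet_one]
  simp only [slaved]
  ring

theorem fourthOrderTruncation (hd : 1 ≤ d) (hυ : 0 < υ) (hη : 0 < η) (hP : P.Admissible)
    (hC : Conditions d (υ * η) P) : FourthOrderTruncation d υ η P := by
  intro U θ hU hθ h0 hheat
  refine ⟨fun i p hp => burgersDefect_coleHopf hU hθ h0 hheat i hp,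
    fun i j p hp => symmetryDefect_coleHopf hU hθ h0 i j hp, slaved P η θ,
    regularFamily_slaved hU hθ, fun h _ p _ => congrFun (density_slaved h) p,
    locBigO_lbDefect_slaved hd hη hU hP hC hθ hheat, ?_⟩
  have hθr : Reg U 1 (fun _ => θ) := reg_const hU hθ one_pos
  have hf (k : Slot d) : Reg U 1 (fun h => slaved P η θ h k) := hθr.jet hU _
  have hden : (fun h => density (slaved P η θ h)) = fun _ => θ := funext density_slaved
  have hslave (k : Slot d) (q : Symb d) : LocBigO U 6 (fun h p =>
      jet (fun h => slaved P η θ h k) q h p -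
        jet (fun h => density (slaved P η θ h)) (q * popSymbol P η k) h p) := by
    refine LocBigO.zero.congr_of_lt one_pos fun h _ _ p hp => ?_
    rw [hden, jet_slaved hU hθ k q h hp, sub_self]
  have hheat' (q : Symb d) : LocBigO U 4
      (jet (fun h => density (slaved P η θ h)) (q * heatSymbol η (υ * η))) := by
    refine LocBigO.zero.congr_of_lt one_pos fun h _ _ p hp => ?_
    rw [hden, jet_heatSymbol_of_diffusionDefect hU hθ hheat q h hp]
  refine ⟨fun i => ?_, fun i => ?_⟩
  · have h1 := locBigO_lbGradient hd hυ hη hU hP hC one_pos hf hslave hheat' i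
    simp only [density_slaved] at h1
    exact h1
  · have h1 := (locBigO_burgers hU hη
      (φ := fun i h p => (2 - P.s1) * flux P η h (slaved P η θ h) i p) (hden ▸ hθr)
      (contDiffOn_flux hf) hheat'
      (jet_lbVelocity_numerator_sub hd hη hU hP hC one_pos hf hslave hheat')
      (fun K hK hKc => ?_)).1 i
    · simp only [lbVelocity_eq, density_slaved] at h1 ⊢
      exact h1
    · simp only [density_slaved]
      rcases K.eq_empty_or_nonempty with rfl | hne
      · exact ⟨1, 1, one_pos, one_pos, by simp⟩
      · obtain ⟨x, hx, hmin⟩ := hKc.exists_isMinOn hne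
          ((hθ.continuousOn.mono hK).abs)
        exact ⟨|θ x|, 1, abs_pos.2 (h0 x (hK hx)), one_pos, fun _ _ _ p hp => hmin hp⟩

end Truncation

/-! ### The explicit parameters -/

theorem explicitParams_admissible (d : ℕ) {ε s0 : ℝ} (hε : 0 < ε) (hs : s0 ∈ Set.Ioo (0 : ℝ) 2) :
    (explicitParams d ε s0).Admissible := by
  refine ⟨hs, ⟨?_, ?_⟩, ⟨?_, ?_⟩, ⟨?_, ?_⟩⟩ <;> simp only [explicitParams]
  · positivity
  · rw [div_lt_iff₀ (by positivity)]; linarith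
  · positivity
  · rw [div_lt_iff₀ (by positivity)]; nlinarith [sq_nonneg (6 * ε - 1), sq_nonneg ε]
  · positivity
  · rw [div_lt_iff₀ (by positivity)]; linarith

theorem explicitParams_conditions (d : ℕ) {ε s0 : ℝ} (hε : 0 < ε) :
    Conditions d ε (explicitParams d ε s0) := by
  have h1 : 6 * ε + 1 ≠ 0 := by positivity
  have h2 : 6 * ε + 3 ≠ 0 := by positivity
  refine ⟨fun hd => ?_, fun _ => ?_⟩
  · subst hd
    simp only [explicitParams, R1, Con1]
    refine ⟨?_, ?_, ?_⟩ <;> push_cast <;> field_simp <;> ring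
  · simp only [explicitParams, Rd1, Rd2, Cond1, Cond2]
    generalize (d : ℝ) = x
    refine ⟨?_, ?_, ?_, ?_, ?_⟩ <;> field_simp <;> ring

theorem fourthOrderAccurate {d : ℕ} (hd : 1 ≤ d) {υ η ε : ℝ} (hυ : 0 < υ) (hη : 0 < η)
    (hε : ε = υ * η) {P : Params} (hP : P.Admissible) (hC : Conditions d ε P) :
    FourthOrderAccurate d υ η P := by
  subst hε
  exact ⟨fourthOrderModifiedEquation hd hυ hη hP hC, fourthOrderTruncation hd hυ hη hP hC⟩

end MRTLB
end

theorem theorem2 (d : ℕ) (hd : 1 ≤ d) (υ η ε : ℝ) (hυ : 0 < υ) (hη : 0 < η)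
    (hε : ∀ h : ℝ, 0 < h → ε = υ * MRTLB.timeStep η h / h ^ 2) :
    (∀ P : MRTLB.Params, P.Admissible → MRTLB.Conditions d ε P →
      MRTLB.FourthOrderAccurate d υ η P) ∧
    (∀ s0 : ℝ, s0 ∈ Set.Ioo (0 : ℝ) 2 →
      (MRTLB.explicitParams d ε s0).Admissible ∧
      MRTLB.Conditions d ε (MRTLB.explicitParams d ε s0) ∧
      MRTLB.FourthOrderAccurate d υ η (MRTLB.explicitParams d ε s0)) := by
  have h1 : ε = υ * η := by
    rw [hε 1 one_pos, MRTLB.timeStep]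
    ring
  have h2 : 0 < ε := h1 ▸ mul_pos hυ hη
  refine ⟨fun P hP hC => MRTLB.fourthOrderAccurate hd hυ hη h1 hP hC, fun s0 hs => ?_⟩
  have hP := MRTLB.explicitParams_admissible d h2 hs
  have hC := MRTLB.explicitParams_conditions d (s0 := s0) h2
  exact ⟨hP, hC, MRTLB.fourthOrderAccurate hd hυ hη h1 hP hC⟩
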